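/- **Setting.** Let $\mathcal M=(\mathcal S,\mathcal A,r,c,P,\rho)$ be a constrained Markov decision process with finite state space $\mathcal S$ and finite action space $\mathcal A$, reward $r:\mathcal S\times\mathcal A\to[0,1]$, constraint cost $c:\mathcal S\times\mathcal A\to[-1,1]$, transition function $P$ and initial distribution $\rho$. For a policy $\pi:\mathcal S\to\Delta(\mathcal A)$ and $g\in\{r,c\}$ let $J_g^\pi=\lim_{N\to\infty}\frac1N\mathbb E_\pi[\sum_{t<N}g(s_t,a_t)\mid s_0\sim\rho]$. Assume that under every policy the state chain is irreducible and aperiodic; let $d^\pi$ be its stationary distribution, $P^\pi$ its transition matrix, $\nu^\pi(s,a)=d^\pi(s)\pi(a|s)$, $Q_g^\pi(s,a)=\mathbb E_\pi[\sum_{t\ge0}(g(s_t,a_t)-J_g^\pi)\mid s_0=s,a_0=a]$, $V_g^\pi(s)=\mathbb E_{a\sim\pi(s)}Q_g^\pi(s,a)$ and $A_g^\pi=Q_g^\pi-V_g^\pi$. Let $\{\pi_\theta\}_{\theta\in\mathbb R^d}$ be a class of policies with $\pi_\theta(a|s)>0$ differentiable in $\theta$, and write $J_g(\theta)=J_g^{\pi_\theta}$.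 Let $\tau_{\rm mix}=\sup_\theta\min\{t\ge1:\|(P^{\pi_\theta})^t(s,\cdot)-d^{\pi_\theta}\|_{\rm TV}\le\frac14\ \forall s\}$. Let $\pi^*$ be a solution of $\max_\pi J_r^\pi$ subject to $J_c^\pi\ge0$ over all policies. Let $\phi_g:\mathcal S\to\mathbb R^m$ be features with $\|\phi_g(s)\|\le1$. Write $\mathbb E_\theta$ for the expectation over $z=(s,a,s')$ with $(s,a)\sim\nu^{\pi_\theta}$, $s'\sim P(s,a)$, and put $$\mathbf A_g(z)=\begin{pmatrix}c_\gamma&0\\ \phi_g(s)&\phi_g(s)(\phi_g(s)-\phi_g(s'))^\top\end{pmatrix},\qquad \mathbf b_g(z)=\begin{pmatrix}c_\gamma g(s,a)\\ g(s,a)\phi_g(s)\end{pmatrix},$$ and $[\eta_g^*(\theta),\zeta_g^*(\theta)]=(\mathbb E_\theta\mathbf A_g(z))^{-1}\mathbb E_\theta\mathbf b_g(z)$. **Assumptions**, with constants $\delta\in(0,1)$, $\lambda,\mu,G_1,G_2>0$ and $c_\gamma\ge\lambda+\sqrt{\max(\lambda^{-2}-1,0)}$: (1) $J_c(\bar\theta)\ge\delta$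 for some $\bar\theta$; (2) $\epsilon_{\rm app}:=\max_{g}\sup_\theta\mathbb E_{s\sim d^{\pi_\theta}}[(\zeta_g^*(\theta)^\top\phi_g(s)-V_g^{\pi_\theta}(s))^2]<\infty$; (3) $x^\top\mathbb E_\theta[\phi_g(s)(\phi_g(s)-\phi_g(s'))^\top]x\ge\lambda\|x\|^2$ for all $x,\theta,g$; (4) with $L_\nu(\omega,\theta,\ell)=\mathbb E_{(s,a)\sim\nu}[(\nabla_\theta\log\pi_\theta(a|s)\cdot\omega-A_r^{\pi_\theta}(s,a)-\ell A_c^{\pi_\theta}(s,a))^2]$ and $\omega^*_{\theta,\ell}=\arg\min_\omega L_{\nu^{\pi_\theta}}(\omega,\theta,\ell)$, one has $L_{\nu^{\pi^*}}(\omega^*_{\theta,\ell},\theta,\ell)\le\epsilon_{\rm bias}$ for all $\theta$ and $\ell\in[0,2/\delta]$; (5) $\|\nabla_\theta\log\pi_\theta(a|s)\|\le G_1$, and $\theta\mapsto\nabla_\theta\log\pi_\theta(a|s)$ is $G_2$-Lipschitz, for all $s,a$; (6) $F(\theta)-\mu I\succeq0$ for all $\theta$, where $F(\theta)=\mathbb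 E_{\nu^{\pi_\theta}}[\nabla_\theta\log\pi_\theta(a|s)\,\nabla_\theta\log\pi_\theta(a|s)^\top]$. **Algorithm (PDNAC).** Start from an arbitrary $\theta_0$, $\lambda_0=0$, and a current state $s_0\sim\rho$. An inner step of epoch $k$ draws $Q\in\{1,2,\dots\}$ with $\Pr(Q=j)=2^{-j}$ and runs $\pi_{\theta_k}$ from the current state for $2^Q$ transitions if $2^Q\le T_{\max}$, and for one transition otherwise; the last state becomes the current state. From the transitions $z^0,z^1,\dots$ it forms, for a function $f$, the estimate $\mathrm{MLMC}(f)=f^0+2^Q(f^Q-f^{Q-1})\mathbf 1(2^Q\le T_{\max})$, where $f^j=2^{-j}\sum_{t<2^j}f(z^t)$. Epoch $k$ performs $H$ critic steps $\xi_g\leftarrow\xi_g-\gamma_\xi\,\mathrm{MLMC}(z\mapsto\mathbf A_g(z)\xi_g-\mathbf b_g(z))$ from $\xi_g=0$, giving $\xi_g^k=[\eta_g^k,\zeta_g^k]$; then $H$ actor steps $\omega_g\leftarrow\omega_g-\gamma_\omega\,\mathrm{MLMC}(\psi)$ from $\omega_g=0$, giving $\omega_g^k$, where $\psi(s,a,s')=u\,u^\top\omega_g-[g(s,a)-\eta_g^k+(\zeta_g^k)^\top(\phi_g(s')-\phi_g(s))]\,u$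 with $u=\nabla_\theta\log\pi_{\theta_k}(a|s)$ (both $g\in\{r,c\}$ use the same samples); then it sets $\theta_{k+1}=\theta_k+\alpha(\omega_r^k+\lambda_k\omega_c^k)$ and $\lambda_{k+1}=\mathcal P_{[0,2/\delta]}[\lambda_k-\beta\eta_c^k]$. **Theorem.** There are a constant $C_0>0$ and exponents $p_0,p\in\mathbb N$ depending only on $(G_1,G_2,\mu,\lambda,c_\gamma,\delta)$, and a constant $C$ depending only on these, on $\tau_{\rm mix}$ and on $\mathbb E_{s\sim d^{\pi^*}}[KL(\pi^*(\cdot|s)\,\|\,\pi_{\theta_0}(\cdot|s))]$, such that the following holds for every $\epsilon\in(0,1)$ and every integer $T\ge2$. Run the algorithm with $\alpha=\beta=T^{-1/2}$, $H=T^\epsilon$, $K=T^{1-\epsilon}$ (each rounded up or down to an integer), $\gamma_\omega=\frac{2\log T}{\mu H}$, $\gamma_\xi=\frac{2\log T}{\lambda H}$, $T_{\max}=T$; none of these choices uses $\tau_{\rm mix}$. If $T^\epsilon\ge C_0\,\tau_{\rm mix}^2(\log T)^{p_0}$, then $$\frac1K\sum_{k=0}^{K-1}\mathbb E\big[J_r^{\pi^*}-J_r(\theta_k)\big]\le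 C(\log T)^p\Big(\sqrt{\epsilon_{\rm bias}}+\sqrt{\epsilon_{\rm app}}+T^{-(1/2-\epsilon)}\Big),$$ $$\frac1K\sum_{k=0}^{K-1}\mathbb E\big[-J_c(\theta_k)\big]\le C(\log T)^p\Big(\sqrt{\epsilon_{\rm bias}}+\sqrt{\epsilon_{\rm app}}+T^{-(1/2-\epsilon)}\Big).$$ -/

import Mathlib

open Filter Finset Matrix

namespace PDNAC

/-- The two signals of a constrained MDP: the reward `r` and the constraint cost `c`. -/
inductive Sig where
  | r
  | c

/-- A constrained Markov decision process with reward in `[0,1]`, constraint cost in `[-1,1]`,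
transition function `P` and initial distribution `ρ`. -/
structure CMDP (S A : Type*) where
  r : S → A → ℝ
  c : S → A → ℝ
  P : S → A → PMF S
  ρ : PMF S
  r_mem : ∀ s a, r s a ∈ Set.Icc (0 : ℝ) 1
  c_mem : ∀ s a, c s a ∈ Set.Icc (-1 : ℝ) 1

/-- A (stationary, randomized) policy. -/
abbrev Policy (S A : Type*) := S → PMF A

/-- A policy class indexed by parameters in `ℝ^d`. -/
abbrev PolicyClass (S A : Type*) (d : ℕ) := EuclideanSpace ℝ (Fin d) → Policy S A

/-- Feature maps `φ_r, φ_c : S → ℝ^m` of the linear critics. -/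
abbrev Features (S : Type*) (m : ℕ) := Sig → S → EuclideanSpace ℝ (Fin m)

/-- The critic variable `ξ = [η, ζ]`: `ξ (inl ())` is `η` and `ξ (inr i)` is `ζ_i`. -/
abbrev CriticVec (m : ℕ) := Unit ⊕ Fin m → ℝ

/-- The expectation of a real function under a discrete law. -/
noncomputable def expect {X : Type*} (p : PMF X) (f : X → ℝ) : ℝ := ∑' x, (p x).toReal * f x

section Model

variable {S A : Type*} [Fintype S] [DecidableEq S] [Fintype A]

/-- The function `g ∈ {r, c}` named by a signal. -/
def CMDP.sig (M : CMDP S A) : Sig → S → A → ℝ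
  | .r => M.r
  | .c => M.c

/-- The transition matrix `P^π(s, s') = ∑_a π(a|s) P(s'|s,a)` of the chain induced by `π`. -/
noncomputable def CMDP.transMat (M : CMDP S A) (π : Policy S A) : Matrix S S ℝ :=
  Matrix.of fun s s' => ∑ a, (π s a).toReal * (M.P s a s').toReal

/-- `E_{a ∼ π(s)} g(s, a)`. -/
noncomputable def CMDP.sigMean (M : CMDP S A) (g : Sig) (π : Policy S A) (s : S) : ℝ :=
  ∑ a, (π s a).toReal * M.sig g s a

/-- The long-run average `J_g^π = lim_N (1/N) E_π[∑_{t<N} g(s_t,a_t) | s_0 ∼ ρ]`, where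
`s_t` has law `ρ (P^π)^t`. -/
noncomputable def CMDP.J (M : CMDP S A) (g : Sig) (π : Policy S A) : ℝ :=
  limUnder atTop fun N : ℕ => (N : ℝ)⁻¹ * ∑ t ∈ range N,
    ((fun s => (M.ρ s).toReal) ᵥ* (M.transMat π) ^ t) ⬝ᵥ M.sigMean g π

/-- A Markov matrix is aperiodic if the return times of every state have greatest common
divisor one. -/
def IsAperiodic (P : Matrix S S ℝ) : Prop :=
  ∀ s, ∀ k : ℕ, (∀ n : ℕ, 1 ≤ n → 0 < (P ^ n) s s → k ∣ n) → k = 1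

/-- Ergodicity: under every policy the state chain is irreducible and aperiodic. -/
def CMDP.IsErgodic (M : CMDP S A) : Prop :=
  ∀ π : Policy S A, (M.transMat π).IsIrreducible ∧ IsAperiodic (M.transMat π)

/-- `v` is a stationary distribution of the chain induced by `π`. -/
def CMDP.IsStationary (M : CMDP S A) (π : Policy S A) (v : S → ℝ) : Prop :=
  v ∈ stdSimplex ℝ S ∧ v ᵥ* M.transMat π = v

/-- The stationary distribution `d^π` (it exists, and is unique if the CMDP is ergodic). -/
noncomputable def CMDP.statDist (M : CMDP S A) (π : Policy S A) : S → ℝ :=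
  Classical.epsilon (M.IsStationary π)

/-- The occupancy measure `ν^π(s, a) = d^π(s) π(a|s)`. -/
noncomputable def CMDP.occ (M : CMDP S A) (π : Policy S A) (s : S) (a : A) : ℝ :=
  M.statDist π s * (π s a).toReal

/-- The mixing time of the chain of `π`: the least `t ≥ 1` such that from every initial state the
total variation distance of `s_t` to stationarity is at most `1/4`. -/
noncomputable def CMDP.mixTime (M : CMDP S A) (π : Policy S A) : ℕ :=
  sInf {t : ℕ | 1 ≤ t ∧
    ∀ s, (1 / 2 : ℝ) * ∑ s', |((M.transMat π) ^ t) s s' - M.statDist π s'| ≤ 1 / 4}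

/-- `E_π[g(s_t, a_t) | s_0 = s, a_0 = a]`. -/
noncomputable def CMDP.condMean (M : CMDP S A) (g : Sig) (π : Policy S A) :
    ℕ → S → A → ℝ
  | 0, s, a => M.sig g s a
  | t + 1, s, a =>
      ∑ s', (M.P s a s').toReal * ((M.transMat π) ^ t *ᵥ M.sigMean g π) s'

/-- The action-value function `Q_g^π`. -/
noncomputable def CMDP.Q (M : CMDP S A) (g : Sig) (π : Policy S A) (s : S) (a : A) : ℝ :=
  ∑' t : ℕ, (M.condMean g π t s a - M.J g π)

/-- The state-value function `V_g^π`. -/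
noncomputable def CMDP.V (M : CMDP S A) (g : Sig) (π : Policy S A) (s : S) : ℝ :=
  ∑ a, (π s a).toReal * M.Q g π s a

/-- The advantage function `A_g^π`. -/
noncomputable def CMDP.Adv (M : CMDP S A) (g : Sig) (π : Policy S A) (s : S) (a : A) : ℝ :=
  M.Q g π s a - M.V g π s

/-- `π` solves `max_π J_r^π` subject to `J_c^π ≥ 0`, over all policies. -/
def CMDP.IsOptimal (M : CMDP S A) (π : Policy S A) : Prop :=
  0 ≤ M.J .c π ∧ ∀ π' : Policy S A, 0 ≤ M.J .c π' → M.J .r π' ≤ M.J .r π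

/-- `E_{s ∼ d^{π}} KL(π(·|s) ‖ π'(·|s))`. -/
noncomputable def CMDP.avgKL (M : CMDP S A) (π π' : Policy S A) : ℝ :=
  ∑ s, M.statDist π s *
    ∑ a, (π s a).toReal * Real.log ((π s a).toReal / (π' s a).toReal)

end Model

section Parametrized

variable {S A : Type*} [Fintype S] [DecidableEq S] [Fintype A] {d m : ℕ}

/-- The overall mixing time `τ_mix = sup_θ τ_mix^θ`. -/
noncomputable def CMDP.tauMix (M : CMDP S A) (π : PolicyClass S A d) : ℕ :=
  ⨆ θ, M.mixTime (π θ)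

/-- The score `∇_θ log π_θ(a|s)`. -/
noncomputable def score (π : PolicyClass S A d) (θ : EuclideanSpace ℝ (Fin d)) (s : S) (a : A) :
    EuclideanSpace ℝ (Fin d) :=
  gradient (fun θ' => Real.log (π θ' s a).toReal) θ

/-- The Fisher information matrix `F(θ)`. -/
noncomputable def CMDP.fisher (M : CMDP S A) (π : PolicyClass S A d)
    (θ : EuclideanSpace ℝ (Fin d)) : Matrix (Fin d) (Fin d) ℝ :=
  ∑ s, ∑ a, M.occ (π θ) s a • vecMulVec (score π θ s a).ofLp (score π θ s a).ofLp

/-- The compatible function approximation loss `L_ν(ω, θ, ℓ)` with multiplier `ℓ`. -/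
noncomputable def CMDP.loss (M : CMDP S A) (π : PolicyClass S A d) (ν : S → A → ℝ)
    (ω θ : EuclideanSpace ℝ (Fin d)) (l : ℝ) : ℝ :=
  ∑ s, ∑ a, ν s a *
    (inner ℝ (score π θ s a) ω - M.Adv .r (π θ) s a - l * M.Adv .c (π θ) s a) ^ 2

/-- A transition sample `z = (s, a, s')`. -/
abbrev Sample (S A : Type*) := S × A × S

/-- The expectation `E_θ` over `z = (s, a, s')` with `(s, a) ∼ ν^{π}` and `s' ∼ P(s, a)`. -/
noncomputable def CMDP.statMean {W : Type*} [AddCommMonoid W] [Module ℝ W] (M : CMDP S A)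
    (π : Policy S A) (f : Sample S A → W) : W :=
  ∑ s, ∑ a, ∑ s', (M.occ π s a * (M.P s a s').toReal) • f (s, a, s')

/-- The feature matrix `φ_g(s) (φ_g(s) - φ_g(s'))ᵀ`. -/
def featMat (φ : Features S m) (g : Sig) (z : Sample S A) : Matrix (Fin m) (Fin m) ℝ :=
  vecMulVec (φ g z.1).ofLp ((φ g z.1).ofLp - (φ g z.2.2).ofLp)

/-- The matrix `A_g(θ; z)` of the critic update. -/
def criticA (φ : Features S m) (cγ : ℝ) (g : Sig) (z : Sample S A) :
    Matrix (Unit ⊕ Fin m) (Unit ⊕ Fin m) ℝ :=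
  Matrix.fromBlocks (Matrix.of fun _ _ => cγ) 0
    (Matrix.of fun i _ => (φ g z.1).ofLp i) (featMat φ g z)

/-- The vector `b_g(θ; z)` of the critic update. -/
def CMDP.criticB (M : CMDP S A) (φ : Features S m) (cγ : ℝ) (g : Sig) (z : Sample S A) :
    CriticVec m :=
  Sum.elim (fun _ => cγ * M.sig g z.1 z.2.1) (fun i => M.sig g z.1 z.2.1 * (φ g z.1).ofLp i)

/-- The critic limit `ξ_g^*(θ) = A_g(θ)⁻¹ b_g(θ)`. -/
noncomputable def CMDP.criticOpt (M : CMDP S A) (φ : Features S m) (cγ : ℝ) (g : Sig)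
    (π : Policy S A) : CriticVec m :=
  (M.statMean π (criticA φ cγ g))⁻¹ *ᵥ M.statMean π (M.criticB φ cγ g)

/-- The critic approximation error `E_{s ∼ d^π} [ζ_g^*ᵀ φ_g(s) - V_g^π(s)]²`. -/
noncomputable def CMDP.criticErr (M : CMDP S A) (φ : Features S m) (cγ : ℝ) (g : Sig)
    (π : Policy S A) : ℝ :=
  ∑ s, M.statDist π s *
    ((∑ i, M.criticOpt φ cγ g π (Sum.inr i) * (φ g s).ofLp i) - M.V g π s) ^ 2

/-- The worst-case critic approximation error `ε_app`, the larger of the suprema over `θ` for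
the two signals. -/
noncomputable def CMDP.epsApp (M : CMDP S A) (π : PolicyClass S A d) (φ : Features S m)
    (cγ : ℝ) : ℝ :=
  max (⨆ θ, M.criticErr φ cγ .r (π θ)) (⨆ θ, M.criticErr φ cγ .c (π θ))

end Parametrized

section Assumptions

variable {S A : Type*} [Fintype S] [DecidableEq S] [Fintype A] {d m : ℕ}

/-- Slater condition with parameter `δ`. -/
def CMDP.Slater (M : CMDP S A) (π : PolicyClass S A d) (δ : ℝ) : Prop :=
  ∃ θ, δ ≤ M.J .c (π θ)

/-- The worst-case critic approximation error is finite. -/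
def CMDP.CriticErrFinite (M : CMDP S A) (π : PolicyClass S A d) (φ : Features S m)
    (cγ : ℝ) : Prop :=
  ∀ g, BddAbove (Set.range fun θ => M.criticErr φ cγ g (π θ))

/-- `E_θ[φ_g(s)(φ_g(s) - φ_g(s'))ᵀ] - κ I` is positive semidefinite (as a quadratic form; the
matrix need not be symmetric) for all `θ` and `g`. -/
def CMDP.CriticPosDef (M : CMDP S A) (π : PolicyClass S A d) (φ : Features S m)
    (κ : ℝ) : Prop :=
  ∀ g θ, ∀ x : Fin m → ℝ, κ * (x ⬝ᵥ x) ≤ x ⬝ᵥ (M.statMean (π θ) (featMat φ g) *ᵥ x)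

/-- The transferred compatible function approximation error is at most `εbias`: for all `θ` and
`ℓ ∈ [0, 2/δ]`, the minimizer `ω` of `L_{ν^{π_θ}}(·, θ, ℓ)` has `L_{ν^{π*}}(ω, θ, ℓ) ≤ εbias`. -/
def CMDP.BiasBound (M : CMDP S A) (π : PolicyClass S A d) (πstar : Policy S A)
    (δ εbias : ℝ) : Prop :=
  ∀ θ, ∀ l ∈ Set.Icc (0 : ℝ) (2 / δ), ∀ ω,
    (∀ ω', M.loss π (M.occ (π θ)) ω θ l ≤ M.loss π (M.occ (π θ)) ω' θ l) →
    M.loss π (M.occ πstar) ω θ l ≤ εbias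

/-- The score exists, is bounded by `G₁`, and is `G₂`-Lipschitz in the parameter. -/
structure ScoreBounds (π : PolicyClass S A d) (G₁ G₂ : ℝ) : Prop where
  pos : ∀ θ s a, 0 < (π θ s a).toReal
  diff : ∀ s a, Differentiable ℝ fun θ => (π θ s a).toReal
  bound : ∀ θ s a, ‖score π θ s a‖ ≤ G₁
  lip : ∀ θ₁ θ₂ s a, ‖score π θ₁ s a - score π θ₂ s a‖ ≤ G₂ * ‖θ₁ - θ₂‖

/-- Fisher non-degeneracy: `F(θ) - μ I` is positive semidefinite for all `θ`. -/
def CMDP.FisherNonDeg (M : CMDP S A) (π : PolicyClass S A d) (μ : ℝ) : Prop :=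
  ∀ θ, (M.fisher π θ - μ • (1 : Matrix (Fin d) (Fin d) ℝ)).PosSemidef

end Assumptions

section Algorithm

/-- The geometric law with success probability `1/2` on `{1, 2, …}`: `Pr(n) = 2^{-n}`. -/
noncomputable def geomHalf : PMF ℕ :=
  ⟨fun n => if n = 0 then 0 else (2⁻¹ : ENNReal) ^ n, by
    have h : ∑' n : ℕ, (if n = 0 then 0 else (2⁻¹ : ENNReal) ^ n) = 1 := by
      rw [tsum_eq_zero_add' ENNReal.summable]
      simp only [if_true, Nat.succ_ne_zero, if_false, zero_add]
      rw [ENNReal.tsum_geometric_add_one, ENNReal.one_sub_inv_two, inv_inv]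
      exact ENNReal.inv_mul_cancel (by simp) (by simp)
    exact h ▸ ENNReal.summable.hasSum⟩

/-- Run a random step `n` times. -/
noncomputable def iter {X : Type*} (step : X → PMF X) : ℕ → X → PMF X
  | 0, x => PMF.pure x
  | n + 1, x => (iter step n x).bind step

/-- The Multi-Level Monte Carlo combination, at level `q` with truncation `Tmax`, of the values
of `f` along a list of samples: `f⁰ + 2^q (f^q - f^{q-1})` if `2^q ≤ Tmax`, and `f⁰` otherwise,
where `f^j` is the mean of `f` over the first `2^j` samples. -/
noncomputable def mlmc {Z W : Type*} [AddCommGroup W] [Module ℝ W] (Tmax q : ℕ) (zs : List Z)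
    (f : Z → W) : W :=
  let avg : ℕ → W := fun j => ((2 : ℝ) ^ j)⁻¹ • ((zs.take (2 ^ j)).map f).sum
  avg 0 + if 2 ^ q ≤ Tmax then (2 : ℝ) ^ q • (avg q - avg (q - 1)) else 0

/-- The number of samples drawn at level `q`. -/
def trajLen (Tmax q : ℕ) : ℕ := (if 2 ^ q ≤ Tmax then 2 ^ q - 1 else 0) + 1

/-- Step sizes and loop parameters of the algorithm: primal step `α`, dual step `β`, actor step
`γω`, critic step `γξ`, critic constant `cγ`, Slater parameter `δ`, inner loop size `H`,
truncation level `Tmax`. -/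
structure Params where
  α : ℝ
  β : ℝ
  γω : ℝ
  γξ : ℝ
  cγ : ℝ
  δ : ℝ
  H : ℕ
  Tmax : ℕ

variable {S A : Type*} {d m : ℕ}

/-- A trajectory of `n` transitions under `π` from `s`: the list of the samples
`(s_t, a_t, s_{t+1})`, `t < n`, together with the final state `s_n`. -/
noncomputable def CMDP.traj (M : CMDP S A) (π : Policy S A) :
    ℕ → S → PMF (List (Sample S A) × S)
  | 0, s => PMF.pure ([], s)
  | n + 1, s => (π s).bind fun a => (M.P s a).bind fun s' =>
      (M.traj π n s').map fun x => ((s, a, s') :: x.1, x.2)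

/-- One critic step: draw a level and a trajectory from the current state, and update the critic
variables of both signals with `v_g(θ, ξ; z) = A_g(θ; z) ξ - b_g(θ; z)`. -/
noncomputable def CMDP.criticStep (M : CMDP S A) (φ : Features S m) (p : Params)
    (π : Policy S A) (x : (Sig → CriticVec m) × S) : PMF ((Sig → CriticVec m) × S) :=
  geomHalf.bind fun q => (M.traj π (trajLen p.Tmax q) x.2).map fun y =>
    (fun g => x.1 g - p.γξ • mlmc p.Tmax q y.1
      (fun z => criticA φ p.cγ g z *ᵥ x.1 g - M.criticB φ p.cγ g z), y.2)

/-- The temporal difference `g(s,a) - η + ζᵀ(φ_g(s') - φ_g(s))`. -/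
def CMDP.tdErr (M : CMDP S A) (φ : Features S m) (g : Sig) (ξ : CriticVec m)
    (z : Sample S A) : ℝ :=
  M.sig g z.1 z.2.1 - ξ (Sum.inl ()) +
    ∑ i, ξ (Sum.inr i) * ((φ g z.2.2).ofLp i - (φ g z.1).ofLp i)

/-- One actor step: draw a level and a trajectory from the current state, and update the natural
gradient estimates of both signals with the stochastic gradient
`(∇log π ⊗ ∇log π) ω - (TD error) ∇log π`. -/
noncomputable def CMDP.actorStep (M : CMDP S A) (φ : Features S m) (p : Params)
    (π : PolicyClass S A d) (θ : EuclideanSpace ℝ (Fin d)) (ξ : Sig → CriticVec m)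
    (x : (Sig → EuclideanSpace ℝ (Fin d)) × S) : PMF ((Sig → EuclideanSpace ℝ (Fin d)) × S) :=
  geomHalf.bind fun q => (M.traj (π θ) (trajLen p.Tmax q) x.2).map fun y =>
    (fun g => x.1 g - p.γω • mlmc p.Tmax q y.1
      (fun z => inner ℝ (score π θ z.1 z.2.1) (x.1 g) • score π θ z.1 z.2.1
        - M.tdErr φ g (ξ g) z • score π θ z.1 z.2.1), y.2)

/-- One epoch of the outer loop, acting on (policy parameter, dual variable, current state):
`H` critic steps from `ξ = 0`, then `H` actor steps from `ω = 0`, then the primal update and the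
dual update projected onto `[0, 2/δ]`. -/
noncomputable def CMDP.epoch (M : CMDP S A) (φ : Features S m) (p : Params)
    (π : PolicyClass S A d) (x : EuclideanSpace ℝ (Fin d) × ℝ × S) :
    PMF (EuclideanSpace ℝ (Fin d) × ℝ × S) :=
  (iter (M.criticStep φ p (π x.1)) p.H (fun _ => 0, x.2.2)).bind fun y =>
    (iter (M.actorStep φ p π x.1 y.1) p.H (fun _ => 0, y.2)).map fun w =>
      (x.1 + p.α • (w.1 .r + x.2.1 • w.1 .c),
        max 0 (min (2 / p.δ) (x.2.1 - p.β * y.1 .c (Sum.inl ()))),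
        w.2)

/-- The law of (policy parameter `θ_k`, dual variable, current state) at the start of epoch `k`,
from the initial parameter `θ₀`, dual variable `0` and a state drawn from `ρ`. -/
noncomputable def CMDP.algLaw (M : CMDP S A) (φ : Features S m) (p : Params)
    (π : PolicyClass S A d) (θ₀ : EuclideanSpace ℝ (Fin d)) (k : ℕ) :
    PMF (EuclideanSpace ℝ (Fin d) × ℝ × S) :=
  M.ρ.bind fun s => iter (M.epoch φ p π) k (θ₀, 0, s)

end Algorithm

end PDNAC

/-! The proof is a Lyapunov argument for the primal-dual iteration. For a multiplier `l` in `[0,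
2/δ]` the potential is the averaged KL divergence from `πstar` to the current policy divided by `α`,
plus `(λ_k - l)² / (2β)`. One epoch lowers its mean by the Lagrangian gap `J_r* - J_r - l J_c`, up
to a small error (`IsRegular.potential_drift`). The smoothness of the log-policies makes the KL term
fall by the inner product of the direction `ω_r + λ_k ω_c` with the mean score under `πstar`. For
the exact natural gradient direction, the performance difference identity and the bias assumption
bound this product below by the Lagrangian gap at `λ_k` minus `√εbias` (`lagrangian_gap_le`); the
dual step exchanges `λ_k` for `l`. Telescoping and dividing by `K` bounds the averaged gap. Taking
`l = 0` gives the reward bound. Taking `l = 2/δ` gives the constraint bound, because strong duality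
provides an optimal multiplier at most `1/δ` (`exists_multiplier`, `average_violation_le`).

Given the state at the start of an epoch, the estimates enter the drift linearly through their
conditional means, and quadratically only with a factor `α` or `β`. So their bias has to be small,
while a bounded second moment suffices. This is what MLMC provides. The level weight `2^Q` cancels
the probability `2^{-Q}`, so the mean telescopes to that of an average over about `T` samples, with
bias `O(τ/T)`, while the second moment grows only like `log T` (`norm_mean_mlmc_sub_le`,
`mean_mlmc_sq_le`). Both bounds follow from the Poisson equation of the chain, whose solution has
size `O(τ)` because deviations from stationarity halve over each mixing time.

Critic and actor are two instances of one scheme, linear stochastic approximation with a strongly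
monotone mean operator (`IsLinearSA`): after `H` steps the mean error has contracted exponentially
and the second moment has stayed bounded. The temporal difference is affine in the critic, so the
actor's conditional mean inherits the mean of the critic error, not its size. What survives is
`√ε_app`, from the mismatch between the critic limit and the value function. The burn-in condition
on `T^ε` makes the step sizes small enough for these recursions to contract. -/

set_option linter.unusedSectionVars false
namespace PDNAC

/-! ### Expectations under finitely supported laws, where no summability question arises. -/

section FiniteSupport

/-- A discrete law with finite support. -/
class FinSupp {X : Type*} (p : PMF X) : Prop where
  finite : p.support.Finite

variable {X Y E F : Type*} [NormedAddCommGroup E] [NormedSpace ℝ E]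
  [NormedAddCommGroup F] [NormedSpace ℝ F]

instance instFinSuppFintype [Finite X] (p : PMF X) : FinSupp p := ⟨Set.toFinite _⟩

instance instFinSuppPure (x : X) : FinSupp (PMF.pure x) := ⟨by simp⟩

instance instFinSuppBind (p : PMF X) (k : X → PMF Y) [hp : FinSupp p] [hk : ∀ x, FinSupp (k x)] :
    FinSupp (p.bind k) :=
  ⟨by rw [PMF.support_bind]; exact hp.finite.biUnion fun x _ => (hk x).finite⟩

instance instFinSuppMap (p : PMF X) (f : X → Y) [hp : FinSupp p] : FinSupp (p.map f) :=
  ⟨by rw [PMF.support_map]; exact hp.finite.image f⟩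

instance instFinSuppIter (step : X → PMF X) [∀ x, FinSupp (step x)] (n : ℕ) (x : X) :
    FinSupp (iter step n x) := by
  induction n with
  | zero => exact instFinSuppPure x
  | succ n ih => exact instFinSuppBind _ _

/-- The vector-valued expectation under a discrete law. -/
noncomputable def mean (p : PMF X) (f : X → E) : E := ∑' x, (p x).toReal • f x

theorem expect_eq_mean (p : PMF X) (f : X → ℝ) : expect p f = mean p f := rfl

theorem mean_eq_sum_of_subset (p : PMF X) (t : Finset X) (ht : p.support ⊆ t) (f : X → E) :
    mean p f = ∑ x ∈ t, (p x).toReal • f x := by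
  refine tsum_eq_sum fun x hx => ?_
  have : p x = 0 := by
    rw [PMF.apply_eq_zero_iff]
    exact fun h => hx (ht h)
  simp [this]

theorem mean_eq_sum (p : PMF X) [hp : FinSupp p] (f : X → E) :
    mean p f = ∑ x ∈ hp.finite.toFinset, (p x).toReal • f x :=
  mean_eq_sum_of_subset p _ (by simp) f

theorem mean_fintype [Fintype X] (p : PMF X) (f : X → E) :
    mean p f = ∑ x, (p x).toReal • f x := tsum_fintype _

theorem sum_toReal_of_subset (p : PMF X) (t : Finset X) (ht : p.support ⊆ t) :
    ∑ x ∈ t, (p x).toReal = 1 := by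
  rw [← ENNReal.toReal_sum fun x _ => p.apply_ne_top x]
  have : ∑ x ∈ t, p x = 1 := by
    rw [← p.tsum_coe]
    refine (tsum_eq_sum fun x hx => ?_).symm
    rw [PMF.apply_eq_zero_iff]
    exact fun h => hx (ht h)
  simp [this]

theorem sum_toReal [Fintype X] (p : PMF X) : ∑ x, (p x).toReal = 1 :=
  sum_toReal_of_subset p _ (by simp)

@[simp] theorem mean_pure (x : X) (f : X → E) : mean (PMF.pure x) f = f x := by
  rw [mean_eq_sum_of_subset _ {x} (by simp)]
  simp

theorem mean_bind (p : PMF X) [hp : FinSupp p] (k : X → PMF Y) [hk : ∀ x, FinSupp (k x)]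
    (f : Y → E) : mean (p.bind k) f = mean p fun x => mean (k x) f := by
  classical
  set t := hp.finite.toFinset with ht
  set u := t.biUnion fun x => (hk x).finite.toFinset with hu
  have hsub : ∀ x ∈ t, (k x).support ⊆ u := by
    intro x hx y hy
    simp only [hu, coe_biUnion, Set.mem_iUnion]
    exact ⟨x, hx, by simpa using hy⟩
  rw [mean_eq_sum_of_subset (p.bind k) u, mean_eq_sum p]
  · have h1 : ∀ y, (p.bind k y).toReal = ∑ x ∈ t, (p x).toReal * (k x y).toReal := by
      intro y
      rw [PMF.bind_apply, tsum_eq_sum (s := t), ENNReal.toReal_sum]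
      · simp
      · exact fun x _ => ENNReal.mul_ne_top (p.apply_ne_top x) ((k x).apply_ne_top y)
      · intro x hx
        have : p x = 0 := by
          rw [PMF.apply_eq_zero_iff]
          simpa [ht] using hx
        simp [this]
    simp_rw [h1, sum_smul]
    rw [sum_comm]
    refine sum_congr rfl fun x hx => ?_
    rw [mean_eq_sum_of_subset (k x) u (hsub x hx), smul_sum]
    simp [mul_smul]
  · intro y hy
    rw [PMF.mem_support_bind_iff] at hy
    obtain ⟨x, hx, hxy⟩ := hy
    exact hsub x (by simpa [ht] using hx) hxy

theorem mean_map (p : PMF X) [FinSupp p] (g : X → Y) (f : Y → E) :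
    mean (p.map g) f = mean p fun x => f (g x) := by
  rw [← PMF.bind_pure_comp, Function.comp_def, mean_bind]
  simp

variable (p : PMF X) [hp : FinSupp p]

theorem mean_add (f g : X → E) : mean p (fun x => f x + g x) = mean p f + mean p g := by
  simp [mean_eq_sum, sum_add_distrib]

theorem mean_sub (f g : X → E) : mean p (fun x => f x - g x) = mean p f - mean p g := by
  simp [mean_eq_sum, smul_sub]

theorem mean_const (c : E) : mean p (fun _ => c) = c := by
  rw [mean_eq_sum, ← sum_smul, sum_toReal_of_subset p _ (by simp), one_smul]

theorem mean_linear (L : E →ₗ[ℝ] F) (f : X → E) : mean p (fun x => L (f x)) = L (mean p f) := by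
  simp [mean_eq_sum]

theorem mean_smul (c : ℝ) (f : X → E) : mean p (fun x => c • f x) = c • mean p f :=
  mean_linear p (LinearMap.lsmul ℝ E c) f

theorem mean_const_mul (c : ℝ) (f : X → ℝ) : mean p (fun x => c * f x) = c * mean p f :=
  mean_smul p c f

variable {p}

theorem mean_mono {f g : X → ℝ} (h : ∀ x ∈ p.support, f x ≤ g x) : mean p f ≤ mean p g := by
  rw [mean_eq_sum, mean_eq_sum]
  refine sum_le_sum fun x hx => ?_
  exact mul_le_mul_of_nonneg_left (h x (by simpa using hx)) ENNReal.toReal_nonneg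

theorem mean_le_of_le {f : X → ℝ} {c : ℝ} (h : ∀ x ∈ p.support, f x ≤ c) : mean p f ≤ c :=
  (mean_mono h).trans_eq (mean_const p c)

theorem le_mean_of_le {f : X → ℝ} {c : ℝ} (h : ∀ x ∈ p.support, c ≤ f x) : c ≤ mean p f :=
  (mean_const p c).symm.trans_le (mean_mono h)

theorem norm_mean_le (f : X → E) : ‖mean p f‖ ≤ mean p fun x => ‖f x‖ := by
  rw [mean_eq_sum, mean_eq_sum]
  refine (norm_sum_le _ _).trans (sum_le_sum fun x _ => ?_)
  rw [norm_smul, Real.norm_of_nonneg ENNReal.toReal_nonneg, smul_eq_mul]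

theorem norm_mean_le_of_le {f : X → E} {c : ℝ} (h : ∀ x, ‖f x‖ ≤ c) : ‖mean p f‖ ≤ c :=
  (norm_mean_le f).trans (mean_le_of_le fun x _ => h x)

theorem sq_mean_le (f : X → ℝ) : mean p f ^ 2 ≤ mean p fun x => f x ^ 2 := by
  have h : 0 ≤ mean p fun x => (f x - mean p f) ^ 2 := le_mean_of_le fun x _ => sq_nonneg _
  have h2 : (mean p fun x => (f x - mean p f) ^ 2) =
      (mean p fun x => f x ^ 2) - mean p f ^ 2 := by
    have : ∀ x, (f x - mean p f) ^ 2 = f x ^ 2 - (2 * mean p f) * f x + mean p f ^ 2 :=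
      fun x => by ring
    simp_rw [this]
    rw [mean_add, mean_sub, mean_const_mul, mean_const]
    ring
  linarith

theorem mean_le_of_sq_le {f : X → ℝ} {c : ℝ} (hc : 0 ≤ c) (h : (mean p fun x => f x ^ 2) ≤ c ^ 2) :
    mean p f ≤ c :=
  le_of_abs_le (abs_le_of_sq_le_sq ((sq_mean_le f).trans h) hc)

end FiniteSupport

end PDNAC

namespace PDNAC

/-! ### Stochastic matrices: positivity of powers, invariant vectors, Doeblin contraction. -/

section Stochastic

variable {S : Type*} [Fintype S] [DecidableEq S]

theorem pow_pos_of_pow_pos {P : Matrix S S ℝ} (hP : P ∈ rowStochastic ℝ S) {a b : ℕ} {i k j : S}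
    (h₁ : 0 < (P ^ a) i k) (h₂ : 0 < (P ^ b) k j) : 0 < (P ^ (a + b)) i j := by
  rw [pow_add, Matrix.mul_apply]
  have hn : ∀ n i j, 0 ≤ (P ^ n) i j := fun n i j =>
    nonneg_of_mem_rowStochastic (pow_mem hP n)
  exact (mul_pos h₁ h₂).trans_le
    (single_le_sum (f := fun l => (P ^ a) i l * (P ^ b) l j)
      (fun l _ => mul_nonneg (hn _ _ _) (hn _ _ _)) (mem_univ k))

/-- Large powers of an irreducible aperiodic stochastic matrix are entrywise positive. -/
theorem exists_forall_ge_pow_pos {P : Matrix S S ℝ} (hP : P ∈ rowStochastic ℝ S)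
    (hirr : P.IsIrreducible) (hap : IsAperiodic P) :
    ∃ N, ∀ t ≥ N, ∀ i j, 0 < (P ^ t) i j := by
  have hret : ∀ s, ∃ n, ∀ t ≥ n, 0 < (P ^ t) s s := by
    intro s
    set R : Set ℕ := {n | 1 ≤ n ∧ 0 < (P ^ n) s s} with hR
    have hg : Nat.setGcd R = 1 := hap s _ fun n h1 h2 => Nat.setGcd_dvd_of_mem ⟨h1, h2⟩
    -- A set of naturals with greatest common divisor one additively generates every large number,
    -- and the times with positive return probability are closed under addition.
    obtain ⟨n, hn⟩ := Nat.exists_mem_closure_of_ge R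
    refine ⟨n, fun t ht => ?_⟩
    have hmem := hn t ht (by simp [hg])
    clear ht
    induction hmem using AddSubmonoid.closure_induction with
    | mem x hx => exact hx.2
    | zero => simp
    | add x y _ _ hx hy => exact pow_pos_of_pow_pos hP hx hy
  choose n hn using hret
  have hpath := (Matrix.isIrreducible_iff_exists_pow_pos (A := P) fun i j =>
    nonneg_of_mem_rowStochastic hP).1 hirr
  choose k hk using hpath
  refine ⟨∑ i, n i + ∑ i, ∑ j, k i j, fun t ht i j => ?_⟩
  have h1 : n i ≤ ∑ i, n i := single_le_sum (fun _ _ => Nat.zero_le _) (mem_univ i)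
  have h2 : k i j ≤ ∑ i, ∑ j, k i j :=
    (single_le_sum (f := fun j => k i j) (fun _ _ => Nat.zero_le _) (mem_univ j)).trans
      (single_le_sum (f := fun i => ∑ j, k i j) (fun _ _ => Nat.zero_le _) (mem_univ i))
  have h3 : t = (t - k i j) + k i j := by omega
  rw [h3]
  exact pow_pos_of_pow_pos hP (hn i _ (by omega)) (hk i j).2

/-- `P - 1` kills the constant vector, so it is singular and also has a nonzero left null vector
`v`. The triangle inequality gives `|v| ≤ |v| P` entrywise, and both sides have the same total since
the rows of `P` sum to one. Hence equality holds everywhere and `|v|`, normalised, is invariant. -/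
theorem exists_stationary [Nonempty S] {P : Matrix S S ℝ} (hP : P ∈ rowStochastic ℝ S) :
    ∃ v ∈ stdSimplex ℝ S, v ᵥ* P = v := by
  have hsing : (P - 1).det = 0 := by
    rw [← Matrix.exists_mulVec_eq_zero_iff]
    exact ⟨1, one_ne_zero, by rw [Matrix.sub_mulVec, hP.2, Matrix.one_mulVec, sub_self]⟩
  obtain ⟨v, hv0, hv⟩ := Matrix.exists_vecMul_eq_zero_iff.2 hsing
  rw [Matrix.vecMul_sub, Matrix.vecMul_one, sub_eq_zero] at hv
  have hle : ∀ j, |v j| ≤ ∑ i, |v i| * P i j := by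
    intro j
    conv_lhs => rw [← hv]
    refine (abs_sum_le_sum_abs _ _).trans_eq (sum_congr rfl fun i _ => ?_)
    rw [abs_mul, abs_of_nonneg (nonneg_of_mem_rowStochastic hP)]
  have hsum : ∑ j, ∑ i, |v i| * P i j = ∑ i, |v i| := by
    rw [sum_comm]
    simp_rw [← mul_sum, sum_row_of_mem_rowStochastic hP, mul_one]
  have heq : ∀ j, |v j| = ∑ i, |v i| * P i j := fun j =>
    (sum_eq_sum_iff_of_le fun j _ => hle j).1 hsum.symm j (mem_univ j)
  have hpos : 0 < ∑ i, |v i| := by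
    obtain ⟨i, hi⟩ := Function.ne_iff.1 hv0
    exact sum_pos' (fun _ _ => abs_nonneg _) ⟨i, mem_univ i, abs_pos.2 hi⟩
  refine ⟨fun i => (∑ i, |v i|)⁻¹ * |v i|, ⟨fun i => by positivity, ?_⟩, ?_⟩
  · rw [← mul_sum, inv_mul_cancel₀ hpos.ne']
  · ext j
    simp only [Matrix.vecMul, dotProduct, mul_assoc]
    rw [← mul_sum, ← heq j]

/-- As `x` sums to zero, subtracting `ε` from every entry of `Q` does not change `x ᵥ* Q`. What
remains is a nonnegative matrix whose rows sum to `1 - |S| ε ≤ 1 - ε`. -/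
theorem sum_abs_vecMul_le {Q : Matrix S S ℝ} (hQ : Q ∈ rowStochastic ℝ S) {ε : ℝ} (hε : 0 ≤ ε)
    (hQε : ∀ i j, ε ≤ Q i j) {x : S → ℝ} (hx : ∑ i, x i = 0) :
    ∑ j, |(x ᵥ* Q) j| ≤ (1 - ε) * ∑ i, |x i| := by
  rcases isEmpty_or_nonempty S with hS | hS
  · simp
  calc ∑ j, |(x ᵥ* Q) j| = ∑ j, |∑ i, x i * (Q i j - ε)| := by
        refine sum_congr rfl fun j _ => ?_
        simp only [mul_sub, sum_sub_distrib, ← sum_mul, hx, zero_mul, sub_zero]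
        rfl
    _ ≤ ∑ j, ∑ i, |x i| * (Q i j - ε) := by
        refine sum_le_sum fun j _ => (abs_sum_le_sum_abs _ _).trans_eq ?_
        refine sum_congr rfl fun i _ => ?_
        rw [abs_mul, abs_of_nonneg (sub_nonneg.2 (hQε i j))]
    _ = (1 - Fintype.card S * ε) * ∑ i, |x i| := by
        rw [sum_comm]
        simp_rw [← mul_sum, sum_sub_distrib, sum_row_of_mem_rowStochastic hQ]
        rw [← sum_mul]
        simp [mul_comm]
    _ ≤ (1 - ε) * ∑ i, |x i| := by
        refine mul_le_mul_of_nonneg_right ?_ (sum_nonneg fun _ _ => abs_nonneg _)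
        have : (1 : ℝ) ≤ Fintype.card S := by exact_mod_cast Fintype.card_pos
        nlinarith

theorem sum_abs_pow_sub_stationary_le {P : Matrix S S ℝ} (hP : P ∈ rowStochastic ℝ S)
    {v : S → ℝ} (hv : v ∈ stdSimplex ℝ S) (hvP : v ᵥ* P = v) {N : ℕ} {ε : ℝ} (hε : 0 ≤ ε)
    (hPε : ∀ i j, ε ≤ (P ^ N) i j) (k : ℕ) (s : S) :
    ∑ j, |(P ^ (N * k)) s j - v j| ≤ 2 * (1 - ε) ^ k := by
  have hvn : ∀ n : ℕ, v ᵥ* P ^ n = v := by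
    intro n
    induction n with
    | zero => simp
    | succ n ih => rw [pow_succ, ← Matrix.vecMul_vecMul, ih, hvP]
  have hε1 : 0 ≤ 1 - ε := by
    have := (hPε s s).trans (le_one_of_mem_rowStochastic (pow_mem hP N))
    linarith
  induction k with
  | zero =>
    have : ∀ j, |(P ^ (N * 0)) s j - v j| ≤ (1 : Matrix S S ℝ) s j + v j := by
      intro j
      rw [mul_zero, pow_zero]
      have h1 : 0 ≤ (1 : Matrix S S ℝ) s j := nonneg_of_mem_rowStochastic (one_mem _)
      have h2 := hv.1 j
      rw [abs_le]; constructor <;> linarith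
    refine (sum_le_sum fun j _ => this j).trans ?_
    rw [sum_add_distrib, sum_row_of_mem_rowStochastic (one_mem _), hv.2]
    norm_num
  | succ k ih =>
    set x : S → ℝ := fun j => (P ^ (N * k)) s j - v j with hx
    have hx0 : ∑ j, x j = 0 := by
      simp [hx, sum_sub_distrib, sum_row_of_mem_rowStochastic (pow_mem hP _), hv.2]
    have hstep : ∀ j, (P ^ (N * (k + 1))) s j - v j = (x ᵥ* P ^ N) j := by
      intro j
      have h1 : x = (fun j => (P ^ (N * k)) s j) - v := rfl
      rw [h1, Matrix.sub_vecMul, hvn, mul_add, mul_one, pow_add]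
      rfl
    simp_rw [hstep]
    calc _ ≤ (1 - ε) * ∑ i, |x i| := sum_abs_vecMul_le (pow_mem hP N) hε hPε hx0
      _ ≤ (1 - ε) * (2 * (1 - ε) ^ k) := mul_le_mul_of_nonneg_left ih hε1
      _ = _ := by ring

/-- Used to compare the chain of an arbitrary policy with that of a deterministic one. -/
theorem pow_le_pow_of_smul_le {P Q : Matrix S S ℝ} (hQ : ∀ i j, 0 ≤ Q i j) {c : ℝ} (hc : 0 ≤ c)
    (h : ∀ i j, c * Q i j ≤ P i j) (n : ℕ) :
    ∀ i j, 0 ≤ (Q ^ n) i j ∧ c ^ n * (Q ^ n) i j ≤ (P ^ n) i j := by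
  induction n with
  | zero =>
    intro i j
    simp only [pow_zero, one_mul, le_refl, and_true]
    exact nonneg_of_mem_rowStochastic (one_mem _)
  | succ n ih =>
    intro i j
    simp only [pow_succ _ n, Matrix.mul_apply]
    refine ⟨sum_nonneg fun k _ => mul_nonneg (ih i k).1 (hQ k j), ?_⟩
    rw [mul_sum]
    refine sum_le_sum fun k _ => ?_
    calc c ^ n * c * ((Q ^ n) i k * Q k j) = (c ^ n * (Q ^ n) i k) * (c * Q k j) := by ring
      _ ≤ _ := mul_le_mul (ih i k).2 (h k j) (mul_nonneg hc (hQ k j))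
          ((mul_nonneg (pow_nonneg hc n) (ih i k).1).trans (ih i k).2)

end Stochastic

/-! ### Uniform mixing over all policies; finiteness of the mixing times. -/

section Ergodic

theorem nonempty_state {S A : Type*} (M : CMDP S A) : Nonempty S :=
  M.ρ.support_nonempty.nonempty

variable {S A : Type*} [Fintype S] [DecidableEq S] [Fintype A] {M : CMDP S A}

theorem transMat_mem (M : CMDP S A) (π : Policy S A) : M.transMat π ∈ rowStochastic ℝ S := by
  rw [mem_rowStochastic_iff_sum]
  refine ⟨fun i j => sum_nonneg fun a _ => by positivity, fun i => ?_⟩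
  simp only [CMDP.transMat, Matrix.of_apply]
  rw [sum_comm]
  simp_rw [← mul_sum, sum_toReal, mul_one]
  exact sum_toReal (π i)

/-- Uniform Doeblin condition over all policies. -/
theorem exists_uniform_pow_ge (hM : M.IsErgodic) :
    ∃ N ≥ 1, ∃ ε > 0, ∀ π : Policy S A, ∀ i j, ε ≤ (M.transMat π ^ N) i j := by
  classical
  rcases isEmpty_or_nonempty A with hA | hA
  · refine ⟨1, le_rfl, 1, one_pos, fun π => ?_⟩
    obtain ⟨s⟩ := nonempty_state M
    exact (hA.false (π s).support_nonempty.some).elim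
  have hS := nonempty_state M
  -- There are finitely many deterministic policies, so a common power makes all their matrices
  -- positive with a common lower bound. An arbitrary policy gives some action probability at least
  -- `1/|A|` in each state, so its matrix dominates `c` times a deterministic one.
  let D : (S → A) → Matrix S S ℝ := fun f => M.transMat fun s => PMF.pure (f s)
  have hprim : ∀ f, ∃ N, ∀ t ≥ N, ∀ i j, 0 < (D f ^ t) i j := fun f =>
    exists_forall_ge_pow_pos (transMat_mem M _) (hM _).1 (hM _).2
  choose n hn using hprim
  set N := ∑ f, n f + 1 with hN
  have hNn : ∀ f, n f ≤ N := fun f =>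
    (single_le_sum (f := n) (fun _ _ => Nat.zero_le _) (mem_univ f)).trans (Nat.le_succ _)
  obtain ⟨x₀, hx₀⟩ := Finite.exists_min fun x : (S → A) × S × S => (D x.1 ^ N) x.2.1 x.2.2
  have hcard : (0 : ℝ) < Fintype.card A := by exact_mod_cast Fintype.card_pos
  set c : ℝ := (Fintype.card A : ℝ)⁻¹ with hc
  have hc0 : 0 < c := inv_pos.2 hcard
  refine ⟨N, by omega, c ^ N * (D x₀.1 ^ N) x₀.2.1 x₀.2.2,
    mul_pos (pow_pos hc0 N) (hn _ _ (hNn _) _ _), fun π i j => ?_⟩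
  have hmax : ∀ s, ∃ a, c ≤ (π s a).toReal := by
    intro s
    by_contra! h
    have h1 := sum_lt_sum_of_nonempty (univ_nonempty (α := A)) fun a _ => h a
    rw [sum_toReal] at h1
    simp [hc] at h1
  choose f hf using hmax
  have hle : ∀ i j, c * D f i j ≤ M.transMat π i j := by
    intro i j
    have h1 : D f i j = (M.P i (f i) j).toReal := by
      simp only [D, CMDP.transMat, Matrix.of_apply, PMF.pure_apply]
      rw [sum_eq_single (f i)] <;> simp +contextual
    rw [h1]
    simp only [CMDP.transMat, Matrix.of_apply]
    exact (mul_le_mul_of_nonneg_right (hf i) ENNReal.toReal_nonneg).trans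
      (single_le_sum (f := fun a => (π i a).toReal * (M.P i a j).toReal)
        (fun a _ => by positivity) (mem_univ (f i)))
  have h2 := pow_le_pow_of_smul_le
    (fun i j => nonneg_of_mem_rowStochastic (transMat_mem M fun s => PMF.pure (f s))) hc0.le hle N i j
  exact (mul_le_mul_of_nonneg_left (hx₀ (f, i, j)) (pow_pos hc0 N).le).trans h2.2

theorem statDist_spec (M : CMDP S A) (π : Policy S A) : M.IsStationary π (M.statDist π) := by
  have := nonempty_state M
  obtain ⟨v, hv⟩ := exists_stationary (transMat_mem M π)
  exact Classical.epsilon_spec (p := M.IsStationary π) ⟨v, hv⟩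

theorem statDist_nonneg (M : CMDP S A) (π : Policy S A) (s : S) : 0 ≤ M.statDist π s :=
  (statDist_spec M π).1.1 s

theorem sum_statDist (M : CMDP S A) (π : Policy S A) : ∑ s, M.statDist π s = 1 :=
  (statDist_spec M π).1.2

/-- Shows that the `sInf` defining `mixTime` is over a nonempty set and that the supremum defining
`tauMix` is over a bounded family; otherwise either could be the default value `0`. -/
theorem exists_uniform_mix (hM : M.IsErgodic) : ∃ t ≥ 1, ∀ π : Policy S A, ∀ s,
    (1 / 2 : ℝ) * ∑ s', |((M.transMat π) ^ t) s s' - M.statDist π s'| ≤ 1 / 4 := by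
  obtain ⟨N, hN, ε, hε, h⟩ := exists_uniform_pow_ge hM
  obtain ⟨k, hk⟩ := exists_pow_lt_of_lt_one (show (0 : ℝ) < 1 / 4 by norm_num)
    (show 1 - ε < 1 by linarith)
  by_cases hε1 : 1 - ε < 0
  · refine ⟨1, le_rfl, fun π s => ?_⟩
    have := (h π s s).trans (le_one_of_mem_rowStochastic (pow_mem (transMat_mem M π) N))
    linarith
  -- The exponent `k + 1` instead of `k` keeps the time at least `1`.
  refine ⟨N * (k + 1), by nlinarith, fun π s => ?_⟩
  have h1 := sum_abs_pow_sub_stationary_le (transMat_mem M π) (statDist_spec M π).1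
    (statDist_spec M π).2 hε.le (h π) (k + 1) s
  have h2 : (1 - ε) ^ (k + 1) ≤ (1 - ε) ^ k :=
    pow_le_pow_of_le_one (by linarith) (by linarith) (Nat.le_succ k)
  linarith

theorem mixTime_spec (hM : M.IsErgodic) (π : Policy S A) : 1 ≤ M.mixTime π ∧ ∀ s,
    (1 / 2 : ℝ) * ∑ s', |((M.transMat π) ^ (M.mixTime π)) s s' - M.statDist π s'| ≤ 1 / 4 := by
  obtain ⟨t, ht, h⟩ := exists_uniform_mix hM
  exact Nat.sInf_mem (s := {t : ℕ | 1 ≤ t ∧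
    ∀ s, (1 / 2 : ℝ) * ∑ s', |((M.transMat π) ^ t) s s' - M.statDist π s'| ≤ 1 / 4})
    ⟨t, ht, h π⟩

theorem mixTime_le_tauMix (hM : M.IsErgodic) {d : ℕ} (π : PolicyClass S A d)
    (θ : EuclideanSpace ℝ (Fin d)) : M.mixTime (π θ) ≤ M.tauMix π := by
  obtain ⟨t, ht, h⟩ := exists_uniform_mix hM
  refine le_ciSup (f := fun θ => M.mixTime (π θ)) ⟨t, ?_⟩ θ
  rintro _ ⟨θ', rfl⟩
  exact Nat.sInf_le ⟨ht, h _⟩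

theorem one_le_tauMix (hM : M.IsErgodic) {d : ℕ} (π : PolicyClass S A d) : 1 ≤ M.tauMix π :=
  (mixTime_spec hM (π 0)).1.trans (mixTime_le_tauMix hM π 0)

end Ergodic

/-! ### Deviations from stationarity and the deviation matrix. -/

section Deviation

variable {S A : Type*} [Fintype S] [DecidableEq S] [Fintype A] {M : CMDP S A}

attribute [local instance] Matrix.linftyOpNormedRing Matrix.linftyOpNormedAlgebra

/-- The deviation `(P^π)^t - 1 (d^π)ᵀ` from stationarity. -/
noncomputable def CMDP.dev (M : CMDP S A) (π : Policy S A) (t : ℕ) : Matrix S S ℝ :=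
  (M.transMat π) ^ t - Matrix.of fun _ s' => M.statDist π s'

theorem norm_le_of_row_sum_le {B : Matrix S S ℝ} {c : ℝ} (hc : 0 ≤ c)
    (h : ∀ i, ∑ j, |B i j| ≤ c) : ‖B‖ ≤ c := by
  rw [Matrix.linfty_opNorm_def]
  have : (univ.sup fun i => ∑ j, ‖B i j‖₊ : NNReal) ≤ ⟨c, hc⟩ := by
    refine Finset.sup_le fun i _ => ?_
    refine NNReal.coe_le_coe.1 ?_
    push_cast
    exact h i
  exact_mod_cast this

theorem row_sum_le_norm (B : Matrix S S ℝ) (i : S) : ∑ j, |B i j| ≤ ‖B‖ := by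
  rw [Matrix.linfty_opNorm_def]
  have : ∑ j, ‖B i j‖₊ ≤ (univ.sup fun i => ∑ j, ‖B i j‖₊ : NNReal) :=
    Finset.le_sup (f := fun i => ∑ j, ‖B i j‖₊) (mem_univ i)
  rw [← NNReal.coe_le_coe] at this
  push_cast at this
  simpa using this

/-- The matrix `1 (d^π)ᵀ` is idempotent and absorbs powers of `P^π` on both sides, so the cross
terms collapse. This multiplicativity turns one mixing time into geometric decay. -/
theorem dev_add (M : CMDP S A) (π : Policy S A) (t u : ℕ) :
    M.dev π (t + u) = M.dev π t * M.dev π u := by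
  have hvn : ∀ n : ℕ, M.statDist π ᵥ* M.transMat π ^ n = M.statDist π := by
    intro n
    induction n with
    | zero => simp
    | succ n ih => rw [pow_succ, ← Matrix.vecMul_vecMul, ih, (statDist_spec M π).2]
  have h1 : (M.transMat π ^ t) * (Matrix.of fun _ s' => M.statDist π s') =
      Matrix.of fun _ s' => M.statDist π s' := by
    ext i j
    simp [Matrix.mul_apply, ← sum_mul,
      sum_row_of_mem_rowStochastic (pow_mem (transMat_mem M π) t)]
  have h2 : (Matrix.of fun (_ : S) s' => M.statDist π s') * (M.transMat π ^ u) =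
      Matrix.of fun _ s' => M.statDist π s' := by
    ext i j
    exact congrFun (hvn u) j
  have h3 : (Matrix.of fun (_ : S) s' => M.statDist π s') *
      (Matrix.of fun (_ : S) s' => M.statDist π s') =
      Matrix.of fun _ s' => M.statDist π s' := by
    ext i j
    simp [Matrix.mul_apply, ← sum_mul, sum_statDist]
  simp only [CMDP.dev, mul_sub, sub_mul, h1, h2, h3, pow_add]
  abel

theorem norm_dev_le_two (M : CMDP S A) (π : Policy S A) (t : ℕ) : ‖M.dev π t‖ ≤ 2 := by
  refine norm_le_of_row_sum_le (by norm_num) fun i => ?_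
  have : ∀ j, |M.dev π t i j| ≤ (M.transMat π ^ t) i j + M.statDist π j := by
    intro j
    have h1 : 0 ≤ (M.transMat π ^ t) i j :=
      nonneg_of_mem_rowStochastic (pow_mem (transMat_mem M π) t)
    have h2 := statDist_nonneg M π j
    simp only [CMDP.dev, Matrix.sub_apply, Matrix.of_apply]
    rw [abs_le]; constructor <;> linarith
  refine (sum_le_sum fun j _ => this j).trans ?_
  rw [sum_add_distrib, sum_row_of_mem_rowStochastic (pow_mem (transMat_mem M π) t), sum_statDist]
  norm_num

/-- Total variation at most `1/4` means row sums of absolute values at most `1/2`, so each block of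
`mixTime` steps halves the operator norm, starting from the trivial bound `2`. -/
theorem norm_dev_mul_add_le (hM : M.IsErgodic) (π : Policy S A) (k r : ℕ) :
    ‖M.dev π (k * M.mixTime π + r)‖ ≤ 2 * (1 / 2) ^ k := by
  induction k with
  | zero => simpa using norm_dev_le_two M π r
  | succ k ih =>
    have h1 : ‖M.dev π (M.mixTime π)‖ ≤ 1 / 2 := by
      refine norm_le_of_row_sum_le (by norm_num) fun i => ?_
      have := (mixTime_spec hM π).2 i
      simp only [CMDP.dev, Matrix.sub_apply, Matrix.of_apply]
      linarith
    have h2 : (k + 1) * M.mixTime π + r = M.mixTime π + (k * M.mixTime π + r) := by ring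
    rw [h2, dev_add]
    calc _ ≤ ‖M.dev π (M.mixTime π)‖ * ‖M.dev π (k * M.mixTime π + r)‖ := norm_mul_le _ _
      _ ≤ 1 / 2 * (2 * (1 / 2) ^ k) :=
        mul_le_mul h1 ih (norm_nonneg _) (by norm_num)
      _ = _ := by ring

/-- Group the times into blocks of length `τ`: the `k`-th block contributes at most `2τ · 2^{-k}`.
-/
theorem sum_norm_dev_le (hM : M.IsErgodic) (π : Policy S A) (n : ℕ) :
    ∑ t ∈ range n, ‖M.dev π t‖ ≤ 4 * M.mixTime π := by
  set τ := M.mixTime π with hτ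
  have hτ1 : 1 ≤ τ := (mixTime_spec hM π).1
  have hblock : ∀ k : ℕ, ∑ t ∈ range (k * τ), ‖M.dev π t‖ ≤ 4 * τ * (1 - (1 / 2) ^ k) := by
    intro k
    induction k with
    | zero => simp
    | succ k ih =>
      rw [Nat.succ_mul, sum_range_add]
      have : ∑ x ∈ range τ, ‖M.dev π (k * τ + x)‖ ≤ ∑ x ∈ range τ, 2 * (1 / 2 : ℝ) ^ k :=
        sum_le_sum fun x _ => norm_dev_mul_add_le hM π k x
      rw [sum_const, card_range, nsmul_eq_mul] at this
      refine (add_le_add ih this).trans_eq ?_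
      ring
  have hsub : range n ⊆ range (n * τ) := range_subset_range.2 (Nat.le_mul_of_pos_right n hτ1)
  refine (sum_le_sum_of_subset_of_nonneg hsub fun _ _ _ => norm_nonneg _).trans
    ((hblock n).trans ?_)
  have : (0 : ℝ) ≤ (1 / 2) ^ n := by positivity
  have h0 : (0 : ℝ) ≤ τ := Nat.cast_nonneg _
  nlinarith [mul_nonneg h0 this]

theorem summable_dev (hM : M.IsErgodic) (π : Policy S A) : Summable (M.dev π) :=
  Summable.of_norm (summable_of_sum_range_le (fun _ => norm_nonneg _) (sum_norm_dev_le hM π))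

/-- The deviation matrix `∑_t ((P^π)^t - 1 (d^π)ᵀ)`. -/
noncomputable def CMDP.devSum (M : CMDP S A) (π : Policy S A) : Matrix S S ℝ := ∑' t, M.dev π t

theorem hasSum_dev (hM : M.IsErgodic) (π : Policy S A) (i j : S) :
    HasSum (fun t => M.dev π t i j) (M.devSum π i j) := by
  have h := (summable_dev hM π).hasSum
  exact (Pi.hasSum.1 (Pi.hasSum.1 h i) j)

theorem sum_abs_devSum_le (hM : M.IsErgodic) (π : Policy S A) (i : S) :
    ∑ j, |M.devSum π i j| ≤ 4 * M.mixTime π := by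
  refine (row_sum_le_norm _ i).trans ?_
  have hs : Summable fun t => ‖M.dev π t‖ :=
    summable_of_sum_range_le (fun _ => norm_nonneg _) (sum_norm_dev_le hM π)
  exact (norm_tsum_le_tsum_norm hs).trans
    (Real.tsum_le_of_sum_range_le (fun _ => norm_nonneg _) (sum_norm_dev_le hM π))

theorem tendsto_dev (hM : M.IsErgodic) (π : Policy S A) (i j : S) :
    Tendsto (fun t => M.dev π t i j) atTop (nhds 0) :=
  (hasSum_dev hM π i j).summable.tendsto_atTop_zero

theorem dev_succ (M : CMDP S A) (π : Policy S A) (t : ℕ) (i j : S) :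
    M.dev π (t + 1) i j = ∑ k, M.transMat π i k * M.dev π t k j := by
  have h : M.dev π (t + 1) = M.transMat π * M.dev π t := by
    have h1 : M.transMat π * (Matrix.of fun _ s' => M.statDist π s') =
        Matrix.of fun _ s' => M.statDist π s' := by
      ext i j
      simp [Matrix.mul_apply, ← sum_mul, sum_row_of_mem_rowStochastic (transMat_mem M π)]
    simp only [CMDP.dev, mul_sub, h1, pow_succ']
  rw [h, Matrix.mul_apply]

/-- Split off the term `t = 0` of the series and factor `P^π` out of the rest. -/
theorem devSum_poisson (hM : M.IsErgodic) (π : Policy S A) (i j : S) :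
    M.devSum π i j = (1 : Matrix S S ℝ) i j - M.statDist π j
      + ∑ k, M.transMat π i k * M.devSum π k j := by
  have h1 : HasSum (fun t => M.dev π (t + 1) i j) (∑ k, M.transMat π i k * M.devSum π k j) := by
    simp_rw [dev_succ]
    exact hasSum_sum fun k _ => (hasSum_dev hM π k j).mul_left _
  have h2 := (hasSum_dev hM π i j).unique h1.zero_add
  simpa [CMDP.dev] using h2

end Deviation
end PDNAC

namespace PDNAC

/-! ### Average-reward theory: gains, values, Bellman equation, performance difference. -/

section AverageReward

theorem abs_sig_le {S A : Type*} (M : CMDP S A) (g : Sig) (s : S) (a : A) : |M.sig g s a| ≤ 1 := by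
  cases g
  · have := M.r_mem s a
    exact abs_le.2 ⟨by linarith [this.1, show M.sig .r s a = M.r s a from rfl], this.2⟩
  · exact abs_le.2 (M.c_mem s a)

theorem sum_occ_action {S A : Type*} [Fintype S] [Fintype A] (M : CMDP S A) (π : Policy S A) (s : S) :
    ∑ a, M.occ π s a = M.statDist π s := by
  simp only [CMDP.occ, ← mul_sum, sum_toReal, mul_one]

variable {S A : Type*} [Fintype S] [DecidableEq S] [Fintype A] {M : CMDP S A}

theorem sum_statDist_transMat (M : CMDP S A) (π : Policy S A) (f : S → ℝ) :
    ∑ s, M.statDist π s * ∑ s', M.transMat π s s' * f s' = ∑ s, M.statDist π s * f s := by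
  simp_rw [mul_sum, ← mul_assoc]
  rw [sum_comm]
  simp_rw [← sum_mul]
  refine sum_congr rfl fun s _ => ?_
  congr 1
  exact congrFun (statDist_spec M π).2 s

theorem dotProduct_vecMul_pow (M : CMDP S A) (π : Policy S A) {v : S → ℝ} (hv : ∑ s, v s = 1)
    (t : ℕ) (f : S → ℝ) : (v ᵥ* M.transMat π ^ t) ⬝ᵥ f =
      ∑ s, M.statDist π s * f s + ∑ s, (∑ i, v i * M.dev π t i s) * f s := by
  have h : ∀ i s, (M.transMat π ^ t) i s = M.statDist π s + M.dev π t i s := by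
    intro i s
    simp [CMDP.dev]
  simp only [dotProduct, Matrix.vecMul, h, mul_add, sum_add_distrib, add_mul, ← sum_mul, hv,
    one_mul]

theorem tendsto_dotProduct_vecMul_pow (hM : M.IsErgodic) (π : Policy S A) {v : S → ℝ}
    (hv : ∑ s, v s = 1) (f : S → ℝ) :
    Tendsto (fun t => (v ᵥ* M.transMat π ^ t) ⬝ᵥ f) atTop
      (nhds (∑ s, M.statDist π s * f s)) := by
  simp_rw [dotProduct_vecMul_pow M π hv]
  have h0 : Tendsto (fun t => ∑ s, (∑ i, v i * M.dev π t i s) * f s) atTop (nhds 0) := by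
    have : Tendsto (fun t => ∑ s, (∑ i, v i * M.dev π t i s) * f s) atTop
        (nhds (∑ s, (∑ i, v i * 0) * f s)) :=
      tendsto_finsetSum _ fun s _ => (tendsto_finsetSum _ fun i _ =>
        (tendsto_dev hM π i s).const_mul (v i)).mul_const (f s)
    simpa using this
  simpa using h0.const_add (∑ s, M.statDist π s * f s)

theorem J_eq (hM : M.IsErgodic) (g : Sig) (π : Policy S A) :
    M.J g π = ∑ s, M.statDist π s * M.sigMean g π s :=
  ((tendsto_dotProduct_vecMul_pow hM π (sum_toReal M.ρ) (M.sigMean g π)).cesaro).limUnder_eq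

/-- Started at `v` the chain keeps the law `v`, yet its law converges to `statDist π`. -/
theorem statDist_unique (hM : M.IsErgodic) (π : Policy S A) {v : S → ℝ}
    (hv : M.IsStationary π v) : v = M.statDist π := by
  have hvn : ∀ n : ℕ, v ᵥ* M.transMat π ^ n = v := by
    intro n
    induction n with
    | zero => simp
    | succ n ih => rw [pow_succ, ← Matrix.vecMul_vecMul, ih, hv.2]
  ext s
  have h := tendsto_dotProduct_vecMul_pow hM π hv.1.2 (Pi.single s 1)
  simp only [hvn, dotProduct_single, mul_one] at h
  have h2 := tendsto_nhds_unique h tendsto_const_nhds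
  simpa [Pi.single_apply] using h2.symm

theorem J_eq_occ (hM : M.IsErgodic) (g : Sig) (π : Policy S A) :
    M.J g π = ∑ s, ∑ a, M.occ π s a * M.sig g s a := by
  simp only [J_eq hM, CMDP.sigMean, CMDP.occ, mul_sum, mul_assoc]

theorem occ_nonneg (M : CMDP S A) (π : Policy S A) (s : S) (a : A) : 0 ≤ M.occ π s a :=
  mul_nonneg (statDist_nonneg M π s) ENNReal.toReal_nonneg

theorem sum_occ (M : CMDP S A) (π : Policy S A) : ∑ s, ∑ a, M.occ π s a = 1 := by
  simp only [sum_occ_action, sum_statDist]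

theorem sum_occ_transition (M : CMDP S A) (π : Policy S A) (f : S → ℝ) :
    ∑ s, ∑ a, M.occ π s a * ∑ s', (M.P s a s').toReal * f s' = ∑ s, M.statDist π s * f s := by
  rw [← sum_statDist_transMat M π f]
  refine sum_congr rfl fun s _ => ?_
  simp only [CMDP.occ, CMDP.transMat, Matrix.of_apply, mul_sum, sum_mul]
  rw [sum_comm]
  simp only [mul_assoc]

theorem sum_occ_le (M : CMDP S A) (π : Policy S A) {f : S → A → ℝ} {c : ℝ}
    (h : ∀ s a, f s a ≤ c) : ∑ s, ∑ a, M.occ π s a * f s a ≤ c := by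
  calc _ ≤ ∑ s, ∑ a, M.occ π s a * c := sum_le_sum fun s _ => sum_le_sum fun a _ =>
        mul_le_mul_of_nonneg_left (h s a) (occ_nonneg M π s a)
    _ = c := by simp_rw [← sum_mul]; rw [sum_occ, one_mul]

theorem le_sum_occ (M : CMDP S A) (π : Policy S A) {f : S → A → ℝ} {c : ℝ}
    (h : ∀ s a, c ≤ f s a) : c ≤ ∑ s, ∑ a, M.occ π s a * f s a := by
  have := sum_occ_le M π (f := fun s a => - f s a) (c := -c) fun s a => neg_le_neg (h s a)
  simp only [mul_neg, sum_neg_distrib] at this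
  linarith

theorem J_le_one (hM : M.IsErgodic) (g : Sig) (π : Policy S A) : M.J g π ≤ 1 := by
  rw [J_eq_occ hM]
  exact sum_occ_le M π fun s a => (le_abs_self _).trans (abs_sig_le M g s a)

theorem J_r_nonneg (hM : M.IsErgodic) (π : Policy S A) : 0 ≤ M.J .r π := by
  rw [J_eq_occ hM]
  exact le_sum_occ M π fun s a => (M.r_mem s a).1

/-- The relative value function, written with the deviation matrix. -/
noncomputable def CMDP.relValue (M : CMDP S A) (g : Sig) (π : Policy S A) (s : S) : ℝ :=
  ∑ s', M.devSum π s s' * M.sigMean g π s'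

/-- Each term of the series after the first is a transition followed by a deviation matrix applied
to the mean signal, so the defining `tsum` converges and is not a default value. -/
theorem Q_eq_relValue (hM : M.IsErgodic) (g : Sig) (π : Policy S A) (s : S) (a : A) :
    M.Q g π s a = M.sig g s a - M.J g π + ∑ s', (M.P s a s').toReal * M.relValue g π s' := by
  have h1 : ∀ t, M.condMean g π (t + 1) s a - M.J g π =
      ∑ s', (M.P s a s').toReal * ∑ u, M.dev π t s' u * M.sigMean g π u := by
    intro t
    have h2 : ∀ s', (M.transMat π ^ t *ᵥ M.sigMean g π) s' =
        M.J g π + ∑ u, M.dev π t s' u * M.sigMean g π u := by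
      intro s'
      simp only [J_eq hM, Matrix.mulVec, dotProduct, CMDP.dev, Matrix.sub_apply, Matrix.of_apply,
        sub_mul, sum_sub_distrib]
      ring
    simp only [CMDP.condMean, h2, mul_add, sum_add_distrib, ← sum_mul, sum_toReal]
    ring
  have h3 : HasSum (fun t => M.condMean g π (t + 1) s a - M.J g π)
      (∑ s', (M.P s a s').toReal * M.relValue g π s') := by
    simp_rw [h1]
    exact hasSum_sum fun s' _ => (hasSum_sum fun u _ =>
      (hasSum_dev hM π s' u).mul_right _).mul_left _
  exact (HasSum.zero_add (f := fun t => M.condMean g π t s a - M.J g π) h3).tsum_eq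

theorem V_eq_relValue (hM : M.IsErgodic) (g : Sig) (π : Policy S A) (s : S) :
    M.V g π s = M.relValue g π s := by
  have h1 : M.V g π s = M.sigMean g π s - M.J g π
      + ∑ s', M.transMat π s s' * M.relValue g π s' := by
    simp only [CMDP.V, Q_eq_relValue hM, mul_add, mul_sub, sum_add_distrib, sum_sub_distrib,
      ← sum_mul, sum_toReal, one_mul, CMDP.sigMean, CMDP.transMat, Matrix.of_apply]
    congr 1
    simp only [sum_mul, mul_sum, mul_assoc]
    rw [sum_comm]
  rw [h1]
  have h2 : M.relValue g π s = ∑ s', ((1 : Matrix S S ℝ) s s' - M.statDist π s'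
      + ∑ k, M.transMat π s k * M.devSum π k s') * M.sigMean g π s' :=
    sum_congr rfl fun s' _ => by rw [← devSum_poisson hM]
  rw [h2]
  simp only [add_mul, sub_mul, sum_add_distrib, sum_sub_distrib, Matrix.one_apply, ite_mul,
    one_mul, zero_mul, sum_ite_eq, mem_univ, if_true, J_eq hM]
  congr 1
  simp only [CMDP.relValue, mul_sum, sum_mul, mul_assoc]
  rw [sum_comm]

/-- The Bellman equation of the average-reward criterion. -/
theorem Q_eq (hM : M.IsErgodic) (g : Sig) (π : Policy S A) (s : S) (a : A) :
    M.Q g π s a = M.sig g s a - M.J g π + ∑ s', (M.P s a s').toReal * M.V g π s' := by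
  simp_rw [V_eq_relValue hM]
  exact Q_eq_relValue hM g π s a

/-- The performance difference identity. -/
theorem sum_occ_Adv (hM : M.IsErgodic) (g : Sig) (π π' : Policy S A) :
    ∑ s, ∑ a, M.occ π' s a * M.Adv g π s a = M.J g π' - M.J g π := by
  have h : ∀ s a, M.occ π' s a * M.Adv g π s a = M.occ π' s a * M.sig g s a
      - M.occ π' s a * M.J g π + M.occ π' s a * ∑ s', (M.P s a s').toReal * M.V g π s'
      - M.occ π' s a * M.V g π s := by
    intro s a
    rw [CMDP.Adv, Q_eq hM]
    ring
  simp_rw [h, sum_sub_distrib, sum_add_distrib, sum_sub_distrib, ← sum_mul]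
  rw [sum_occ, sum_occ_transition, ← J_eq_occ hM]
  simp_rw [sum_occ_action]
  ring

end AverageReward

/-! ### Convexity of the achievable averages and strong duality. -/

section Duality

variable {S A : Type*} [Fintype S] [DecidableEq S] [Fintype A] {M : CMDP S A}

theorem exists_pmf_of_weights (w : A → ℝ) (hw : ∀ a, 0 ≤ w a) (h1 : ∑ a, w a = 1) :
    ∃ p : PMF A, ∀ a, (p a).toReal = w a := by
  refine ⟨PMF.ofFintype (fun a => ENNReal.ofReal (w a)) ?_, fun a => ?_⟩
  · rw [← ENNReal.ofReal_sum_of_nonneg fun a _ => hw a, h1, ENNReal.ofReal_one]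
  · rw [PMF.ofFintype_apply, ENNReal.toReal_ofReal (hw a)]

/-- The set of achievable pairs of averages is convex. -/
theorem exists_policy_mix (hM : M.IsErgodic) (π₁ π₂ : Policy S A) {t u : ℝ} (ht : 0 ≤ t)
    (hu : 0 ≤ u) (htu : t + u = 1) :
    ∃ π : Policy S A, ∀ g, M.J g π = t * M.J g π₁ + u * M.J g π₂ := by
  set v : S → ℝ := fun s => t * M.statDist π₁ s + u * M.statDist π₂ s with hv
  set o : S → A → ℝ := fun s a => t * M.occ π₁ s a + u * M.occ π₂ s a with ho
  have hv0 : ∀ s, 0 ≤ v s := fun s => add_nonneg (mul_nonneg ht (statDist_nonneg M _ s))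
    (mul_nonneg hu (statDist_nonneg M _ s))
  have ho0 : ∀ s a, 0 ≤ o s a := fun s a => add_nonneg (mul_nonneg ht (occ_nonneg M _ s a))
    (mul_nonneg hu (occ_nonneg M _ s a))
  have hov : ∀ s, ∑ a, o s a = v s := by
    intro s
    simp only [ho, sum_add_distrib, ← mul_sum, sum_occ_action, hv]
  -- Conditioning the mixed occupancy measure on the state gives the policy; in a state of zero mass
  -- every action law works. The flow equations are linear, so `v` is stationary for it, and
  -- uniqueness identifies `v` with its stationary distribution.
  have hex : ∀ s, ∃ p : PMF A, ∀ a, v s * (p a).toReal = o s a := by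
    intro s
    by_cases h : v s = 0
    · refine ⟨π₁ s, fun a => ?_⟩
      have h2 := hov s
      rw [h, sum_eq_zero_iff_of_nonneg fun a _ => ho0 s a] at h2
      rw [h2 a (mem_univ a), h, zero_mul]
    · obtain ⟨p, hp⟩ := exists_pmf_of_weights (fun a => o s a / v s)
        (fun a => div_nonneg (ho0 s a) (hv0 s)) (by rw [← sum_div, hov, div_self h])
      exact ⟨p, fun a => by rw [hp, mul_div_cancel₀ _ h]⟩
  choose π hπ using hex
  have hstat : M.IsStationary π v := by
    refine ⟨⟨hv0, ?_⟩, ?_⟩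
    · simp only [hv, sum_add_distrib, ← mul_sum, sum_statDist, mul_one, htu]
    · ext s'
      have h1 : ∀ π' : Policy S A, ∑ s, ∑ a, M.occ π' s a * (M.P s a s').toReal
          = M.statDist π' s' := by
        intro π'
        have h2 := congrFun (statDist_spec M π').2 s'
        rw [← h2]
        simp only [Matrix.vecMul, dotProduct, CMDP.transMat, Matrix.of_apply, mul_sum, CMDP.occ,
          mul_assoc]
      simp only [Matrix.vecMul, dotProduct, CMDP.transMat, Matrix.of_apply, mul_sum, ← mul_assoc,
        hπ]
      simp only [ho, add_mul, sum_add_distrib, mul_assoc, ← mul_sum, h1]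
      rfl
  refine ⟨π, fun g => ?_⟩
  have hocc : ∀ s a, M.occ π s a = o s a := by
    intro s a
    rw [← hπ, CMDP.occ, ← statDist_unique hM π hstat]
  simp only [J_eq_occ hM, hocc, ho, add_mul, sum_add_distrib, mul_assoc, ← mul_sum]

/-- Strong duality: a Lagrange multiplier in `[0, 1/δ]` exists under Slater's condition. -/
theorem exists_multiplier (hM : M.IsErgodic) {πstar πbar : Policy S A} (hopt : M.IsOptimal πstar)
    {δ : ℝ} (hδ : 0 < δ) (hbar : δ ≤ M.J .c πbar) :
    ∃ l : ℝ, l ≤ 1 / δ ∧ ∀ π : Policy S A, l * M.J .c π ≤ M.J .r πstar - M.J .r π := by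
  -- In the plane of pairs `(J_c, J_r)` the multiplier is the steepest rate at which reward above
  -- the optimum can be bought by violating the constraint. The inserted `0` keeps the set nonempty
  -- if no policy is infeasible.
  set X : Set ℝ := insert 0 {x | ∃ π : Policy S A, M.J .c π < 0 ∧
    x = (M.J .r π - M.J .r πstar) / (- M.J .c π)} with hX
  have hslope : ∀ π' : Policy S A, 0 < M.J .c π' → ∀ x ∈ X,
      x ≤ (M.J .r πstar - M.J .r π') / M.J .c π' := by
    intro π' hπ' x hx
    rcases hx with rfl | ⟨π, hπ, rfl⟩
    · exact div_nonneg (sub_nonneg.2 (hopt.2 π' hπ'.le)) hπ'.le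
    · set a := M.J .c π' with ha
      set b := - M.J .c π with hb
      have hb0 : 0 < b := by linarith
      -- These weights mix a strictly feasible and an infeasible policy so that the constraint value
      -- is exactly zero; optimality over feasible policies then compares the two slopes.
      obtain ⟨πm, hπm⟩ := exists_policy_mix hM π' π (t := b / (a + b)) (u := a / (a + b))
        (by positivity) (by positivity) (by field_simp; ring)
      have hc : M.J .c πm = 0 := by
        rw [hπm, ← ha, show M.J .c π = -b by simp [hb]]
        field_simp
        ring
      have h1 := hopt.2 πm hc.ge
      rw [hπm] at h1
      rw [div_le_div_iff₀ hb0 hπ']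
      have h2 : b / (a + b) * M.J .r π' + a / (a + b) * M.J .r π =
          (b * M.J .r π' + a * M.J .r π) / (a + b) := by field_simp
      rw [h2, div_le_iff₀ (by positivity)] at h1
      linarith
  have hbar0 : 0 < M.J .c πbar := hδ.trans_le hbar
  have hne : X.Nonempty := ⟨0, Set.mem_insert _ _⟩
  have hbdd : BddAbove X := ⟨_, hslope πbar hbar0⟩
  refine ⟨sSup X, ?_, fun π => ?_⟩
  -- The Slater policy bounds every slope by a quotient with numerator at most `1`, since rewards
  -- lie in `[0,1]`, and denominator at least `δ`.
  · refine (csSup_le hne (hslope πbar hbar0)).trans ?_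
    rw [div_le_div_iff₀ hbar0 hδ]
    have h1 := J_le_one hM .r πstar
    have h2 := J_r_nonneg hM πbar
    nlinarith
  · rcases lt_trichotomy (M.J .c π) 0 with h | h | h
    · have h1 := le_csSup hbdd (show _ ∈ X from Set.mem_insert_of_mem _ ⟨π, h, rfl⟩)
      rw [div_le_iff₀ (by linarith)] at h1
      linarith
    · rw [h, mul_zero]
      exact sub_nonneg.2 (hopt.2 π h.ge)
    · exact (le_div_iff₀ h).1 (csSup_le hne (hslope π h))

end Duality
end PDNAC

namespace PDNAC


/-! ### Sums along a trajectory through the Poisson equation. -/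

section Trajectories

variable {S A : Type*} [Fintype S] [DecidableEq S] [Fintype A] {M : CMDP S A}
  {E : Type*} [NormedAddCommGroup E] [InnerProductSpace ℝ E]

theorem mean_inner {X : Type*} (p : PMF X) [FinSupp p] (v : E) (f : X → E) :
    mean p (fun x => inner ℝ v (f x)) = inner ℝ v (mean p f) :=
  mean_linear p (innerₛₗ ℝ v) f

theorem mean_norm_add_sq {X : Type*} (p : PMF X) [FinSupp p] (v : E) (f : X → E) :
    mean p (fun x => ‖v + f x‖ ^ 2) =
      ‖v‖ ^ 2 + 2 * inner ℝ v (mean p f) + mean p fun x => ‖f x‖ ^ 2 := by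
  simp_rw [norm_add_sq_real]
  rw [mean_add, mean_add, mean_const, mean_const_mul, mean_inner]

theorem norm_add_sq_le_two (x y : E) : ‖x + y‖ ^ 2 ≤ 2 * ‖x‖ ^ 2 + 2 * ‖y‖ ^ 2 := by
  have h := norm_add_le x y
  nlinarith [norm_nonneg (x + y), sq_nonneg (‖x‖ - ‖y‖)]

theorem norm_sub_sq_le_two (x y : E) : ‖x - y‖ ^ 2 ≤ 2 * ‖x‖ ^ 2 + 2 * ‖y‖ ^ 2 := by
  simpa [sub_eq_add_neg] using norm_add_sq_le_two x (-y)

/-- The mean of `f (s, a, s')` over one transition from `s` under `π`. -/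
noncomputable def CMDP.stepMean (M : CMDP S A) (π : Policy S A) (f : Sample S A → E) (s : S) : E :=
  mean (π s) fun a => mean (M.P s a) fun s' => f (s, a, s')

theorem norm_stepMean_le (π : Policy S A) {f : Sample S A → E} {σ : ℝ} (hf : ∀ z, ‖f z‖ ≤ σ)
    (s : S) : ‖M.stepMean π f s‖ ≤ σ :=
  norm_mean_le_of_le fun _ => norm_mean_le_of_le fun _ => hf _

theorem statMean_eq_sum_stepMean (M : CMDP S A) (π : Policy S A) (f : Sample S A → E) :
    M.statMean π f = ∑ s, M.statDist π s • M.stepMean π f s := by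
  simp only [CMDP.statMean, CMDP.stepMean, mean_fintype, smul_sum, CMDP.occ, mul_smul]

theorem norm_statMean_le (M : CMDP S A) (π : Policy S A) {f : Sample S A → E} {σ : ℝ}
    (hf : ∀ z, ‖f z‖ ≤ σ) : ‖M.statMean π f‖ ≤ σ := by
  rw [statMean_eq_sum_stepMean]
  calc _ ≤ ∑ s, M.statDist π s * σ := by
        refine (norm_sum_le _ _).trans (sum_le_sum fun s _ => ?_)
        rw [norm_smul, Real.norm_of_nonneg (statDist_nonneg M π s)]
        exact mul_le_mul_of_nonneg_left (norm_stepMean_le π hf s) (statDist_nonneg M π s)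
    _ = σ := by rw [← sum_mul, sum_statDist, one_mul]

theorem stepMean_next (M : CMDP S A) (π : Policy S A) (h : S → E) (s : S) :
    M.stepMean π (fun z => h z.2.2) s = ∑ s', M.transMat π s s' • h s' := by
  simp only [CMDP.stepMean, mean_fintype, CMDP.transMat, Matrix.of_apply, sum_smul, smul_sum,
    mul_smul]
  rw [sum_comm]

/-- The solution of the Poisson equation for `f`. -/
noncomputable def CMDP.poisson (M : CMDP S A) (π : Policy S A) (f : Sample S A → E) (s : S) : E :=
  ∑ s', M.devSum π s s' • M.stepMean π f s'

theorem poisson_eq (hM : M.IsErgodic) (π : Policy S A) (f : Sample S A → E) (s : S) :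
    M.stepMean π f s + M.stepMean π (fun z => M.poisson π f z.2.2) s =
      M.poisson π f s + M.statMean π f := by
  have h : M.poisson π f s = ∑ s', ((1 : Matrix S S ℝ) s s' - M.statDist π s'
      + ∑ k, M.transMat π s k * M.devSum π k s') • M.stepMean π f s' :=
    sum_congr rfl fun s' _ => by rw [← devSum_poisson hM]
  rw [h, stepMean_next, statMean_eq_sum_stepMean]
  simp only [add_smul, sub_smul, sum_add_distrib, sum_sub_distrib, Matrix.one_apply, ite_smul,
    one_smul, zero_smul, sum_ite_eq, mem_univ, if_true, CMDP.poisson, smul_sum, sum_smul, mul_smul]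
  rw [sum_comm (f := fun s' k => M.transMat π s k • M.devSum π k s' • M.stepMean π f s')]
  abel

theorem norm_poisson_le (hM : M.IsErgodic) (π : Policy S A) {f : Sample S A → E} {σ τ : ℝ}
    (hf : ∀ z, ‖f z‖ ≤ σ) (hσ : 0 ≤ σ) (hτ : M.mixTime π ≤ τ) (s : S) :
    ‖M.poisson π f s‖ ≤ 4 * τ * σ := by
  calc _ ≤ ∑ s', |M.devSum π s s'| * σ := by
        refine (norm_sum_le _ _).trans (sum_le_sum fun s' _ => ?_)
        rw [norm_smul, Real.norm_eq_abs]
        exact mul_le_mul_of_nonneg_left (norm_stepMean_le π hf s') (abs_nonneg _)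
    _ ≤ 4 * τ * σ := by
        rw [← sum_mul]
        refine mul_le_mul_of_nonneg_right ((sum_abs_devSum_le hM π s).trans ?_) hσ
        linarith

instance instFinSuppTraj (M : CMDP S A) (π : Policy S A) (n : ℕ) (s : S) :
    FinSupp (M.traj π n s) := by
  induction n generalizing s with
  | zero => exact instFinSuppPure _
  | succ n ih => rw [CMDP.traj]; infer_instance

theorem mean_traj_zero {F : Type*} [NormedAddCommGroup F] [NormedSpace ℝ F]
    (M : CMDP S A) (π : Policy S A) (s : S) (f : List (Sample S A) × S → F) :
    mean (M.traj π 0 s) f = f ([], s) := by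
  rw [CMDP.traj, mean_pure]

theorem mean_traj_succ {F : Type*} [NormedAddCommGroup F] [NormedSpace ℝ F]
    (M : CMDP S A) (π : Policy S A) (n : ℕ) (s : S) (f : List (Sample S A) × S → F) :
    mean (M.traj π (n + 1) s) f = mean (π s) fun a => mean (M.P s a) fun s' =>
      mean (M.traj π n s') fun x => f ((s, a, s') :: x.1, x.2) := by
  rw [CMDP.traj, mean_bind]
  congr 1; ext a
  rw [mean_bind]
  congr 1; ext s'
  rw [mean_map]

/-- By the Markov property an initial segment of a longer run has the law of a shorter run, so all
MLMC levels can be analysed on one trajectory. -/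
theorem mean_traj_take {F : Type*} [NormedAddCommGroup F] [NormedSpace ℝ F]
    (M : CMDP S A) (π : Policy S A) (n k : ℕ) (s : S) (f : List (Sample S A) → F) :
    mean (M.traj π (n + k) s) (fun x => f (x.1.take n)) = mean (M.traj π n s) fun x => f x.1 := by
  induction n generalizing s f with
  | zero => simp [mean_const, mean_traj_zero]
  | succ n ih =>
    rw [Nat.add_right_comm, mean_traj_succ, mean_traj_succ]
    simp only [List.take_succ_cons]
    congr 1; ext a
    congr 1; ext s'
    exact ih s' fun l => f ((s, a, s') :: l)

/-- By the Poisson equation the centred sum plus the boundary values of the Poisson solution is a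
martingale started at zero. -/
theorem mean_traj_sum (hM : M.IsErgodic) (π : Policy S A) (f : Sample S A → E) (n : ℕ) (s : S) :
    mean (M.traj π n s) (fun x => (x.1.map f).sum - (n : ℝ) • M.statMean π f
      + M.poisson π f x.2 - M.poisson π f s) = 0 := by
  induction n generalizing s with
  | zero => simp [mean_traj_zero]
  | succ n ih =>
    rw [mean_traj_succ]
    have h1 : ∀ a s', mean (M.traj π n s') (fun x => (((s, a, s') :: x.1).map f).sum
        - ((n + 1 : ℕ) : ℝ) • M.statMean π f + M.poisson π f x.2 - M.poisson π f s) =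
        f (s, a, s') + M.poisson π f s' - (M.statMean π f + M.poisson π f s) := by
      intro a s'
      have h2 : ∀ x : List (Sample S A) × S, (((s, a, s') :: x.1).map f).sum
          - ((n + 1 : ℕ) : ℝ) • M.statMean π f + M.poisson π f x.2 - M.poisson π f s =
          ((x.1.map f).sum - (n : ℝ) • M.statMean π f + M.poisson π f x.2 - M.poisson π f s') +
          (f (s, a, s') + M.poisson π f s' - (M.statMean π f + M.poisson π f s)) := by
        intro x
        simp only [List.map_cons, List.sum_cons, Nat.cast_add, Nat.cast_one, add_smul, one_smul]
        abel
      simp_rw [h2]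
      rw [mean_add, ih, mean_const, zero_add]
    simp_rw [h1, mean_sub, mean_add, mean_const]
    have h3 := poisson_eq hM π f s
    simp only [CMDP.stepMean] at h3
    rw [h3]
    abel

/-- Martingale increments are orthogonal, so the second moment grows linearly in `n`: conditionally
on the first transition, the remaining sum has mean zero and the cross term vanishes. -/
theorem mean_traj_sum_sq (hM : M.IsErgodic) (π : Policy S A) (f : Sample S A → E) {D : ℝ}
    (hD : ∀ s a s', ‖f (s, a, s') - M.statMean π f + M.poisson π f s' - M.poisson π f s‖ ≤ D)
    (n : ℕ) (s : S) :
    mean (M.traj π n s) (fun x => ‖(x.1.map f).sum - (n : ℝ) • M.statMean π f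
      + M.poisson π f x.2 - M.poisson π f s‖ ^ 2) ≤ n * D ^ 2 := by
  induction n generalizing s with
  | zero => simp [mean_traj_zero]
  | succ n ih =>
    rw [mean_traj_succ]
    refine mean_le_of_le fun a _ => mean_le_of_le fun s' _ => ?_
    have h2 : ∀ x : List (Sample S A) × S, (((s, a, s') :: x.1).map f).sum
        - ((n + 1 : ℕ) : ℝ) • M.statMean π f + M.poisson π f x.2 - M.poisson π f s =
        (f (s, a, s') - M.statMean π f + M.poisson π f s' - M.poisson π f s) +
        ((x.1.map f).sum - (n : ℝ) • M.statMean π f + M.poisson π f x.2 - M.poisson π f s') := by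
      intro x
      simp only [List.map_cons, List.sum_cons, Nat.cast_add, Nat.cast_one, add_smul, one_smul]
      abel
    simp_rw [h2]
    rw [mean_norm_add_sq, mean_traj_sum hM, inner_zero_right]
    have h3 := ih s'
    have h4 := pow_le_pow_left₀ (norm_nonneg _) (hD s a s') 2
    push_cast
    linarith

theorem mean_traj_sum_sub_sq_le (hM : M.IsErgodic) (π : Policy S A) {f : Sample S A → E} {σ τ : ℝ}
    (hf : ∀ z, ‖f z‖ ≤ σ) (hσ : 0 ≤ σ) (hτ : M.mixTime π ≤ τ) (hτ1 : 1 ≤ τ) {n : ℕ} (hn : 1 ≤ n)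
    (s : S) :
    mean (M.traj π n s) (fun x => ‖(x.1.map f).sum - (n : ℝ) • M.statMean π f‖ ^ 2) ≤
      400 * n * (τ * σ) ^ 2 := by
  have hh := norm_poisson_le hM π hf hσ hτ
  have hm := norm_statMean_le M π hf
  have hστ : σ ≤ τ * σ := le_mul_of_one_le_left hσ hτ1
  -- The sample and its mean contribute `2σ`, the two values of the Poisson solution `8τσ`.
  -- Returning below to the plain sum costs a factor `2` and a boundary term: `200 n + 128 ≤ 400 n`.
  have hD : ∀ s a s', ‖f (s, a, s') - M.statMean π f + M.poisson π f s' - M.poisson π f s‖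
      ≤ 10 * (τ * σ) := by
    intro s a s'
    have h1 := norm_sub_le (f (s, a, s') - M.statMean π f + M.poisson π f s') (M.poisson π f s)
    have h2 := norm_add_le (f (s, a, s') - M.statMean π f) (M.poisson π f s')
    have h3 := norm_sub_le (f (s, a, s')) (M.statMean π f)
    have := hf (s, a, s')
    have := hh s
    have := hh s'
    linarith
  have key := mean_traj_sum_sq hM π f hD n s
  have hpt : ∀ x ∈ (M.traj π n s).support, ‖(x.1.map f).sum - (n : ℝ) • M.statMean π f‖ ^ 2 ≤
      2 * ‖(x.1.map f).sum - (n : ℝ) • M.statMean π f + M.poisson π f x.2 - M.poisson π f s‖ ^ 2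
        + 128 * (τ * σ) ^ 2 := by
    intro x _
    have h1 := norm_add_sq_le_two ((x.1.map f).sum - (n : ℝ) • M.statMean π f
      + M.poisson π f x.2 - M.poisson π f s) (M.poisson π f s - M.poisson π f x.2)
    have h2 : (x.1.map f).sum - (n : ℝ) • M.statMean π f + M.poisson π f x.2 - M.poisson π f s
        + (M.poisson π f s - M.poisson π f x.2) = (x.1.map f).sum - (n : ℝ) • M.statMean π f := by
      abel
    rw [h2] at h1
    have h3 : ‖M.poisson π f s - M.poisson π f x.2‖ ≤ 8 * (τ * σ) := by
      have := norm_sub_le (M.poisson π f s) (M.poisson π f x.2)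
      linarith [hh s, hh x.2]
    have h4 := pow_le_pow_left₀ (norm_nonneg _) h3 2
    nlinarith
  refine (mean_mono hpt).trans ?_
  rw [mean_add, mean_const_mul, mean_const]
  have hn' : (1 : ℝ) ≤ n := by exact_mod_cast hn
  have : 0 ≤ (τ * σ) ^ 2 := sq_nonneg _
  nlinarith [mul_le_mul_of_nonneg_right hn' this]

/-- The mean of `f` over the first `2^j` samples. -/
noncomputable def prefixAvg (f : Sample S A → E) (j : ℕ) (zs : List (Sample S A)) : E :=
  ((2 : ℝ) ^ j)⁻¹ • ((zs.take (2 ^ j)).map f).sum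

theorem mean_prefixAvg_sub_sq_le (hM : M.IsErgodic) (π : Policy S A) {f : Sample S A → E}
    {σ τ : ℝ} (hf : ∀ z, ‖f z‖ ≤ σ) (hσ : 0 ≤ σ) (hτ : M.mixTime π ≤ τ) (hτ1 : 1 ≤ τ) (j : ℕ)
    {N : ℕ} (hN : 2 ^ j ≤ N) (s : S) :
    mean (M.traj π N s) (fun x => ‖prefixAvg f j x.1 - M.statMean π f‖ ^ 2) ≤
      400 * (τ * σ) ^ 2 / 2 ^ j := by
  obtain ⟨k, rfl⟩ := Nat.exists_eq_add_of_le hN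
  have h1 := mean_traj_take M π (2 ^ j) k s
    fun l => ‖((2 : ℝ) ^ j)⁻¹ • (l.map f).sum - M.statMean π f‖ ^ 2
  have h2 : ∀ l : List (Sample S A), ‖((2 : ℝ) ^ j)⁻¹ • (l.map f).sum - M.statMean π f‖ ^ 2 =
      (((2 : ℝ) ^ j)⁻¹) ^ 2 * ‖(l.map f).sum - ((2 ^ j : ℕ) : ℝ) • M.statMean π f‖ ^ 2 := by
    intro l
    have h3 : ((2 : ℝ) ^ j)⁻¹ • (l.map f).sum - M.statMean π f =
        ((2 : ℝ) ^ j)⁻¹ • ((l.map f).sum - ((2 ^ j : ℕ) : ℝ) • M.statMean π f) := by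
      rw [smul_sub, smul_smul]
      simp
    rw [h3, norm_smul, mul_pow, Real.norm_of_nonneg (by positivity)]
  simp only [prefixAvg]
  rw [h1]
  simp_rw [h2]
  rw [mean_const_mul]
  have h4 := mean_traj_sum_sub_sq_le hM π hf hσ hτ hτ1 (n := 2 ^ j) Nat.one_le_two_pow s
  refine (mul_le_mul_of_nonneg_left h4 (by positivity)).trans_eq ?_
  push_cast
  field_simp

/-- The bias of an empirical average is purely a boundary effect of the Poisson solution, hence of
order `τ / 2^j`, better than the `2^{-j/2}` fluctuation. -/
theorem mean_prefixAvg (hM : M.IsErgodic) (π : Policy S A) (f : Sample S A → E) (j : ℕ) {N : ℕ}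
    (hN : 2 ^ j ≤ N) (s : S) :
    mean (M.traj π N s) (fun x => prefixAvg f j x.1) = M.statMean π f + ((2 : ℝ) ^ j)⁻¹ •
      (M.poisson π f s - mean (M.traj π (2 ^ j) s) fun x => M.poisson π f x.2) := by
  obtain ⟨k, rfl⟩ := Nat.exists_eq_add_of_le hN
  have h1 := mean_traj_take M π (2 ^ j) k s fun l => ((2 : ℝ) ^ j)⁻¹ • (l.map f).sum
  simp only [prefixAvg]
  rw [h1, mean_smul]
  have h2 := mean_traj_sum hM π f (2 ^ j) s
  rw [mean_sub, mean_add, mean_sub, mean_const, mean_const] at h2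
  have h3 : mean (M.traj π (2 ^ j) s) (fun x => (x.1.map f).sum) =
      ((2 ^ j : ℕ) : ℝ) • M.statMean π f + (M.poisson π f s
        - mean (M.traj π (2 ^ j) s) fun x => M.poisson π f x.2) := by
    rw [← sub_eq_zero, ← h2]
    abel
  rw [h3, smul_add, smul_smul]
  simp

theorem norm_prefixAvg_zero_le {f : Sample S A → E} {σ : ℝ} (hf : ∀ z, ‖f z‖ ≤ σ) (hσ : 0 ≤ σ)
    (zs : List (Sample S A)) : ‖prefixAvg f 0 zs‖ ≤ σ := by
  rcases zs with _ | ⟨z, zs⟩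
  · simpa [prefixAvg] using hσ
  · have h : prefixAvg f 0 (z :: zs) = f z := by
      change ((2 : ℝ) ^ 0)⁻¹ • (f z + 0) = f z
      simp
    rw [h]
    exact hf z

end Trajectories

/-! ### The random level, truncated to finite support. -/

section Levels

/-- The geometric law truncated at level `J + 1`. -/
noncomputable def levelPMF (J : ℕ) : PMF ℕ := geomHalf.map fun q => min q (J + 1)

theorem levelPMF_support_subset (J : ℕ) :
    (levelPMF J).support ⊆ (range (J + 2) : Finset ℕ) := by
  intro q hq
  rw [levelPMF, PMF.mem_support_map_iff] at hq
  obtain ⟨a, -, rfl⟩ := hq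
  simp only [coe_range, Set.mem_Iio]
  omega

instance instFinSuppLevel (J : ℕ) : FinSupp (levelPMF J) :=
  ⟨(range (J + 2)).finite_toSet.subset (levelPMF_support_subset J)⟩

theorem levelPMF_apply_of_le {J q : ℕ} (hq : q ≤ J) : levelPMF J q = geomHalf q := by
  rw [levelPMF, PMF.map_apply, tsum_eq_single q]
  · rw [if_pos (by omega)]
  · intro a ha
    rw [if_neg (by omega)]

/-- Levels `1, …, J` keep their weights `2^{-q}`; the remaining mass `2^{-J}` is collected at `J +
1`. -/
theorem mean_levelPMF {E : Type*} [NormedAddCommGroup E] [NormedSpace ℝ E] (J : ℕ) (f : ℕ → E) :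
    mean (levelPMF J) f = ∑ q ∈ range J, ((2 : ℝ) ^ (q + 1))⁻¹ • f (q + 1)
      + ((2 : ℝ) ^ J)⁻¹ • f (J + 1) := by
  have h0 : (levelPMF J 0).toReal = 0 := by
    rw [levelPMF_apply_of_le (Nat.zero_le J)]
    rfl
  have h1 : ∀ q ∈ range J, (levelPMF J (q + 1)).toReal = ((2 : ℝ) ^ (q + 1))⁻¹ := by
    intro q hq
    rw [levelPMF_apply_of_le (by simpa using hq)]
    have : geomHalf (q + 1) = (2⁻¹ : ENNReal) ^ (q + 1) := rfl
    rw [this]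
    simp
  have hgeom : ∑ q ∈ range J, ((2 : ℝ) ^ (q + 1))⁻¹ = 1 - ((2 : ℝ) ^ J)⁻¹ := by
    induction J with
    | zero => simp
    | succ J ih =>
      rw [sum_range_succ, ih]
      · rw [pow_succ]
        field_simp
        ring
      · rw [levelPMF_apply_of_le (Nat.zero_le J)]; rfl
      · intro q hq
        rw [levelPMF_apply_of_le (by simpa using hq)]
        have : geomHalf (q + 1) = (2⁻¹ : ENNReal) ^ (q + 1) := rfl
        rw [this]
        simp
  have h2 : (levelPMF J (J + 1)).toReal = ((2 : ℝ) ^ J)⁻¹ := by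
    have h := sum_toReal_of_subset (levelPMF J) _ (levelPMF_support_subset J)
    rw [sum_range_succ, sum_range_succ', sum_congr rfl h1, hgeom, h0] at h
    linarith
  rw [mean_eq_sum_of_subset _ _ (levelPMF_support_subset J), sum_range_succ, sum_range_succ', h0,
    h2, zero_smul, add_zero]
  congr 1
  exact sum_congr rfl fun q hq => by rw [h1 q hq]

end Levels

/-! ### Bias and second moment of the multi-level Monte Carlo estimate. -/

section MLMC

variable {S A : Type*} [Fintype S] [DecidableEq S] [Fintype A] {M : CMDP S A}
  {E : Type*} [NormedAddCommGroup E] [InnerProductSpace ℝ E]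

/-- The joint law of the truncated level and of the trajectory of one inner step. -/
noncomputable def CMDP.levelTraj (M : CMDP S A) (π : Policy S A) (T : ℕ) (s : S) :
    PMF (ℕ × List (Sample S A) × S) :=
  (levelPMF (Nat.log 2 T)).bind fun q => (M.traj π (trajLen T q) s).map fun y => (q, y)

instance instFinSuppLevelTraj (M : CMDP S A) (π : Policy S A) (T : ℕ) (s : S) :
    FinSupp (M.levelTraj π T s) := by
  rw [CMDP.levelTraj]; infer_instance

/-- All levels with `2^q > T` draw one transition and apply the same update, so the geometric law
may be replaced by its truncation. This keeps every law of the algorithm finitely supported. -/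
theorem geomHalf_bind_traj_eq {X : Type*} (M : CMDP S A) (π : Policy S A) {T : ℕ}
    (s : S) (Φ : ℕ → List (Sample S A) × S → X)
    (hΦ : ∀ q, T < 2 ^ q → ∀ q', T < 2 ^ q' → Φ q = Φ q') :
    (geomHalf.bind fun q => (M.traj π (trajLen T q) s).map (Φ q)) =
      (M.levelTraj π T s).map fun w => Φ w.1 w.2 := by
  rw [CMDP.levelTraj, PMF.map_bind, levelPMF, PMF.bind_map]
  congr 1
  ext1 q
  simp only [Function.comp_def, PMF.map_comp]
  rcases le_or_gt q (Nat.log 2 T + 1) with h | h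
  · rw [min_eq_left h]
  · rw [min_eq_right h.le]
    have h1 : T < 2 ^ (Nat.log 2 T + 1) := Nat.lt_pow_succ_log_self (by norm_num) T
    have h2 : T < 2 ^ q := h1.trans_le (Nat.pow_le_pow_right (by norm_num) h.le)
    rw [hΦ q h2 _ h1]
    simp only [trajLen, if_neg (not_le.2 h1), if_neg (not_le.2 h2)]

theorem mean_levelTraj {F : Type*} [NormedAddCommGroup F] [NormedSpace ℝ F]
    (M : CMDP S A) (π : Policy S A) {T : ℕ} (hT : T ≠ 0) (s : S)
    (f : ℕ → List (Sample S A) → F) :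
    mean (M.levelTraj π T s) (fun w => f w.1 w.2.1) =
      ∑ q ∈ range (Nat.log 2 T), ((2 : ℝ) ^ (q + 1))⁻¹ •
        mean (M.traj π (2 ^ (q + 1)) s) (fun x => f (q + 1) x.1)
      + ((2 : ℝ) ^ Nat.log 2 T)⁻¹ •
        mean (M.traj π 1 s) (fun x => f (Nat.log 2 T + 1) x.1) := by
  have h1 : T < 2 ^ (Nat.log 2 T + 1) := Nat.lt_pow_succ_log_self (by norm_num) T
  rw [CMDP.levelTraj, mean_bind]
  simp_rw [mean_map]
  rw [mean_levelPMF]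
  congr 1
  · refine sum_congr rfl fun q hq => ?_
    have h2 : 2 ^ (q + 1) ≤ T :=
      (Nat.pow_le_pow_right (by norm_num) (by simpa using hq)).trans (Nat.pow_log_le_self 2 hT)
    rw [trajLen, if_pos h2, Nat.sub_add_cancel Nat.one_le_two_pow]
  · rw [trajLen, if_neg (not_le.2 h1)]

theorem mlmc_eq_of_le {T q : ℕ} (hq : 2 ^ (q + 1) ≤ T) (zs : List (Sample S A))
    (f : Sample S A → E) : mlmc T (q + 1) zs f = prefixAvg f 0 zs
      + (2 : ℝ) ^ (q + 1) • (prefixAvg f (q + 1) zs - prefixAvg f q zs) := by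
  simp only [mlmc, if_pos hq, prefixAvg, Nat.add_sub_cancel]

theorem mlmc_eq_of_lt {T q : ℕ} (hq : T < 2 ^ q) (zs : List (Sample S A))
    (f : Sample S A → E) : mlmc T q zs f = prefixAvg f 0 zs := by
  simp only [mlmc, if_neg (not_le.2 hq), prefixAvg, add_zero]

/-- The factor `2^q` cancels the probability of level `q`, so the mean differences telescope and
only the average over `2^J` samples remains, `J` being the largest admissible level. Its bias is at
most `8τσ / 2^J`, and `2^J > T/2`. -/
theorem norm_mean_mlmc_sub_le (hM : M.IsErgodic) (π : Policy S A) {f : Sample S A → E} {σ τ : ℝ}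
    (hf : ∀ z, ‖f z‖ ≤ σ) (hσ : 0 ≤ σ) (hτ : M.mixTime π ≤ τ) {T : ℕ} (hT : T ≠ 0) (s : S) :
    ‖mean (M.levelTraj π T s) (fun w => mlmc T w.1 w.2.1 f) - M.statMean π f‖ ≤
      16 * τ * σ / T := by
  set J := Nat.log 2 T with hJ
  set a : ℕ → E := fun j => M.statMean π f + ((2 : ℝ) ^ j)⁻¹ •
    (M.poisson π f s - mean (M.traj π (2 ^ j) s) fun x => M.poisson π f x.2) with ha
  have h1 : T < 2 ^ (J + 1) := Nat.lt_pow_succ_log_self (by norm_num) T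
  have hmean : mean (M.levelTraj π T s) (fun w => mlmc T w.1 w.2.1 f) = a J := by
    rw [mean_levelTraj M π hT s fun q zs => mlmc T q zs f, ← hJ]
    have h3 : ∀ q ∈ range J, ((2 : ℝ) ^ (q + 1))⁻¹ • mean (M.traj π (2 ^ (q + 1)) s)
        (fun x => mlmc T (q + 1) x.1 f) = ((2 : ℝ) ^ (q + 1))⁻¹ • a 0 + (a (q + 1) - a q) := by
      intro q hq
      have h2 : 2 ^ (q + 1) ≤ T :=
        (Nat.pow_le_pow_right (by norm_num) (by simpa using hq)).trans (Nat.pow_log_le_self 2 hT)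
      simp_rw [mlmc_eq_of_le h2]
      rw [mean_add, mean_smul, mean_sub, mean_prefixAvg hM π f 0 (Nat.pow_le_pow_right (by norm_num) (by omega)),
        mean_prefixAvg hM π f (q + 1) le_rfl,
        mean_prefixAvg hM π f q (Nat.pow_le_pow_right (by norm_num) (by omega)), smul_add, smul_smul,
        inv_mul_cancel₀ (by positivity), one_smul]
    rw [sum_congr rfl h3, sum_add_distrib, sum_range_sub]
    simp_rw [mlmc_eq_of_lt h1]
    rw [mean_prefixAvg hM π f 0 (by simp)]
    have h4 := mean_levelPMF J fun _ => a 0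
    rw [mean_const] at h4
    change _ + (a J - a 0) + ((2 : ℝ) ^ J)⁻¹ • a 0 = a J
    rw [add_right_comm, ← h4]
    abel
  rw [hmean, ha]
  simp only [add_sub_cancel_left]
  have hh := norm_poisson_le hM π hf hσ hτ
  rw [norm_smul, Real.norm_of_nonneg (by positivity)]
  have h5 : ‖M.poisson π f s - mean (M.traj π (2 ^ J) s) fun x => M.poisson π f x.2‖
      ≤ 8 * τ * σ := by
    refine (norm_sub_le _ _).trans ?_
    have := norm_mean_le_of_le (p := M.traj π (2 ^ J) s)
      (f := fun x => M.poisson π f x.2) fun x => hh x.2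
    linarith [hh s]
  have h6 : ((2 : ℝ) ^ J)⁻¹ ≤ 2 / T := by
    have hT0 : (0 : ℝ) < T := by exact_mod_cast Nat.pos_of_ne_zero hT
    rw [inv_eq_one_div, div_le_div_iff₀ (by positivity) hT0]
    have : (T : ℝ) < 2 ^ (J + 1) := by exact_mod_cast h1
    rw [pow_succ] at this
    linarith
  calc _ ≤ 2 / T * (8 * τ * σ) :=
        mul_le_mul h6 h5 (norm_nonneg _) (by positivity)
    _ = _ := by ring

/-- Level `q` has weight `2^{-q}`, squared amplification `4^q` and variance of order `2^{-q}`, so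
every level contributes the same amount `O(τ²σ²)` and the sum is proportional to the number of
levels. -/
theorem mean_mlmc_sq_le (hM : M.IsErgodic) (π : Policy S A) {f : Sample S A → E} {σ τ : ℝ}
    (hf : ∀ z, ‖f z‖ ≤ σ) (hσ : 0 ≤ σ) (hτ : M.mixTime π ≤ τ) (hτ1 : 1 ≤ τ) {T : ℕ} (hT : T ≠ 0)
    (s : S) :
    mean (M.levelTraj π T s) (fun w => ‖mlmc T w.1 w.2.1 f‖ ^ 2) ≤
      5000 * (Nat.log 2 T + 1) * (τ * σ) ^ 2 := by
  set J := Nat.log 2 T with hJ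
  have h1 : T < 2 ^ (J + 1) := Nat.lt_pow_succ_log_self (by norm_num) T
  rw [mean_levelTraj M π hT s fun q zs => ‖mlmc T q zs f‖ ^ 2]
  have hστ : σ ^ 2 ≤ (τ * σ) ^ 2 :=
    pow_le_pow_left₀ hσ (le_mul_of_one_le_left hσ hτ1) 2
  -- The constant is `4 · (400 + 800)`: the finer average has variance `400 (τσ)² / 2^(q+1)`, the
  -- coarser one twice that.
  have h3 : ∀ q ∈ range J, ((2 : ℝ) ^ (q + 1))⁻¹ • mean (M.traj π (2 ^ (q + 1)) s)
      (fun x => ‖mlmc T (q + 1) x.1 f‖ ^ 2) ≤ ((2 : ℝ) ^ (q + 1))⁻¹ • (2 * σ ^ 2)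
        + 4800 * (τ * σ) ^ 2 := by
    intro q hq
    have h2 : 2 ^ (q + 1) ≤ T :=
      (Nat.pow_le_pow_right (by norm_num) (by simpa using hq)).trans (Nat.pow_log_le_self 2 hT)
    have hpt : ∀ x ∈ (M.traj π (2 ^ (q + 1)) s).support, ‖mlmc T (q + 1) x.1 f‖ ^ 2 ≤
        2 * σ ^ 2 + (4 * ((2 : ℝ) ^ (q + 1)) ^ 2) *
          (‖prefixAvg f (q + 1) x.1 - M.statMean π f‖ ^ 2
            + ‖prefixAvg f q x.1 - M.statMean π f‖ ^ 2) := by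
      intro x _
      rw [mlmc_eq_of_le h2]
      refine (norm_add_sq_le_two _ _).trans ?_
      have h4 := pow_le_pow_left₀ (norm_nonneg _) (norm_prefixAvg_zero_le hf hσ x.1) 2
      have h5 := norm_sub_sq_le_two (prefixAvg f (q + 1) x.1 - M.statMean π f)
        (prefixAvg f q x.1 - M.statMean π f)
      rw [sub_sub_sub_cancel_right] at h5
      rw [norm_smul, mul_pow, Real.norm_of_nonneg (by positivity)]
      have h6 := mul_le_mul_of_nonneg_left h5 (sq_nonneg ((2 : ℝ) ^ (q + 1)))
      nlinarith
    have h7 := mean_mono hpt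
    rw [mean_add, mean_const, mean_const_mul, mean_add] at h7
    have h8 := mean_prefixAvg_sub_sq_le hM π hf hσ hτ hτ1 (q + 1) le_rfl s
    have h9 := mean_prefixAvg_sub_sq_le hM π hf hσ hτ hτ1 q (N := 2 ^ (q + 1))
      (Nat.pow_le_pow_right (by norm_num) (by omega)) s
    have h10 : mean (M.traj π (2 ^ (q + 1)) s) (fun x => ‖mlmc T (q + 1) x.1 f‖ ^ 2) ≤
        2 * σ ^ 2 + (4 * ((2 : ℝ) ^ (q + 1)) ^ 2) *
          (400 * (τ * σ) ^ 2 / 2 ^ (q + 1) + 400 * (τ * σ) ^ 2 / 2 ^ q) :=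
      h7.trans (add_le_add le_rfl
        (mul_le_mul_of_nonneg_left (add_le_add h8 h9) (by positivity)))
    simp only [smul_eq_mul]
    refine (mul_le_mul_of_nonneg_left h10 (by positivity)).trans_eq ?_
    rw [pow_succ]
    field_simp
    ring
  have h4 : mean (M.traj π 1 s) (fun x => ‖mlmc T (J + 1) x.1 f‖ ^ 2) ≤ 2 * σ ^ 2 := by
    refine mean_le_of_le fun x _ => ?_
    rw [mlmc_eq_of_lt h1]
    have := pow_le_pow_left₀ (norm_nonneg _) (norm_prefixAvg_zero_le hf hσ x.1) 2
    nlinarith [sq_nonneg σ]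
  have h5 := mean_levelPMF J fun _ => 2 * σ ^ 2
  rw [mean_const] at h5
  calc _ ≤ ∑ q ∈ range J, (((2 : ℝ) ^ (q + 1))⁻¹ • (2 * σ ^ 2) + 4800 * (τ * σ) ^ 2)
        + ((2 : ℝ) ^ J)⁻¹ • (2 * σ ^ 2) :=
        add_le_add (sum_le_sum h3) (mul_le_mul_of_nonneg_left h4 (by positivity))
    _ = 2 * σ ^ 2 + J * (4800 * (τ * σ) ^ 2) := by
        rw [sum_add_distrib, add_right_comm, ← h5, sum_const, card_range, nsmul_eq_mul]
    _ ≤ _ := by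
        have : (0 : ℝ) ≤ J * (τ * σ) ^ 2 := by positivity
        nlinarith

end MLMC
end PDNAC

namespace PDNAC


/-! ### Abstract recursions for the second moment and for the mean. -/

section Iteration

variable {X E : Type*} [NormedAddCommGroup E] [InnerProductSpace ℝ E]
  {step : X → PMF X} [∀ x, FinSupp (step x)] {e : X → E}

theorem mean_iter_succ {F : Type*} [NormedAddCommGroup F] [NormedSpace ℝ F] (n : ℕ) (x : X)
    (f : X → F) : mean (iter step (n + 1) x) f = mean (iter step n x) fun y => mean (step y) f := by
  rw [iter, mean_bind]

theorem mean_iter_sq_le {r B : ℝ} (hr0 : 0 ≤ r) (hr1 : r ≤ 1) (hB : 0 ≤ B)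
    (h : ∀ x, mean (step x) (fun y => ‖e y‖ ^ 2) ≤ (1 - r) * ‖e x‖ ^ 2 + r * B) (n : ℕ) (x : X) :
    mean (iter step n x) (fun y => ‖e y‖ ^ 2) ≤ ‖e x‖ ^ 2 + B := by
  induction n with
  | zero => simpa [iter] using hB
  | succ n ih =>
    rw [mean_iter_succ]
    refine (mean_mono fun y _ => h y).trans ?_
    rw [mean_add, mean_const, mean_const_mul]
    have h1 := mul_le_mul_of_nonneg_left ih (sub_nonneg.2 hr1)
    have h2 : 0 ≤ r * ‖e x‖ ^ 2 := by positivity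
    nlinarith

/-- The mean error obeys a linear contraction driven by the one-step bias. That bias is at most
affine in the error norm, so a uniform first-moment bound `Y` suffices to sum the geometric series.
-/
theorem norm_mean_iter_le {r b₁ b₂ Y : ℝ} (hr0 : 0 < r) (hr1 : r ≤ 1) (hb₁ : 0 ≤ b₁)
    (L : E →ₗ[ℝ] E) (hL : ∀ v, ‖L v‖ ≤ (1 - r) * ‖v‖)
    (h : ∀ x, ‖mean (step x) e - L (e x)‖ ≤ b₁ * ‖e x‖ + b₂) {x : X} (hb : 0 ≤ b₁ * Y + b₂)
    (hY : ∀ n, mean (iter step n x) (fun y => ‖e y‖) ≤ Y) (n : ℕ) :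
    ‖mean (iter step n x) e‖ ≤ (1 - r) ^ n * ‖e x‖ + (b₁ * Y + b₂) / r := by
  induction n with
  | zero =>
    simp only [iter, mean_pure, pow_zero, one_mul]
    exact le_add_of_nonneg_right (div_nonneg hb hr0.le)
  | succ n ih =>
    have h1 : mean (iter step (n + 1) x) e = L (mean (iter step n x) e)
        + mean (iter step n x) fun y => mean (step y) e - L (e y) := by
      rw [mean_iter_succ, mean_sub, mean_linear]
      abel
    have h2 : ‖mean (iter step n x) fun y => mean (step y) e - L (e y)‖ ≤ b₁ * Y + b₂ := by
      refine (norm_mean_le _).trans ((mean_mono fun y _ => h y).trans ?_)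
      rw [mean_add, mean_const, mean_const_mul]
      linarith [mul_le_mul_of_nonneg_left (hY n) hb₁]
    rw [h1]
    calc _ ≤ (1 - r) * ‖mean (iter step n x) e‖ + (b₁ * Y + b₂) :=
          (norm_add_le _ _).trans (add_le_add (hL _) h2)
      _ ≤ (1 - r) * ((1 - r) ^ n * ‖e x‖ + (b₁ * Y + b₂) / r) + (b₁ * Y + b₂) :=
          add_le_add (mul_le_mul_of_nonneg_left ih (sub_nonneg.2 hr1)) le_rfl
      _ = _ := by field_simp; ring

end Iteration

/-! ### Linear stochastic approximation with MLMC samples of a Markov chain. -/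

section LinearSA

variable {S A : Type*} [Fintype S] [DecidableEq S] [Fintype A]
  {E : Type*} [NormedAddCommGroup E] [InnerProductSpace ℝ E]

theorem statMean_sub {W : Type*} [AddCommGroup W] [Module ℝ W] (M : CMDP S A) (π : Policy S A)
    (f g : Sample S A → W) :
    M.statMean π (fun z => f z - g z) = M.statMean π f - M.statMean π g := by
  simp only [CMDP.statMean, smul_sub, sum_sub_distrib]

theorem statMean_add {W : Type*} [AddCommGroup W] [Module ℝ W] (M : CMDP S A) (π : Policy S A)
    (f g : Sample S A → W) :
    M.statMean π (fun z => f z + g z) = M.statMean π f + M.statMean π g := by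
  simp only [CMDP.statMean, smul_add, sum_add_distrib]

theorem statMean_linear {W W' : Type*} [AddCommGroup W] [Module ℝ W] [AddCommGroup W']
    [Module ℝ W'] (M : CMDP S A) (π : Policy S A) (L : W →ₗ[ℝ] W') (f : Sample S A → W) :
    M.statMean π (fun z => L (f z)) = L (M.statMean π f) := by
  simp only [CMDP.statMean, map_sum, map_smul]

theorem statMean_action {W : Type*} [AddCommGroup W] [Module ℝ W] (M : CMDP S A) (π : Policy S A)
    (f : S → A → W) :
    M.statMean π (fun z => f z.1 z.2.1) = ∑ s, ∑ a, M.occ π s a • f s a := by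
  simp only [CMDP.statMean, ← sum_smul, ← mul_sum, sum_toReal, mul_one]

theorem statMean_const {W : Type*} [AddCommGroup W] [Module ℝ W] (M : CMDP S A) (π : Policy S A)
    (w : W) : M.statMean π (fun _ => w) = w := by
  rw [statMean_action M π fun _ _ => w]
  simp_rw [← sum_smul]
  rw [sum_occ, one_smul]

/-- A linear stochastic approximation problem `B̄ x = b̄` observed along the chain of `π`:
`B z`, `b z` are bounded by `Λ`, `b₀` and `B̄` is `ρ`-strongly monotone. -/
structure IsLinearSA (M : CMDP S A) (π : Policy S A) (B : Sample S A → E →ₗ[ℝ] E)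
    (b : Sample S A → E) (Λ b₀ ρ : ℝ) (xs : E) : Prop where
  ρ_pos : 0 < ρ
  ρ_le : ρ ≤ Λ
  b₀_nonneg : 0 ≤ b₀
  B_le : ∀ z x, ‖B z x‖ ≤ Λ * ‖x‖
  b_le : ∀ z, ‖b z‖ ≤ b₀
  mono : ∀ x, ρ * ‖x‖ ^ 2 ≤ inner ℝ x (M.statMean π B x)
  sol : M.statMean π B xs = M.statMean π b

variable {M : CMDP S A} {π : Policy S A} {B : Sample S A → E →ₗ[ℝ] E}
  {b : Sample S A → E} {Λ b₀ ρ : ℝ} {xs : E}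

theorem norm_le_div_of_mono {L : E →ₗ[ℝ] E} (hρ : 0 < ρ)
    (hL : ∀ x, ρ * ‖x‖ ^ 2 ≤ inner ℝ x (L x)) (x : E) : ‖x‖ ≤ ‖L x‖ / ρ := by
  rw [le_div_iff₀ hρ]
  rcases (norm_nonneg x).eq_or_lt with h | h
  · rw [← h, zero_mul]; exact norm_nonneg _
  · have h1 := (hL x).trans (real_inner_le_norm x (L x))
    have h2 : ‖x‖ * (‖x‖ * ρ) ≤ ‖x‖ * ‖L x‖ := by linarith
    exact le_of_mul_le_mul_left h2 h

theorem IsLinearSA.statMean_apply (x : E) :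
    M.statMean π (fun z => B z x) = M.statMean π B x :=
  statMean_linear M π (LinearMap.applyₗ x) B

theorem IsLinearSA.norm_sol_le (h : IsLinearSA M π B b Λ b₀ ρ xs) : ‖xs‖ ≤ b₀ / ρ :=
  (norm_le_div_of_mono h.ρ_pos h.mono xs).trans
    (div_le_div_of_nonneg_right (by rw [h.sol]; exact norm_statMean_le M π h.b_le) h.ρ_pos.le)

/-- Centring at the solution makes the sample size affine in the current error; `b₀ ≤ Λ b₀ / ρ`
absorbs the inhomogeneous term. -/
theorem IsLinearSA.norm_sample_le (h : IsLinearSA M π B b Λ b₀ ρ xs) (x : E) (z : Sample S A) :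
    ‖B z x - b z‖ ≤ Λ * (‖x - xs‖ + 2 * (b₀ / ρ)) := by
  have hΛ : 0 < Λ := h.ρ_pos.trans_le h.ρ_le
  have h1 : B z x - b z = B z (x - xs) + B z xs - b z := by simp
  have h2 : b₀ ≤ Λ * (b₀ / ρ) := by
    rw [← mul_div_assoc, le_div_iff₀ h.ρ_pos, mul_comm]
    exact mul_le_mul_of_nonneg_right h.ρ_le h.b₀_nonneg
  rw [h1]
  refine (norm_sub_le _ _).trans ((add_le_add (norm_add_le _ _) (h.b_le z)).trans ?_)
  have h3 := h.B_le z (x - xs)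
  have h4 := (h.B_le z xs).trans (mul_le_mul_of_nonneg_left h.norm_sol_le hΛ.le)
  linarith

theorem IsLinearSA.statMean_sample (h : IsLinearSA M π B b Λ b₀ ρ xs) (x : E) :
    M.statMean π (fun z => B z x - b z) = M.statMean π B (x - xs) := by
  rw [statMean_sub, statMean_apply, map_sub, h.sol]

variable {τ γ : ℝ} {T : ℕ}

theorem IsLinearSA.norm_mean_step_sub_le
    (hM : M.IsErgodic) (h : IsLinearSA M π B b Λ b₀ ρ xs) (hτ : M.mixTime π ≤ τ) (hT : T ≠ 0)
    (hγ : 0 < γ) (x : E) (s : S) :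
    ‖mean (M.levelTraj π T s) (fun w => x - γ • mlmc T w.1 w.2.1 (fun z => B z x - b z) - xs)
      - (x - xs - γ • M.statMean π B (x - xs))‖ ≤
      γ * (16 * τ * Λ / T) * (‖x - xs‖ + 2 * (b₀ / ρ)) := by
  have hΛ : 0 < Λ := h.ρ_pos.trans_le h.ρ_le
  have hR : 0 ≤ b₀ / ρ := div_nonneg h.b₀_nonneg h.ρ_pos.le
  have h1 := norm_mean_mlmc_sub_le hM π (h.norm_sample_le x) (by positivity) hτ hT s
  rw [h.statMean_sample] at h1
  rw [mean_sub, mean_sub, mean_const, mean_const, mean_smul]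
  have h2 : ∀ u v : E, x - γ • u - xs - (x - xs - γ • v) = -(γ • (u - v)) := by
    intro u v
    rw [smul_sub]
    abel
  rw [h2, norm_neg, norm_smul, Real.norm_of_nonneg hγ.le]
  refine (mul_le_mul_of_nonneg_left h1 hγ.le).trans_eq ?_
  ring

/-- Strong monotonicity yields the drift `-2γρ‖e‖²`. Condition `hc₁` makes the MLMC bias at most
`ρ/12` of the sample scale and `hc₂` keeps the second-moment term below a quarter of `γρ` times its
square. Together they consume `5/6` of `γρ‖e‖²`, leaving more than one full unit of contraction. -/
theorem IsLinearSA.mean_step_sq_le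
    (hM : M.IsErgodic) (h : IsLinearSA M π B b Λ b₀ ρ xs) (hτ : M.mixTime π ≤ τ) (hτ1 : 1 ≤ τ)
    (hT : T ≠ 0) (hγ : 0 < γ) (hc₁ : 192 * τ * Λ ≤ ρ * T)
    (hc₂ : γ * (20000 * (Nat.log 2 T + 1) * τ ^ 2 * Λ ^ 2) ≤ ρ) (x : E) (s : S) :
    mean (M.levelTraj π T s)
      (fun w => ‖x - γ • mlmc T w.1 w.2.1 (fun z => B z x - b z) - xs‖ ^ 2) ≤
      (1 - γ * ρ) * ‖x - xs‖ ^ 2 + γ * ρ * (3 * (b₀ / ρ) ^ 2) := by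
  have hΛ : 0 < Λ := h.ρ_pos.trans_le h.ρ_le
  have hρ := h.ρ_pos
  have hT0 : (0 : ℝ) < T := by exact_mod_cast Nat.pos_of_ne_zero hT
  set R := b₀ / ρ with hRdef
  have hR : 0 ≤ R := div_nonneg h.b₀_nonneg h.ρ_pos.le
  set e := x - xs with he
  set G : ℕ × List (Sample S A) × S → E :=
    fun w => mlmc T w.1 w.2.1 (fun z => B z x - b z) with hG
  have hbias := norm_mean_mlmc_sub_le hM π (h.norm_sample_le x) (by positivity) hτ hT s
  have hsq := mean_mlmc_sq_le hM π (h.norm_sample_le x) (by positivity) hτ hτ1 hT s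
  rw [h.statMean_sample] at hbias
  have hexp : mean (M.levelTraj π T s) (fun w => ‖x - γ • G w - xs‖ ^ 2) =
      ‖e‖ ^ 2 - 2 * γ * inner ℝ e (mean (M.levelTraj π T s) G)
        + γ ^ 2 * mean (M.levelTraj π T s) fun w => ‖G w‖ ^ 2 := by
    have h1 : ∀ w, x - γ • G w - xs = e + (-γ) • G w := by
      intro w
      rw [neg_smul, he]
      abel
    simp_rw [h1]
    rw [mean_norm_add_sq, mean_smul, inner_smul_right]
    simp_rw [norm_smul, mul_pow]
    rw [mean_const_mul]
    simp only [Real.norm_eq_abs, abs_neg, sq_abs]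
    ring
  rw [hexp]
  have hinner : ρ * ‖e‖ ^ 2 - ‖e‖ * (ρ / 12 * (‖e‖ + 2 * R)) ≤
      inner ℝ e (mean (M.levelTraj π T s) G) := by
    have h1 := h.mono e
    have h2 : inner ℝ e (mean (M.levelTraj π T s) G) = inner ℝ e (M.statMean π B e)
        + inner ℝ e (mean (M.levelTraj π T s) G - M.statMean π B e) := by
      rw [← inner_add_right, add_sub_cancel]
    have h3 := neg_le_of_abs_le (abs_real_inner_le_norm e
      (mean (M.levelTraj π T s) G - M.statMean π B e))
    have h4 : ‖mean (M.levelTraj π T s) G - M.statMean π B e‖ ≤ ρ / 12 * (‖e‖ + 2 * R) := by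
      refine hbias.trans ?_
      rw [div_le_iff₀ hT0]
      have : 0 ≤ ‖e‖ + 2 * R := by positivity
      nlinarith [mul_le_mul_of_nonneg_right hc₁ this]
    have h5 := mul_le_mul_of_nonneg_left h4 (norm_nonneg e)
    linarith
  have hvar : γ ^ 2 * mean (M.levelTraj π T s) (fun w => ‖G w‖ ^ 2) ≤
      γ * ρ * (1 / 4 * (‖e‖ + 2 * R) ^ 2) := by
    have h1 := mul_le_mul_of_nonneg_left hsq (sq_nonneg γ)
    refine h1.trans ?_
    have h2 : γ ^ 2 * (5000 * (Nat.log 2 T + 1) * (τ * (Λ * (‖e‖ + 2 * R))) ^ 2) =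
      (γ * (20000 * (Nat.log 2 T + 1) * τ ^ 2 * Λ ^ 2)) * (γ * (1 / 4 * (‖e‖ + 2 * R) ^ 2)) := by
      ring
    rw [h2]
    refine (mul_le_mul_of_nonneg_right hc₂ (by positivity)).trans_eq ?_
    ring
  have h6 := mul_le_mul_of_nonneg_left hinner (show 0 ≤ 2 * γ by positivity)
  have h7 : ‖e‖ * (ρ / 12 * (‖e‖ + 2 * R)) ≤ ρ * (1 / 6 * ‖e‖ ^ 2 + 1 / 12 * R ^ 2) := by
    nlinarith [mul_nonneg hρ.le (sq_nonneg (‖e‖ - R))]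
  have h8 : (‖e‖ + 2 * R) ^ 2 ≤ 2 * ‖e‖ ^ 2 + 8 * R ^ 2 := by
    nlinarith [sq_nonneg (‖e‖ - 2 * R)]
  have h9 : 0 < γ * ρ := mul_pos hγ hρ
  have h10 := mul_le_mul_of_nonneg_left h7 (show 0 ≤ 2 * γ by positivity)
  have h11 := mul_le_mul_of_nonneg_left h8 (show 0 ≤ γ * ρ * (1 / 4) by positivity)
  nlinarith [mul_nonneg h9.le (sq_nonneg ‖e‖), mul_nonneg h9.le (sq_nonneg R)]

theorem IsLinearSA.step_size
    (h : IsLinearSA M π B b Λ b₀ ρ xs) (hτ1 : 1 ≤ τ) (hγ : 0 < γ)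
    (hc₂ : γ * (20000 * (Nat.log 2 T + 1) * τ ^ 2 * Λ ^ 2) ≤ ρ) : γ * Λ ^ 2 ≤ ρ ∧ γ * ρ ≤ 1 := by
  have hΛ : 0 < Λ := h.ρ_pos.trans_le h.ρ_le
  have h1 : γ * Λ ^ 2 ≤ ρ := by
    refine le_trans ?_ hc₂
    have h2 : 1 ≤ 20000 * ((Nat.log 2 T : ℝ) + 1) * τ ^ 2 := by
      have h3 : (0 : ℝ) ≤ Nat.log 2 T := Nat.cast_nonneg _
      nlinarith [mul_nonneg h3 (sq_nonneg τ)]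
    have := mul_le_mul_of_nonneg_left h2 (show 0 ≤ γ * Λ ^ 2 by positivity)
    linarith
  refine ⟨h1, ?_⟩
  have h2 : γ * Λ ^ 2 ≤ Λ := h1.trans h.ρ_le
  have h3 : γ * Λ ≤ 1 := by
    by_contra! hc
    nlinarith
  nlinarith [mul_le_mul_of_nonneg_left h.ρ_le hγ.le]

/-- Since `γΛ² ≤ ρ`, the quadratic term of the squared norm cancels at most half of the drift, and
`1 - γρ ≤ (1 - γρ/2)²`. -/
theorem IsLinearSA.norm_contraction_le
    (h : IsLinearSA M π B b Λ b₀ ρ xs) (hτ1 : 1 ≤ τ) (hγ : 0 < γ)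
    (hc₂ : γ * (20000 * (Nat.log 2 T + 1) * τ ^ 2 * Λ ^ 2) ≤ ρ) (v : E) :
    ‖v - γ • M.statMean π B v‖ ≤ (1 - γ * ρ / 2) * ‖v‖ := by
  have hΛ : 0 < Λ := h.ρ_pos.trans_le h.ρ_le
  obtain ⟨h1, h2⟩ := h.step_size hτ1 hγ hc₂
  have h3 : ‖M.statMean π B v‖ ≤ Λ * ‖v‖ := by
    rw [← IsLinearSA.statMean_apply]
    exact norm_statMean_le M π fun z => h.B_le z v
  refine le_of_sq_le_sq ?_ (mul_nonneg (by linarith) (norm_nonneg _))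
  rw [norm_sub_sq_real, inner_smul_right, norm_smul, Real.norm_of_nonneg hγ.le]
  have h4 := mul_le_mul_of_nonneg_left (h.mono v) hγ.le
  have h5 : (γ * ‖M.statMean π B v‖) ^ 2 ≤ γ * ρ * ‖v‖ ^ 2 := by
    have h6 := pow_le_pow_left₀ (norm_nonneg _) h3 2
    have h7 := mul_le_mul_of_nonneg_left h6 (sq_nonneg γ)
    have h8 := mul_le_mul_of_nonneg_right h1 (show 0 ≤ γ * ‖v‖ ^ 2 by positivity)
    nlinarith
  nlinarith [sq_nonneg (γ * ρ * ‖v‖)]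

variable {X : Type*} {step : X → PMF X} [∀ x, FinSupp (step x)] {co : X → E} {st : X → S}

/-- The actual iteration carries the variables of both signals and the chain state. The maps `co`
and `st` single out one variable and the state; `hstep` only fixes the marginal law of `co`, so the
coupling of the two signals through common samples is irrelevant. -/
theorem IsLinearSA.mean_iter_sq_le
    (hM : M.IsErgodic) (h : IsLinearSA M π B b Λ b₀ ρ xs) (hτ : M.mixTime π ≤ τ) (hτ1 : 1 ≤ τ)
    (hT : T ≠ 0) (hγ : 0 < γ) (hc₁ : 192 * τ * Λ ≤ ρ * T)
    (hc₂ : γ * (20000 * (Nat.log 2 T + 1) * τ ^ 2 * Λ ^ 2) ≤ ρ)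
    (hstep : ∀ x, (step x).map co = (M.levelTraj π T (st x)).map fun w =>
      co x - γ • mlmc T w.1 w.2.1 fun z => B z (co x) - b z) {x : X} (hx : co x = 0) (n : ℕ) :
    mean (iter step n x) (fun y => ‖co y - xs‖ ^ 2) ≤ 4 * (b₀ / ρ) ^ 2 := by
  obtain ⟨-, h2⟩ := h.step_size hτ1 hγ hc₂
  have h1 := PDNAC.mean_iter_sq_le (step := step) (e := fun y => co y - xs)
    (mul_pos hγ h.ρ_pos).le h2 (B := 3 * (b₀ / ρ) ^ 2) (by positivity) (fun y => by
      have h3 := h.mean_step_sq_le hM hτ hτ1 hT hγ hc₁ hc₂ (co y) (st y)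
      rwa [← mean_map (M.levelTraj π T (st y)) (fun w =>
          co y - γ • mlmc T w.1 w.2.1 fun z => B z (co y) - b z) (fun v => ‖v - xs‖ ^ 2),
        ← hstep, mean_map] at h3) n x
  refine h1.trans ?_
  simp only [hx, zero_sub, norm_neg]
  have := pow_le_pow_left₀ (norm_nonneg _) h.norm_sol_le 2
  linarith

theorem IsLinearSA.norm_mean_iter_sub_le
    (hM : M.IsErgodic) (h : IsLinearSA M π B b Λ b₀ ρ xs) (hτ : M.mixTime π ≤ τ) (hτ1 : 1 ≤ τ)
    (hT : T ≠ 0) (hγ : 0 < γ) (hc₁ : 192 * τ * Λ ≤ ρ * T)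
    (hc₂ : γ * (20000 * (Nat.log 2 T + 1) * τ ^ 2 * Λ ^ 2) ≤ ρ)
    (hstep : ∀ x, (step x).map co = (M.levelTraj π T (st x)).map fun w =>
      co x - γ • mlmc T w.1 w.2.1 fun z => B z (co x) - b z) {x : X} (hx : co x = 0) (n : ℕ) :
    ‖mean (iter step n x) (fun y => co y - xs)‖ ≤
      ((1 - γ * ρ / 2) ^ n + 128 * τ * Λ / (ρ * T)) * (b₀ / ρ) := by
  have hΛ : 0 < Λ := h.ρ_pos.trans_le h.ρ_le
  have hρ := h.ρ_pos
  have hT0 : (0 : ℝ) < T := by exact_mod_cast Nat.pos_of_ne_zero hT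
  have hR : 0 ≤ b₀ / ρ := div_nonneg h.b₀_nonneg h.ρ_pos.le
  obtain ⟨-, h2⟩ := h.step_size hτ1 hγ hc₂
  have hγρ := mul_pos hγ h.ρ_pos
  have h1 := norm_mean_iter_le (step := step) (e := fun y => co y - xs) (r := γ * ρ / 2)
    (b₁ := γ * (16 * τ * Λ / T)) (b₂ := γ * (16 * τ * Λ / T) * (2 * (b₀ / ρ)))
    (Y := 2 * (b₀ / ρ)) (x := x)
    (by linarith) (by linarith) (by positivity) (LinearMap.id - γ • M.statMean π B)
    (fun v => by simpa using h.norm_contraction_le hτ1 hγ hc₂ v)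
    (fun y => by
      have h3 := h.norm_mean_step_sub_le hM hτ hT hγ (co y) (st y)
      rw [← mean_map (M.levelTraj π T (st y)) (fun w =>
          co y - γ • mlmc T w.1 w.2.1 fun z => B z (co y) - b z) (fun v => v - xs),
        ← hstep, mean_map] at h3
      rw [← mul_add]
      simpa using h3)
    -- The second-moment bound `4 (b₀/ρ)²` provides the first-moment bound `Y = 2 b₀/ρ` required by
    -- the mean recursion.
    (by positivity)
    (fun n => mean_le_of_sq_le (by positivity)
      ((h.mean_iter_sq_le hM hτ hτ1 hT hγ hc₁ hc₂ hstep hx n).trans_eq (by ring))) n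
  refine h1.trans ?_
  rw [hx, zero_sub, norm_neg]
  have h4 : (γ * (16 * τ * Λ / T) * (2 * (b₀ / ρ)) + γ * (16 * τ * Λ / T) * (2 * (b₀ / ρ)))
      / (γ * ρ / 2) = 128 * τ * Λ / (ρ * T) * (b₀ / ρ) := by
    field_simp
    ring
  rw [h4, add_mul]
  exact add_le_add (mul_le_mul_of_nonneg_left h.norm_sol_le (pow_nonneg (by linarith) n)) le_rfl

end LinearSA
end PDNAC

namespace PDNAC


/-! ### The critic as a linear stochastic approximation, in Euclidean coordinates. -/

section Critic

variable {S A : Type*} [Fintype S] [DecidableEq S] [Fintype A] {d m : ℕ} {M : CMDP S A}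

/-- The tail `ζ` of a critic variable `[η, ζ]`. -/
noncomputable def tail (x : CriticVec m) : EuclideanSpace ℝ (Fin m) :=
  WithLp.toLp 2 fun i => x (Sum.inr i)

/-- A critic variable as a Euclidean vector. -/
noncomputable def criticEuclid : CriticVec m ≃ₗ[ℝ] EuclideanSpace ℝ (Unit ⊕ Fin m) :=
  (WithLp.linearEquiv 2 ℝ (CriticVec m)).symm

theorem criticEuclid_apply (x : CriticVec m) (i : Unit ⊕ Fin m) : criticEuclid x i = x i := rfl

theorem norm_criticEuclid_sq (x : CriticVec m) :
    ‖criticEuclid x‖ ^ 2 = x (Sum.inl ()) ^ 2 + ‖tail x‖ ^ 2 := by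
  rw [EuclideanSpace.real_norm_sq_eq, EuclideanSpace.real_norm_sq_eq, Fintype.sum_sum_type]
  simp [criticEuclid_apply, tail]

theorem abs_head_le (x : CriticVec m) : |x (Sum.inl ())| ≤ ‖criticEuclid x‖ := by
  refine abs_le_of_sq_le_sq ?_ (norm_nonneg _)
  rw [norm_criticEuclid_sq]
  nlinarith [sq_nonneg ‖tail x‖]

theorem norm_tail_le (x : CriticVec m) : ‖tail x‖ ≤ ‖criticEuclid x‖ := by
  refine le_of_sq_le_sq ?_ (norm_nonneg _)
  rw [norm_criticEuclid_sq]
  nlinarith [sq_nonneg (x (Sum.inl ()))]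

theorem criticA_mulVec (φ : Features S m) (cγ : ℝ) (g : Sig) (z : Sample S A) (x : CriticVec m) :
    criticA φ cγ g z *ᵥ x = Sum.elim (fun _ => cγ * x (Sum.inl ())) (fun i => (φ g z.1).ofLp i *
      (x (Sum.inl ()) + inner ℝ (φ g z.1 - φ g z.2.2) (tail x))) := by
  have hin : inner ℝ (φ g z.1 - φ g z.2.2) (tail x) =
      ∑ j, ((φ g z.1).ofLp j - (φ g z.2.2).ofLp j) * x (Sum.inr j) := by
    rw [PiLp.inner_apply]
    simp [tail, mul_comm]
  rw [hin]
  ext i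
  rcases i with i | i
  · simp [criticA, Matrix.mulVec, dotProduct, Fintype.sum_sum_type, Matrix.fromBlocks]
  · simp only [criticA, Matrix.mulVec, dotProduct, Fintype.sum_sum_type, Matrix.fromBlocks,
      Matrix.of_apply, Sum.elim_inl, Sum.elim_inr, featMat, Matrix.vecMulVec_apply, Pi.sub_apply,
      univ_unique, sum_singleton, mul_add, mul_sum, mul_assoc]

/-- The random operator of the critic recursion. -/
noncomputable def criticOp (φ : Features S m) (cγ : ℝ) (g : Sig) (z : Sample S A) :
    EuclideanSpace ℝ (Unit ⊕ Fin m) →ₗ[ℝ] EuclideanSpace ℝ (Unit ⊕ Fin m) :=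
  Matrix.toEuclideanLin (criticA φ cγ g z)

theorem criticOp_criticEuclid (φ : Features S m) (cγ : ℝ) (g : Sig) (z : Sample S A)
    (x : CriticVec m) :
    criticOp φ cγ g z (criticEuclid x) = criticEuclid (criticA φ cγ g z *ᵥ x) := rfl

theorem statMean_criticOp (M : CMDP S A) (π : Policy S A) (φ : Features S m) (cγ : ℝ) (g : Sig)
    (x : CriticVec m) : M.statMean π (criticOp φ cγ g) (criticEuclid x) =
      criticEuclid (M.statMean π (criticA φ cγ g) *ᵥ x) := by
  have h : M.statMean π (criticOp φ cγ g) =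
      Matrix.toEuclideanLin (M.statMean π (criticA φ cγ g)) :=
    statMean_linear M π (Matrix.toEuclideanLin (𝕜 := ℝ)).toLinearMap (criticA φ cγ g)
  rw [h]
  rfl

theorem abs_inner_sub_le {φ : Features S m} (hφ : ∀ g s, ‖φ g s‖ ≤ 1) (g : Sig) (s s' : S)
    (v : EuclideanSpace ℝ (Fin m)) : |inner ℝ (φ g s - φ g s') v| ≤ 2 * ‖v‖ := by
  refine (abs_real_inner_le_norm _ _).trans (mul_le_mul_of_nonneg_right ?_ (norm_nonneg _))
  exact (norm_sub_le _ _).trans (by linarith [hφ g s, hφ g s'])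

theorem norm_criticOp_le {φ : Features S m} (hφ : ∀ g s, ‖φ g s‖ ≤ 1) {cγ : ℝ} (hc : 0 < cγ)
    (g : Sig) (z : Sample S A) (x : EuclideanSpace ℝ (Unit ⊕ Fin m)) :
    ‖criticOp φ cγ g z x‖ ≤ (cγ + 3) * ‖x‖ := by
  obtain ⟨x, rfl⟩ := criticEuclid.surjective x
  rw [criticOp_criticEuclid, criticA_mulVec]
  set w := inner ℝ (φ g z.1 - φ g z.2.2) (tail x) with hw
  refine le_of_sq_le_sq ?_ (by positivity)
  rw [norm_criticEuclid_sq]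
  have h1 : tail (m := m) (Sum.elim (fun _ => cγ * x (Sum.inl ()))
      (fun i => (φ g z.1).ofLp i * (x (Sum.inl ()) + w))) = (x (Sum.inl ()) + w) • φ g z.1 := by
    ext i
    simp [tail, mul_comm]
  rw [h1, norm_smul, Real.norm_eq_abs]
  have h2 := abs_head_le x
  have h3 : |x (Sum.inl ()) + w| ≤ 3 * ‖criticEuclid x‖ := by
    refine (abs_add_le _ _).trans ?_
    have := abs_inner_sub_le hφ g z.1 z.2.2 (tail x)
    have := norm_tail_le x
    linarith
  have h4 : |x (Sum.inl ()) + w| * ‖φ g z.1‖ ≤ 3 * ‖criticEuclid x‖ :=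
    (mul_le_of_le_one_right (abs_nonneg _) (hφ g z.1)).trans h3
  have h5 := pow_le_pow_left₀ (by positivity) h4 2
  have h6 : x (Sum.inl ()) ^ 2 ≤ ‖criticEuclid x‖ ^ 2 := by
    rw [← sq_abs]; exact pow_le_pow_left₀ (abs_nonneg _) h2 2
  have h7 := mul_le_mul_of_nonneg_left h6 (sq_nonneg cγ)
  simp only [Sum.elim_inl]
  nlinarith [mul_nonneg hc.le (sq_nonneg ‖criticEuclid x‖)]

theorem norm_criticB_le {φ : Features S m} (hφ : ∀ g s, ‖φ g s‖ ≤ 1) {cγ : ℝ} (hc : 0 < cγ)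
    (g : Sig) (z : Sample S A) : ‖criticEuclid (M.criticB φ cγ g z)‖ ≤ cγ + 1 := by
  refine le_of_sq_le_sq ?_ (by positivity)
  rw [norm_criticEuclid_sq]
  have h1 : tail (M.criticB φ cγ g z) = M.sig g z.1 z.2.1 • φ g z.1 := by
    ext i
    simp [tail, CMDP.criticB]
  have h2 : M.criticB φ cγ g z (Sum.inl ()) = cγ * M.sig g z.1 z.2.1 := rfl
  rw [h1, h2, norm_smul, Real.norm_eq_abs]
  have h3 := abs_sig_le M g z.1 z.2.1
  have h4 : M.sig g z.1 z.2.1 ^ 2 ≤ 1 := by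
    rw [← sq_abs]; exact pow_le_one₀ (abs_nonneg _) h3
  have h5 : (|M.sig g z.1 z.2.1| * ‖φ g z.1‖) ^ 2 ≤ 1 :=
    pow_le_one₀ (by positivity) (mul_le_one₀ h3 (norm_nonneg _) (hφ g z.1))
  have h6 := mul_le_mul_of_nonneg_left h4 (sq_nonneg cγ)
  nlinarith

theorem inner_criticOp (φ : Features S m) (cγ : ℝ) (g : Sig) (z : Sample S A) (x : CriticVec m) :
    inner ℝ (criticEuclid x) (criticOp φ cγ g z (criticEuclid x)) =
      cγ * x (Sum.inl ()) ^ 2 + x (Sum.inl ()) * inner ℝ (φ g z.1) (tail x)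
        + (tail x).ofLp ⬝ᵥ (featMat φ g z *ᵥ (tail x).ofLp) := by
  have h1 : inner ℝ (φ g z.1) (tail x) = ∑ i, x (Sum.inr i) * (φ g z.1).ofLp i := by
    rw [PiLp.inner_apply]
    simp [tail]
  have h2 : (tail x).ofLp ⬝ᵥ (featMat φ g z *ᵥ (tail x).ofLp) =
      ∑ i, x (Sum.inr i) * ((φ g z.1).ofLp i * inner ℝ (φ g z.1 - φ g z.2.2) (tail x)) := by
    refine sum_congr rfl fun i _ => ?_
    rw [PiLp.inner_apply]
    simp only [featMat, Matrix.mulVec, dotProduct, Matrix.vecMulVec_apply, tail, mul_sum]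
    refine sum_congr rfl fun j _ => ?_
    simp only [Pi.sub_apply, PiLp.sub_apply, RCLike.inner_apply, conj_trivial]
    ring
  rw [criticOp_criticEuclid, criticA_mulVec, PiLp.inner_apply, Fintype.sum_sum_type, h1, h2]
  simp only [criticEuclid_apply, Sum.elim_inl, Sum.elim_inr, univ_unique, sum_singleton,
    mul_sum]
  rw [add_assoc, ← sum_add_distrib]
  congr 1
  · simp; ring
  · refine sum_congr rfl fun i _ => ?_
    simp
    ring

/-- Converts the assumed size of `cγ` into the form needed for Young's inequality in `critic_mono`.
For `κ ≥ 1` the radicand is nonpositive, `Real.sqrt` returns `0`, and `κ` alone is large enough. -/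
theorem half_add_inv_le {κ cγ : ℝ} (hκ : 0 < κ) (h : κ + Real.sqrt (1 / κ ^ 2 - 1) ≤ cγ) :
    κ / 2 + 1 / (2 * κ) ≤ cγ := by
  refine le_trans ?_ h
  rcases le_total 1 κ with h1 | h1
  · have h2 : 1 / (2 * κ) ≤ κ / 2 := by
      rw [div_le_div_iff₀ (by positivity) (by positivity)]
      nlinarith
    linarith [Real.sqrt_nonneg (1 / κ ^ 2 - 1)]
  · have h2 : 1 / (2 * κ) - κ / 2 ≤ Real.sqrt (1 / κ ^ 2 - 1) := by
      refine Real.le_sqrt_of_sq_le ?_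
      have h4 : 1 / κ ^ 2 - 1 - (1 / (2 * κ) - κ / 2) ^ 2 =
          (1 - κ ^ 2) * (3 + κ ^ 2) / (4 * κ ^ 2) := by
        field_simp
        ring
      have h5 : 0 ≤ (1 - κ ^ 2) * (3 + κ ^ 2) / (4 * κ ^ 2) := by
        have : 0 ≤ 1 - κ ^ 2 := by nlinarith
        positivity
      linarith
    linarith

/-- The only indefinite term is the coupling `η ⟨E φ, ζ⟩`. Young's inequality splits it into
`η²/(2κ)`, paid by `cγ`, and `(κ/2)‖ζ‖²`, paid by half of the feature matrix; `κ/2` remains in both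
blocks. -/
theorem critic_mono {π : PolicyClass S A d} {φ : Features S m} (hφ : ∀ g s, ‖φ g s‖ ≤ 1)
    {κ cγ : ℝ} (hκ : 0 < κ) (hc : κ / 2 + 1 / (2 * κ) ≤ cγ) (hpd : M.CriticPosDef π φ κ) (g : Sig)
    (θ : EuclideanSpace ℝ (Fin d)) (x : EuclideanSpace ℝ (Unit ⊕ Fin m)) :
    κ / 2 * ‖x‖ ^ 2 ≤ inner ℝ x (M.statMean (π θ) (criticOp φ cγ g) x) := by
  obtain ⟨x, rfl⟩ := criticEuclid.surjective x
  set η := x (Sum.inl ()) with hη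
  have h1 : inner ℝ (criticEuclid x) (M.statMean (π θ) (criticOp φ cγ g) (criticEuclid x)) =
      cγ * η ^ 2 + M.statMean (π θ) (fun z => η * inner ℝ (φ g z.1) (tail x))
        + (tail x).ofLp ⬝ᵥ (M.statMean (π θ) (featMat φ g) *ᵥ (tail x).ofLp) := by
    let L : Matrix (Fin m) (Fin m) ℝ →ₗ[ℝ] ℝ :=
      { toFun := fun B => (tail x).ofLp ⬝ᵥ (B *ᵥ (tail x).ofLp)
        map_add' := fun B C => by rw [Matrix.add_mulVec, dotProduct_add]
        map_smul' := fun c B => by rw [Matrix.smul_mulVec, dotProduct_smul]; rfl }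
    have h2 := statMean_linear M (π θ) L (featMat φ g)
    have h3 := statMean_linear M (π θ) (innerₛₗ ℝ (criticEuclid x))
      (fun z => criticOp φ cγ g z (criticEuclid x))
    rw [IsLinearSA.statMean_apply] at h3
    simp only [innerₛₗ_apply_apply, inner_criticOp] at h3
    rw [← h3, statMean_add, statMean_add, statMean_const]
    congr 1
  have h2 := hpd g θ (tail x).ofLp
  have h3 : (tail x).ofLp ⬝ᵥ (tail x).ofLp = ‖tail x‖ ^ 2 := by
    rw [EuclideanSpace.real_norm_sq_eq]
    exact sum_congr rfl fun i _ => (sq _).symm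
  have h4 : -(|η| * ‖tail x‖) ≤ M.statMean (π θ) (fun z => η * inner ℝ (φ g z.1) (tail x)) := by
    have h5 := norm_statMean_le M (π θ) (σ := |η| * ‖tail x‖)
      (f := fun z => η * inner ℝ (φ g z.1) (tail x)) fun z => by
        rw [Real.norm_eq_abs, abs_mul]
        refine mul_le_mul_of_nonneg_left ((abs_real_inner_le_norm _ _).trans ?_) (abs_nonneg _)
        exact mul_le_of_le_one_left (norm_nonneg _) (hφ g z.1)
    exact neg_le_of_abs_le h5
  rw [h1, norm_criticEuclid_sq]
  rw [h3] at h2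
  have h5 : |η| * ‖tail x‖ ≤ 1 / (2 * κ) * η ^ 2 + κ / 2 * ‖tail x‖ ^ 2 := by
    have h6 : 1 / (2 * κ) * η ^ 2 + κ / 2 * ‖tail x‖ ^ 2 - |η| * ‖tail x‖ =
        (|η| - κ * ‖tail x‖) ^ 2 / (2 * κ) := by
      rw [← sq_abs η]
      field_simp
      ring
    have h7 : 0 ≤ (|η| - κ * ‖tail x‖) ^ 2 / (2 * κ) := by positivity
    linarith
  have h6 := mul_le_mul_of_nonneg_right hc (sq_nonneg η)
  linarith

/-- Monotonicity makes the mean matrix injective, so the matrix inverse in `criticOpt` is a genuine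
inverse. -/
theorem criticA_mulVec_criticOpt {π : PolicyClass S A d} {φ : Features S m}
    (hφ : ∀ g s, ‖φ g s‖ ≤ 1) {κ cγ : ℝ} (hκ : 0 < κ) (hc : κ / 2 + 1 / (2 * κ) ≤ cγ)
    (hpd : M.CriticPosDef π φ κ) (g : Sig) (θ : EuclideanSpace ℝ (Fin d)) :
    M.statMean (π θ) (criticA φ cγ g) *ᵥ M.criticOpt φ cγ g (π θ) =
      M.statMean (π θ) (M.criticB φ cγ g) := by
  have hinj : Function.Injective (M.statMean (π θ) (criticA φ cγ g)).mulVec := by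
    intro x y hxy
    have h1 : M.statMean (π θ) (criticA φ cγ g) *ᵥ (x - y) = 0 := by
      rw [Matrix.mulVec_sub]; exact sub_eq_zero.2 hxy
    have h2 := norm_le_div_of_mono (half_pos hκ) (critic_mono hφ hκ hc hpd g θ)
      (criticEuclid (x - y))
    rw [statMean_criticOp, h1, map_zero, norm_zero, zero_div] at h2
    have h3 := norm_le_zero_iff.1 h2
    rw [LinearEquiv.map_eq_zero_iff] at h3
    exact sub_eq_zero.1 h3
  have hdet := (Matrix.isUnit_iff_isUnit_det _).1 (Matrix.mulVec_injective_iff_isUnit.1 hinj)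
  rw [CMDP.criticOpt, Matrix.mulVec_mulVec, Matrix.mul_nonsing_inv _ hdet, Matrix.one_mulVec]

theorem critic_isLinearSA {π : PolicyClass S A d} {φ : Features S m}
    (hφ : ∀ g s, ‖φ g s‖ ≤ 1) {κ cγ : ℝ} (hκ : 0 < κ) (hc : κ / 2 + 1 / (2 * κ) ≤ cγ)
    (hpd : M.CriticPosDef π φ κ) (g : Sig) (θ : EuclideanSpace ℝ (Fin d)) :
    IsLinearSA M (π θ) (criticOp φ cγ g) (fun z => criticEuclid (M.criticB φ cγ g z))
      (cγ + 3) (cγ + 1) (κ / 2) (criticEuclid (M.criticOpt φ cγ g (π θ))) where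
  ρ_pos := half_pos hκ
  ρ_le := by
    have : 0 < 1 / (2 * κ) := by positivity
    linarith
  b₀_nonneg := by
    have : 0 < 1 / (2 * κ) := by positivity
    linarith
  B_le := norm_criticOp_le hφ (lt_of_lt_of_le (by positivity) hc) g
  b_le := norm_criticB_le hφ (lt_of_lt_of_le (by positivity) hc) g
  mono := critic_mono hφ hκ hc hpd g θ
  sol := by
    rw [statMean_criticOp, criticA_mulVec_criticOpt hφ hκ hc hpd]
    exact (statMean_linear M (π θ) criticEuclid.toLinearMap (M.criticB φ cγ g)).symm

/-- The first component of the critic limit is the average of the signal. -/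
theorem criticOpt_head (hM : M.IsErgodic) {π : PolicyClass S A d} {φ : Features S m}
    (hφ : ∀ g s, ‖φ g s‖ ≤ 1) {κ cγ : ℝ} (hκ : 0 < κ) (hc : κ / 2 + 1 / (2 * κ) ≤ cγ)
    (hpd : M.CriticPosDef π φ κ) (g : Sig) (θ : EuclideanSpace ℝ (Fin d)) :
    M.criticOpt φ cγ g (π θ) (Sum.inl ()) = M.J g (π θ) := by
  have hc0 : 0 < cγ := lt_of_lt_of_le (by positivity) hc
  have h := congrFun (criticA_mulVec_criticOpt hφ hκ hc hpd g θ) (Sum.inl ())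
  set x := M.criticOpt φ cγ g (π θ) with hx
  let L : Matrix (Unit ⊕ Fin m) (Unit ⊕ Fin m) ℝ →ₗ[ℝ] ℝ :=
    { toFun := fun B => (B *ᵥ x) (Sum.inl ())
      map_add' := fun B C => by rw [Matrix.add_mulVec]; rfl
      map_smul' := fun c B => by rw [Matrix.smul_mulVec]; rfl }
  have h2 := statMean_linear M (π θ) L (criticA φ cγ g)
  have h3 := statMean_linear M (π θ) (LinearMap.proj (R := ℝ) (φ := fun _ : Unit ⊕ Fin m => ℝ)
    (Sum.inl ())) (M.criticB φ cγ g)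
  -- The first row of the critic system involves only `η`, so it decouples and reads `cγ η = cγ
  -- J_g`.
  have h4 : M.statMean (π θ) (fun z => L (criticA φ cγ g z)) = cγ * x (Sum.inl ()) := by
    have : ∀ z : Sample S A, L (criticA φ cγ g z) = cγ * x (Sum.inl ()) := fun z => by
      change (criticA φ cγ g z *ᵥ x) (Sum.inl ()) = _
      rw [criticA_mulVec]
      rfl
    simp_rw [this]
    exact statMean_const M (π θ) _
  have h5 : M.statMean (π θ) (fun z => (LinearMap.proj (R := ℝ)
      (φ := fun _ : Unit ⊕ Fin m => ℝ) (Sum.inl ())) (M.criticB φ cγ g z)) =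
      cγ * M.J g (π θ) := by
    have := statMean_action M (π θ) fun s a => cγ * M.sig g s a
    change M.statMean (π θ) (fun z => cγ * M.sig g z.1 z.2.1) = _
    rw [this, J_eq_occ hM]
    simp only [smul_eq_mul, mul_sum]
    refine sum_congr rfl fun s _ => sum_congr rfl fun a _ => by ring
  have h6 : cγ * x (Sum.inl ()) = cγ * M.J g (π θ) := by
    rw [← h4, ← h5, h2, h3]
    exact h
  exact mul_left_cancel₀ hc0.ne' h6

theorem map_mlmc {Z W W' : Type*} [AddCommGroup W] [Module ℝ W] [AddCommGroup W'] [Module ℝ W']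
    (L : W →ₗ[ℝ] W') (T q : ℕ) (zs : List Z) (f : Z → W) :
    L (mlmc T q zs f) = mlmc T q zs fun z => L (f z) := by
  simp only [mlmc]
  split_ifs <;> simp [map_list_sum, List.map_take, Function.comp_def]

theorem mlmc_eq_of_lt_of_lt {Z W : Type*} [AddCommGroup W] [Module ℝ W] {T q q' : ℕ}
    (hq : T < 2 ^ q) (hq' : T < 2 ^ q') (zs : List Z) (f : Z → W) :
    mlmc T q zs f = mlmc T q' zs f := by
  simp only [mlmc, if_neg (not_le.2 hq), if_neg (not_le.2 hq')]

theorem criticStep_eq (M : CMDP S A) (φ : Features S m) (p : Params) (π : Policy S A)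
    (x : (Sig → CriticVec m) × S) :
    M.criticStep φ p π x = (M.levelTraj π p.Tmax x.2).map fun w =>
      (fun g => x.1 g - p.γξ • mlmc p.Tmax w.1 w.2.1
        (fun z => criticA φ p.cγ g z *ᵥ x.1 g - M.criticB φ p.cγ g z), w.2.2) :=
  geomHalf_bind_traj_eq M π x.2 (fun q y => (fun g => x.1 g - p.γξ • mlmc p.Tmax q y.1
    (fun z => criticA φ p.cγ g z *ᵥ x.1 g - M.criticB φ p.cγ g z), y.2))
    fun q hq q' hq' => by
      ext1 y
      simp only [mlmc_eq_of_lt_of_lt hq hq']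

instance instFinSuppCriticStep (M : CMDP S A) (φ : Features S m) (p : Params) (π : Policy S A)
    (x : (Sig → CriticVec m) × S) : FinSupp (M.criticStep φ p π x) := by
  rw [criticStep_eq]; infer_instance

/-- MLMC is linear in the sampled function, so it commutes with the passage to Euclidean
coordinates; the result has the form of `hstep`. -/
theorem criticStep_map (M : CMDP S A) (φ : Features S m) (p : Params) (π : Policy S A) (g : Sig)
    (x : (Sig → CriticVec m) × S) :
    (M.criticStep φ p π x).map (fun y => criticEuclid (y.1 g)) =
      (M.levelTraj π p.Tmax x.2).map fun w => criticEuclid (x.1 g) - p.γξ •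
        mlmc p.Tmax w.1 w.2.1 fun z => criticOp φ p.cγ g z (criticEuclid (x.1 g))
          - criticEuclid (M.criticB φ p.cγ g z) := by
  rw [criticStep_eq, PMF.map_comp]
  congr 1
  ext1 w
  simp only [Function.comp_def]
  rw [map_sub, map_smul]
  congr 2
  refine (map_mlmc criticEuclid.toLinearMap _ _ _ _).trans ?_
  simp only [LinearEquiv.coe_coe, map_sub, criticOp_criticEuclid]

end Critic
end PDNAC

namespace PDNAC


/-! ### Natural gradient estimation and the Lagrangian gap. -/

section Actor

variable {S A : Type*} [Fintype S] [DecidableEq S] [Fintype A] {d m : ℕ} {M : CMDP S A}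

/-- The rank-one operator `x ↦ ⟨u, x⟩ u`. -/
noncomputable def outer (u : EuclideanSpace ℝ (Fin d)) :
    EuclideanSpace ℝ (Fin d) →ₗ[ℝ] EuclideanSpace ℝ (Fin d) :=
  (innerₛₗ ℝ u).smulRight u

theorem outer_apply (u x : EuclideanSpace ℝ (Fin d)) : outer u x = inner ℝ u x • u := rfl

theorem norm_outer_le {u : EuclideanSpace ℝ (Fin d)} {G : ℝ} (hu : ‖u‖ ≤ G)
    (x : EuclideanSpace ℝ (Fin d)) : ‖outer u x‖ ≤ G ^ 2 * ‖x‖ := by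
  rw [outer_apply, norm_smul, Real.norm_eq_abs]
  calc _ ≤ (‖u‖ * ‖x‖) * ‖u‖ :=
        mul_le_mul_of_nonneg_right (abs_real_inner_le_norm u x) (norm_nonneg _)
    _ = ‖u‖ ^ 2 * ‖x‖ := by ring
    _ ≤ G ^ 2 * ‖x‖ :=
        mul_le_mul_of_nonneg_right (pow_le_pow_left₀ (norm_nonneg _) hu 2) (norm_nonneg _)

/-- The Fisher information as an operator. -/
noncomputable def CMDP.fisherOp (M : CMDP S A) (π : PolicyClass S A d)
    (θ : EuclideanSpace ℝ (Fin d)) : EuclideanSpace ℝ (Fin d) →ₗ[ℝ] EuclideanSpace ℝ (Fin d) :=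
  M.statMean (π θ) fun z => outer (score π θ z.1 z.2.1)

theorem fisherOp_apply (M : CMDP S A) (π : PolicyClass S A d) (θ x : EuclideanSpace ℝ (Fin d)) :
    M.fisherOp π θ x =
      ∑ s, ∑ a, M.occ (π θ) s a • (inner ℝ (score π θ s a) x • score π θ s a) := by
  rw [CMDP.fisherOp, statMean_action M (π θ) fun s a => outer (score π θ s a)]
  simp only [LinearMap.sum_apply, LinearMap.smul_apply, outer_apply]

theorem inner_fisherOp (M : CMDP S A) (π : PolicyClass S A d)
    (θ y x : EuclideanSpace ℝ (Fin d)) :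
    inner ℝ y (M.fisherOp π θ x) = ∑ s, ∑ a, M.occ (π θ) s a *
      (inner ℝ (score π θ s a) x * inner ℝ (score π θ s a) y) := by
  rw [fisherOp_apply]
  simp only [inner_sum, inner_smul_right]
  refine sum_congr rfl fun s _ => sum_congr rfl fun a _ => ?_
  rw [real_inner_comm y]

theorem fisherOp_mono {π : PolicyClass S A d} {μ : ℝ} (hF : M.FisherNonDeg π μ)
    (θ x : EuclideanSpace ℝ (Fin d)) : μ * ‖x‖ ^ 2 ≤ inner ℝ x (M.fisherOp π θ x) := by
  have h := (hF θ).dotProduct_mulVec_nonneg x.ofLp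
  simp only [star_trivial, Matrix.sub_mulVec, dotProduct_sub, Matrix.smul_mulVec,
    Matrix.one_mulVec, dotProduct_smul, smul_eq_mul] at h
  have h1 : x.ofLp ⬝ᵥ x.ofLp = ‖x‖ ^ 2 := by
    rw [EuclideanSpace.real_norm_sq_eq]
    exact sum_congr rfl fun i _ => (sq _).symm
  have h2 : x.ofLp ⬝ᵥ (M.fisher π θ *ᵥ x.ofLp) = inner ℝ x (M.fisherOp π θ x) := by
    rw [inner_fisherOp]
    simp only [CMDP.fisher, Matrix.sum_mulVec, dotProduct_sum, Matrix.smul_mulVec,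
      dotProduct_smul, smul_eq_mul]
    refine sum_congr rfl fun s _ => sum_congr rfl fun a _ => ?_
    have h3 : inner ℝ (score π θ s a) x = (score π θ s a).ofLp ⬝ᵥ x.ofLp := by
      rw [EuclideanSpace.inner_eq_star_dotProduct, dotProduct_comm]
      simp
    rw [h3, Matrix.vecMulVec_mulVec]
    simp only [dotProduct_smul, op_smul_eq_smul, smul_eq_mul]
    rw [dotProduct_comm x.ofLp]
  rw [h1, h2] at h
  linarith

theorem exists_fisherInv {π : PolicyClass S A d} {μ : ℝ} (hμ : 0 < μ) (hF : M.FisherNonDeg π μ)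
    (θ : EuclideanSpace ℝ (Fin d)) :
    ∃ L : EuclideanSpace ℝ (Fin d) →ₗ[ℝ] EuclideanSpace ℝ (Fin d),
      ∀ v, M.fisherOp π θ (L v) = v := by
  have hinj : Function.Injective (M.fisherOp π θ) := by
    rw [← LinearMap.ker_eq_bot, LinearMap.ker_eq_bot']
    intro x hx
    have := norm_le_div_of_mono hμ (fisherOp_mono hF θ) x
    rw [hx, norm_zero, zero_div] at this
    exact norm_le_zero_iff.1 this
  refine ⟨(LinearEquiv.ofInjectiveEndo (M.fisherOp π θ) hinj).symm.toLinearMap, fun v => ?_⟩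
  exact (LinearEquiv.ofInjectiveEndo (M.fisherOp π θ) hinj).apply_symm_apply v

/-- The part of the temporal difference that is linear in the critic. -/
noncomputable def tdFunctional (φ : Features S m) (g : Sig) (z : Sample S A) :
    EuclideanSpace ℝ (Unit ⊕ Fin m) →ₗ[ℝ] ℝ where
  toFun v := v (Sum.inl ()) + ∑ i, v (Sum.inr i) * ((φ g z.1).ofLp i - (φ g z.2.2).ofLp i)
  map_add' v w := by
    simp only [PiLp.add_apply, add_mul, sum_add_distrib]
    ring
  map_smul' c v := by
    simp only [PiLp.smul_apply, smul_eq_mul, mul_assoc, ← mul_sum, RingHom.id_apply]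
    ring

theorem tdErr_eq (M : CMDP S A) (φ : Features S m) (g : Sig) (ξ : CriticVec m)
    (z : Sample S A) :
    M.tdErr φ g ξ z = M.sig g z.1 z.2.1 - tdFunctional φ g z (criticEuclid ξ) := by
  have : ∑ i, ξ (Sum.inr i) * ((φ g z.2.2).ofLp i - (φ g z.1).ofLp i) =
      - ∑ i, ξ (Sum.inr i) * ((φ g z.1).ofLp i - (φ g z.2.2).ofLp i) := by
    rw [← sum_neg_distrib]
    exact sum_congr rfl fun i _ => by ring
  simp only [CMDP.tdErr, this, tdFunctional, LinearMap.coe_mk, AddHom.coe_mk, criticEuclid_apply]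
  ring

theorem abs_tdFunctional_le {φ : Features S m} (hφ : ∀ g s, ‖φ g s‖ ≤ 1) (g : Sig)
    (z : Sample S A) (v : EuclideanSpace ℝ (Unit ⊕ Fin m)) :
    |tdFunctional φ g z v| ≤ 3 * ‖v‖ := by
  obtain ⟨x, rfl⟩ := criticEuclid.surjective v
  have h1 : tdFunctional φ g z (criticEuclid x) = x (Sum.inl ())
      + inner ℝ (φ g z.1 - φ g z.2.2) (tail x) := by
    rw [PiLp.inner_apply]
    simp [tdFunctional, criticEuclid_apply, tail]
  rw [h1]
  refine (abs_add_le _ _).trans ?_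
  have := abs_inner_sub_le hφ g z.1 z.2.2 (tail x)
  have := norm_tail_le x
  have := abs_head_le x
  linarith

theorem norm_tdErr_smul_le {π : PolicyClass S A d} {φ : Features S m}
    (hφ : ∀ g s, ‖φ g s‖ ≤ 1) {G₁ G₂ : ℝ} (hπ : ScoreBounds π G₁ G₂) (g : Sig)
    (θ : EuclideanSpace ℝ (Fin d)) (ξ : CriticVec m) (z : Sample S A) :
    ‖M.tdErr φ g ξ z • score π θ z.1 z.2.1‖ ≤ G₁ * (1 + 3 * ‖criticEuclid ξ‖) := by
  rw [norm_smul, mul_comm, Real.norm_eq_abs, tdErr_eq]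
  refine mul_le_mul (hπ.bound θ _ _) ?_ (abs_nonneg _) ((norm_nonneg _).trans (hπ.bound θ z.1 z.2.1))
  refine (abs_sub _ _).trans (add_le_add (abs_sig_le M g _ _) (abs_tdFunctional_le hφ g z _))

/-- The maximum guarantees `ρ ≤ Λ` also for `d = 0`, where Fisher non-degeneracy is vacuous and does
not force `μ ≤ G₁²`. -/
theorem actor_isLinearSA {π : PolicyClass S A d} {φ : Features S m}
    (hφ : ∀ g s, ‖φ g s‖ ≤ 1) {G₁ G₂ μ : ℝ} (hμ : 0 < μ) (hG₁ : 0 < G₁)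
    (hπ : ScoreBounds π G₁ G₂) (hF : M.FisherNonDeg π μ) (g : Sig)
    (θ : EuclideanSpace ℝ (Fin d)) (ξ : CriticVec m)
    {L : EuclideanSpace ℝ (Fin d) →ₗ[ℝ] EuclideanSpace ℝ (Fin d)}
    (hL : ∀ v, M.fisherOp π θ (L v) = v) :
    IsLinearSA M (π θ) (fun z => outer (score π θ z.1 z.2.1))
      (fun z => M.tdErr φ g ξ z • score π θ z.1 z.2.1) (max (G₁ ^ 2) μ)
      (G₁ * (1 + 3 * ‖criticEuclid ξ‖)) μ
      (L (M.statMean (π θ) fun z => M.tdErr φ g ξ z • score π θ z.1 z.2.1)) where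
  ρ_pos := hμ
  ρ_le := le_max_right _ _
  b₀_nonneg := by positivity
  B_le := fun z x => (norm_outer_le (hπ.bound θ _ _) x).trans
    (mul_le_mul_of_nonneg_right (le_max_left _ _) (norm_nonneg _))
  b_le := norm_tdErr_smul_le hφ hπ g θ ξ
  mono := fisherOp_mono hF θ
  sol := hL _

theorem actorStep_eq (M : CMDP S A) (φ : Features S m) (p : Params) (π : PolicyClass S A d)
    (θ : EuclideanSpace ℝ (Fin d)) (ξ : Sig → CriticVec m)
    (x : (Sig → EuclideanSpace ℝ (Fin d)) × S) :
    M.actorStep φ p π θ ξ x = (M.levelTraj (π θ) p.Tmax x.2).map fun w =>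
      (fun g => x.1 g - p.γω • mlmc p.Tmax w.1 w.2.1
        (fun z => inner ℝ (score π θ z.1 z.2.1) (x.1 g) • score π θ z.1 z.2.1
          - M.tdErr φ g (ξ g) z • score π θ z.1 z.2.1), w.2.2) :=
  geomHalf_bind_traj_eq M (π θ) x.2 (fun q y => (fun g => x.1 g - p.γω • mlmc p.Tmax q y.1
    (fun z => inner ℝ (score π θ z.1 z.2.1) (x.1 g) • score π θ z.1 z.2.1
      - M.tdErr φ g (ξ g) z • score π θ z.1 z.2.1), y.2))
    fun q hq q' hq' => by
      ext1 y
      simp only [mlmc_eq_of_lt_of_lt hq hq']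

instance instFinSuppActorStep (M : CMDP S A) (φ : Features S m) (p : Params)
    (π : PolicyClass S A d) (θ : EuclideanSpace ℝ (Fin d)) (ξ : Sig → CriticVec m)
    (x : (Sig → EuclideanSpace ℝ (Fin d)) × S) : FinSupp (M.actorStep φ p π θ ξ x) := by
  rw [actorStep_eq]; infer_instance

theorem actorStep_map (M : CMDP S A) (φ : Features S m) (p : Params) (π : PolicyClass S A d)
    (θ : EuclideanSpace ℝ (Fin d)) (ξ : Sig → CriticVec m) (g : Sig)
    (x : (Sig → EuclideanSpace ℝ (Fin d)) × S) :
    (M.actorStep φ p π θ ξ x).map (fun y => y.1 g) =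
      (M.levelTraj (π θ) p.Tmax x.2).map fun w => x.1 g - p.γω •
        mlmc p.Tmax w.1 w.2.1 fun z => outer (score π θ z.1 z.2.1) (x.1 g)
          - M.tdErr φ g (ξ g) z • score π θ z.1 z.2.1 := by
  rw [actorStep_eq, PMF.map_comp]
  rfl

/-- The linear dependence on the critic of the mean of the temporal difference times the score. -/
noncomputable def CMDP.tdOp (M : CMDP S A) (φ : Features S m) (π : PolicyClass S A d) (g : Sig)
    (θ : EuclideanSpace ℝ (Fin d)) :
    EuclideanSpace ℝ (Unit ⊕ Fin m) →ₗ[ℝ] EuclideanSpace ℝ (Fin d) :=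
  M.statMean (π θ) fun z => (tdFunctional φ g z).smulRight (score π θ z.1 z.2.1)

theorem tdOp_apply (M : CMDP S A) (φ : Features S m) (π : PolicyClass S A d) (g : Sig)
    (θ : EuclideanSpace ℝ (Fin d)) (v : EuclideanSpace ℝ (Unit ⊕ Fin m)) :
    M.tdOp φ π g θ v = M.statMean (π θ) fun z => tdFunctional φ g z v • score π θ z.1 z.2.1 :=
  (statMean_linear M (π θ) (LinearMap.applyₗ v)
    fun z => (tdFunctional φ g z).smulRight (score π θ z.1 z.2.1)).symm

theorem norm_tdOp_le {π : PolicyClass S A d} {φ : Features S m} (hφ : ∀ g s, ‖φ g s‖ ≤ 1)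
    {G₁ G₂ : ℝ} (hπ : ScoreBounds π G₁ G₂) (g : Sig) (θ : EuclideanSpace ℝ (Fin d))
    (v : EuclideanSpace ℝ (Unit ⊕ Fin m)) : ‖M.tdOp φ π g θ v‖ ≤ 3 * G₁ * ‖v‖ := by
  rw [tdOp_apply]
  refine norm_statMean_le M (π θ) fun z => ?_
  rw [norm_smul, Real.norm_eq_abs]
  refine (mul_le_mul (abs_tdFunctional_le hφ g z v) (hπ.bound θ _ _) (norm_nonneg _)
    (by positivity)).trans_eq (by ring)

/-- The temporal difference is affine in the critic. Averaging over a random critic therefore sees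
only the mean of its error. -/
theorem statMean_tdErr_smul (M : CMDP S A) (φ : Features S m) (π : PolicyClass S A d) (g : Sig)
    (θ : EuclideanSpace ℝ (Fin d)) (ξ ξ' : CriticVec m) :
    (M.statMean (π θ) fun z => M.tdErr φ g ξ z • score π θ z.1 z.2.1) =
      (M.statMean (π θ) fun z => M.tdErr φ g ξ' z • score π θ z.1 z.2.1)
        - M.tdOp φ π g θ (criticEuclid ξ - criticEuclid ξ') := by
  rw [tdOp_apply, ← statMean_sub]
  congr 1
  ext1 z
  rw [tdErr_eq, tdErr_eq, map_sub, ← sub_smul]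
  congr 1
  ring

/-- The mean of the advantage times the score. -/
noncomputable def CMDP.advMean (M : CMDP S A) (π : PolicyClass S A d) (g : Sig)
    (θ : EuclideanSpace ℝ (Fin d)) : EuclideanSpace ℝ (Fin d) :=
  ∑ s, ∑ a, M.occ (π θ) s a • (M.Adv g (π θ) s a • score π θ s a)

/-- By the Bellman equation, the temporal difference with the exact average and value function has
conditional mean equal to the advantage. -/
theorem advMean_eq (hM : M.IsErgodic) (π : PolicyClass S A d) (g : Sig)
    (θ : EuclideanSpace ℝ (Fin d)) :
    M.advMean π g θ = M.statMean (π θ) fun z =>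
      (M.sig g z.1 z.2.1 - M.J g (π θ) + M.V g (π θ) z.2.2 - M.V g (π θ) z.1) •
        score π θ z.1 z.2.1 := by
  simp only [CMDP.advMean, CMDP.statMean]
  refine sum_congr rfl fun s _ => sum_congr rfl fun a _ => ?_
  simp only [mul_smul, ← smul_sum]
  congr 1
  simp only [smul_smul, ← sum_smul]
  congr 1
  have h : ∀ s', (M.P s a s').toReal * (M.sig g s a - M.J g (π θ) + M.V g (π θ) s'
      - M.V g (π θ) s) = (M.P s a s').toReal * (M.sig g s a - M.J g (π θ) - M.V g (π θ) s)
      + (M.P s a s').toReal * M.V g (π θ) s' := fun s' => by ring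
  simp_rw [h, sum_add_distrib, ← sum_mul]
  rw [sum_toReal, CMDP.Adv, Q_eq hM]
  ring

theorem sum_statDist_abs_le (M : CMDP S A) (π : Policy S A) (f : S → ℝ) :
    ∑ s, M.statDist π s * |f s| ≤ Real.sqrt (∑ s, M.statDist π s * f s ^ 2) := by
  refine Real.le_sqrt_of_sq_le ?_
  set c := ∑ s, M.statDist π s * |f s| with hc
  have h : 0 ≤ ∑ s, M.statDist π s * (|f s| - c) ^ 2 :=
    sum_nonneg fun s _ => mul_nonneg (statDist_nonneg M π s) (sq_nonneg _)
  have h2 : ∀ s, M.statDist π s * (|f s| - c) ^ 2 = M.statDist π s * f s ^ 2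
      - 2 * c * (M.statDist π s * |f s|) + M.statDist π s * c ^ 2 := by
    intro s
    rw [← sq_abs (f s)]
    ring
  simp_rw [h2, sum_add_distrib, sum_sub_distrib, ← mul_sum, ← sum_mul] at h
  rw [sum_statDist, ← hc] at h
  linarith

theorem criticErr_le_epsApp {π : PolicyClass S A d} {φ : Features S m} {cγ : ℝ}
    (hfin : M.CriticErrFinite π φ cγ) (g : Sig) (θ : EuclideanSpace ℝ (Fin d)) :
    M.criticErr φ cγ g (π θ) ≤ M.epsApp π φ cγ := by
  have h := le_ciSup (hfin g) θ
  cases g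
  · exact h.trans (le_max_left _ _)
  · exact h.trans (le_max_right _ _)

/-- At the critic limit the average is exact, so the two temporal differences differ by `e(s') -
e(s)`, with `e` the critic's value error. Under stationarity `s` and `s'` have the same law, and
each term is at most `√ε_app` in mean by Cauchy-Schwarz. -/
theorem norm_statMean_tdErr_sub_advMean_le (hM : M.IsErgodic) {π : PolicyClass S A d}
    {φ : Features S m} (hφ : ∀ g s, ‖φ g s‖ ≤ 1) {G₁ G₂ : ℝ} (hπ : ScoreBounds π G₁ G₂)
    {κ cγ : ℝ} (hκ : 0 < κ) (hc : κ / 2 + 1 / (2 * κ) ≤ cγ) (hpd : M.CriticPosDef π φ κ)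
    (hfin : M.CriticErrFinite π φ cγ) (g : Sig) (θ : EuclideanSpace ℝ (Fin d)) :
    ‖(M.statMean (π θ) fun z => M.tdErr φ g (M.criticOpt φ cγ g (π θ)) z • score π θ z.1 z.2.1)
      - M.advMean π g θ‖ ≤ 2 * G₁ * Real.sqrt (M.epsApp π φ cγ) := by
  set ξ := M.criticOpt φ cγ g (π θ) with hξ
  set e : S → ℝ := fun s => (∑ i, ξ (Sum.inr i) * (φ g s).ofLp i) - M.V g (π θ) s with he
  have hG : 0 ≤ G₁ := by
    obtain ⟨s⟩ := nonempty_state M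
    exact (norm_nonneg _).trans (hπ.bound θ s (π θ s).support_nonempty.some)
  rw [advMean_eq hM, ← statMean_sub]
  have h1 : ∀ z : Sample S A, M.tdErr φ g ξ z • score π θ z.1 z.2.1
      - (M.sig g z.1 z.2.1 - M.J g (π θ) + M.V g (π θ) z.2.2 - M.V g (π θ) z.1) •
        score π θ z.1 z.2.1 = (e z.2.2 - e z.1) • score π θ z.1 z.2.1 := by
    intro z
    rw [← sub_smul]
    congr 1
    simp only [CMDP.tdErr, he, hξ, criticOpt_head hM hφ hκ hc hpd, mul_sub, sum_sub_distrib]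
    ring
  simp_rw [h1]
  have h2 : ‖M.statMean (π θ) fun z => (e z.2.2 - e z.1) • score π θ z.1 z.2.1‖ ≤
      M.statMean (π θ) fun z => (|e z.2.2| + |e z.1|) * G₁ := by
    simp only [CMDP.statMean]
    refine (norm_sum_le _ _).trans (sum_le_sum fun s _ => (norm_sum_le _ _).trans
      (sum_le_sum fun a _ => (norm_sum_le _ _).trans (sum_le_sum fun s' _ => ?_)))
    have h0 : 0 ≤ M.occ (π θ) s a * (M.P s a s').toReal :=
      mul_nonneg (occ_nonneg M (π θ) s a) ENNReal.toReal_nonneg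
    rw [norm_smul, Real.norm_of_nonneg h0, smul_eq_mul]
    refine mul_le_mul_of_nonneg_left ?_ h0
    rw [norm_smul, Real.norm_eq_abs]
    exact mul_le_mul (abs_sub _ _) (hπ.bound θ s a) (norm_nonneg _) (by positivity)
  refine h2.trans ?_
  have h3 : (M.statMean (π θ) fun z => (|e z.2.2| + |e z.1|) * G₁) =
      2 * G₁ * ∑ s, M.statDist (π θ) s * |e s| := by
    have h4 : M.statMean (π θ) (fun z => |e z.2.2|) = ∑ s, M.statDist (π θ) s * |e s| := by
      rw [← sum_occ_transition M (π θ) fun s => |e s|]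
      simp only [CMDP.statMean, smul_eq_mul, mul_sum, mul_assoc]
    have h5 : M.statMean (π θ) (fun z => |e z.1|) = ∑ s, M.statDist (π θ) s * |e s| := by
      rw [statMean_action M (π θ) fun s _ => |e s|]
      simp only [smul_eq_mul, ← sum_mul, sum_occ_action]
    have h6 := statMean_linear M (π θ) (LinearMap.mulRight ℝ G₁) fun z => |e z.2.2| + |e z.1|
    simp only [LinearMap.mulRight_apply] at h6
    rw [h6, statMean_add, h4, h5]
    ring
  rw [h3]
  refine mul_le_mul_of_nonneg_left ?_ (by positivity)
  exact (sum_statDist_abs_le M (π θ) e).trans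
    (Real.sqrt_le_sqrt (criticErr_le_epsApp hfin g θ))

/-- The hypothesis on `ω` is the normal equation of the least squares problem; completing the square
kills the cross term `h2`. -/
theorem loss_minimizer {π : PolicyClass S A d} (θ : EuclideanSpace ℝ (Fin d)) (l : ℝ)
    {ω : EuclideanSpace ℝ (Fin d)}
    (hω : M.fisherOp π θ ω = M.advMean π .r θ + l • M.advMean π .c θ)
    (ω' : EuclideanSpace ℝ (Fin d)) :
    M.loss π (M.occ (π θ)) ω θ l ≤ M.loss π (M.occ (π θ)) ω' θ l := by
  have h1 : ∀ s a, M.occ (π θ) s a * (inner ℝ (score π θ s a) ω' - M.Adv .r (π θ) s a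
      - l * M.Adv .c (π θ) s a) ^ 2 =
      M.occ (π θ) s a * (inner ℝ (score π θ s a) ω - M.Adv .r (π θ) s a
      - l * M.Adv .c (π θ) s a) ^ 2 + M.occ (π θ) s a * inner ℝ (score π θ s a) (ω' - ω) ^ 2
      + 2 * (M.occ (π θ) s a *
          (inner ℝ (score π θ s a) ω * inner ℝ (score π θ s a) (ω' - ω))
        - inner ℝ (ω' - ω) (M.occ (π θ) s a • (M.Adv .r (π θ) s a • score π θ s a))
        - l * inner ℝ (ω' - ω) (M.occ (π θ) s a • (M.Adv .c (π θ) s a • score π θ s a))) := by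
    intro s a
    simp only [inner_smul_right, real_inner_comm (score π θ s a) (ω' - ω)]
    rw [inner_sub_right]
    ring
  have h2 : ∑ s, ∑ a, (M.occ (π θ) s a *
          (inner ℝ (score π θ s a) ω * inner ℝ (score π θ s a) (ω' - ω))
        - inner ℝ (ω' - ω) (M.occ (π θ) s a • (M.Adv .r (π θ) s a • score π θ s a))
        - l * inner ℝ (ω' - ω) (M.occ (π θ) s a • (M.Adv .c (π θ) s a • score π θ s a))) = 0 := by
    simp only [sum_sub_distrib, ← mul_sum, ← inner_sum]
    rw [← inner_fisherOp, hω, inner_add_right, inner_smul_right]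
    simp only [CMDP.advMean]
    ring
  have h3 : 0 ≤ ∑ s, ∑ a, M.occ (π θ) s a * inner ℝ (score π θ s a) (ω' - ω) ^ 2 :=
    sum_nonneg fun s _ => sum_nonneg fun a _ => mul_nonneg (occ_nonneg M _ s a) (sq_nonneg _)
  simp only [CMDP.loss]
  simp_rw [h1, sum_add_distrib, ← mul_sum]
  rw [h2]
  linarith

/-- The mean score under the occupancy measure of the comparison policy. -/
noncomputable def CMDP.meanScore (M : CMDP S A) (π : PolicyClass S A d) (πstar : Policy S A)
    (θ : EuclideanSpace ℝ (Fin d)) : EuclideanSpace ℝ (Fin d) :=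
  ∑ s, ∑ a, M.occ πstar s a • score π θ s a

theorem norm_meanScore_le {π : PolicyClass S A d} {G₁ G₂ : ℝ} (hπ : ScoreBounds π G₁ G₂)
    (πstar : Policy S A) (θ : EuclideanSpace ℝ (Fin d)) : ‖M.meanScore π πstar θ‖ ≤ G₁ := by
  rw [CMDP.meanScore, ← statMean_action M πstar fun s a => score π θ s a]
  exact norm_statMean_le M πstar fun z => hπ.bound θ _ _

/-- Average the residual of the compatible approximation under the occupancy of `πstar`. By Jensen
this mean is at most `√εbias` in absolute value, and by the performance difference identity the
advantages average to the differences of `J_r` and `J_c`. -/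
theorem lagrangian_gap_le (hM : M.IsErgodic) {π : PolicyClass S A d} {πstar : Policy S A}
    {δ εbias : ℝ} (hb : M.BiasBound π πstar δ εbias) (θ : EuclideanSpace ℝ (Fin d)) {l : ℝ}
    (hl : l ∈ Set.Icc (0 : ℝ) (2 / δ)) {ω : EuclideanSpace ℝ (Fin d)}
    (hω : M.fisherOp π θ ω = M.advMean π .r θ + l • M.advMean π .c θ) :
    M.J .r πstar - M.J .r (π θ) + l * (M.J .c πstar - M.J .c (π θ)) - Real.sqrt εbias ≤
      inner ℝ (M.meanScore π πstar θ) ω := by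
  have h1 := hb θ l hl ω (loss_minimizer θ l hω)
  set f : S → A → ℝ := fun s a => inner ℝ (score π θ s a) ω - M.Adv .r (π θ) s a
    - l * M.Adv .c (π θ) s a with hf
  set c := ∑ s, ∑ a, M.occ πstar s a * f s a with hc
  have h2 : c ^ 2 ≤ εbias := by
    refine le_trans ?_ h1
    have h : 0 ≤ ∑ s, ∑ a, M.occ πstar s a * (f s a - c) ^ 2 :=
      sum_nonneg fun s _ => sum_nonneg fun a _ => mul_nonneg (occ_nonneg M _ s a) (sq_nonneg _)
    have h3 : ∀ s a, M.occ πstar s a * (f s a - c) ^ 2 = M.occ πstar s a * f s a ^ 2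
      - 2 * c * (M.occ πstar s a * f s a) + M.occ πstar s a * c ^ 2 := fun s a => by ring
    simp_rw [h3, sum_add_distrib, sum_sub_distrib, ← mul_sum, ← sum_mul] at h
    rw [sum_occ, ← hc] at h
    change c ^ 2 ≤ ∑ s, ∑ a, M.occ πstar s a * f s a ^ 2
    linarith
  have h3 : -Real.sqrt εbias ≤ c := (abs_le.1 (Real.abs_le_sqrt h2)).1
  have h4 : c = inner ℝ (M.meanScore π πstar θ) ω - (M.J .r πstar - M.J .r (π θ))
      - l * (M.J .c πstar - M.J .c (π θ)) := by
    have h5 : ∀ s a, M.occ πstar s a * f s a = inner ℝ (M.occ πstar s a • score π θ s a) ω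
        - M.occ πstar s a * M.Adv .r (π θ) s a
        - l * (M.occ πstar s a * M.Adv .c (π θ) s a) := by
      intro s a
      rw [real_inner_smul_left]
      simp only [hf]
      ring
    rw [hc]
    simp_rw [h5, sum_sub_distrib, ← mul_sum, ← sum_inner]
    rw [sum_occ_Adv hM, sum_occ_Adv hM]
    rfl
  linarith

end Actor

/-! ### The KL divergence to the comparison policy along a parameter step. -/

section KullbackLeibler

variable {S A : Type*} [Fintype S] [DecidableEq S] [Fintype A] {d : ℕ} {M : CMDP S A}
  {π : PolicyClass S A d} {G₁ G₂ : ℝ}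

theorem hasGradientAt_log (hπ : ScoreBounds π G₁ G₂) (θ : EuclideanSpace ℝ (Fin d)) (s : S)
    (a : A) : HasGradientAt (fun θ' => Real.log (π θ' s a).toReal) (score π θ s a) θ :=
  (((hπ.diff s a) θ).log (hπ.pos θ s a).ne').hasGradientAt

theorem log_policy_ge (hπ : ScoreBounds π G₁ G₂) (θ v : EuclideanSpace ℝ (Fin d)) (s : S) (a : A) :
    Real.log (π θ s a).toReal + inner ℝ (score π θ s a) v - G₂ / 2 * ‖v‖ ^ 2 ≤
      Real.log (π (θ + v) s a).toReal := by
  -- The quadratic correction compensates the Lipschitz variation of the score along the segment, so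
  -- `ψ` is nondecreasing on `[0,1]`; comparing its endpoints gives the bound.
  set ψ : ℝ → ℝ := fun t => Real.log (π (θ + t • v) s a).toReal
    - t * inner ℝ (score π θ s a) v + G₂ / 2 * ‖v‖ ^ 2 * t ^ 2 with hψ
  have hder : ∀ t, HasDerivAt ψ (inner ℝ (score π (θ + t • v) s a) v
      - inner ℝ (score π θ s a) v + G₂ / 2 * ‖v‖ ^ 2 * (2 * t)) t := by
    intro t
    have h1 : HasDerivAt (fun t : ℝ => θ + t • v) v t := by
      simpa using ((hasDerivAt_id t).smul_const v).const_add θ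
    have h2 := (hasGradientAt_log hπ (θ + t • v) s a).hasFDerivAt.comp_hasDerivAt t h1
    have h3 := (hasDerivAt_id t).mul_const (inner ℝ (score π θ s a) v)
    have h4 := (hasDerivAt_pow 2 t).const_mul (G₂ / 2 * ‖v‖ ^ 2)
    refine ((h2.sub h3).add h4).congr_deriv ?_
    simp
  have hmono : MonotoneOn ψ (Set.Icc 0 1) := by
    refine monotoneOn_of_deriv_nonneg (convex_Icc 0 1)
      (fun t _ => (hder t).continuousAt.continuousWithinAt)
      (fun t _ => (hder t).differentiableAt.differentiableWithinAt) fun t ht => ?_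
    rw [interior_Icc] at ht
    rw [(hder t).deriv, ← inner_sub_left]
    have h1 := (abs_le.1 (abs_real_inner_le_norm
      (score π (θ + t • v) s a - score π θ s a) v)).1
    have h2 := hπ.lip (θ + t • v) θ s a
    rw [add_sub_cancel_left, norm_smul, Real.norm_of_nonneg ht.1.le] at h2
    have h3 := mul_le_mul_of_nonneg_right h2 (norm_nonneg v)
    nlinarith
  have h := hmono (Set.left_mem_Icc.2 zero_le_one) (Set.right_mem_Icc.2 zero_le_one) zero_le_one
  simp only [hψ, zero_smul, add_zero, zero_mul, sub_zero, one_smul, one_mul, one_pow, mul_one,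
    ne_eq, OfNat.ofNat_ne_zero, not_false_eq_true, zero_pow, mul_zero] at h
  linarith

/-- The linear term is the mean score under the occupancy of `πstar`, the same vector as in
`lagrangian_gap_le`; this match is why KL is the right potential. -/
theorem avgKL_add_le (hπ : ScoreBounds π G₁ G₂) (πstar : Policy S A)
    (θ v : EuclideanSpace ℝ (Fin d)) :
    M.avgKL πstar (π (θ + v)) ≤ M.avgKL πstar (π θ) - inner ℝ (M.meanScore π πstar θ) v
      + G₂ / 2 * ‖v‖ ^ 2 := by
  have hpt : ∀ s a, (πstar s a).toReal *
      Real.log ((πstar s a).toReal / (π (θ + v) s a).toReal) ≤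
      (πstar s a).toReal * Real.log ((πstar s a).toReal / (π θ s a).toReal)
        - (πstar s a).toReal * inner ℝ (score π θ s a) v
        + (πstar s a).toReal * (G₂ / 2 * ‖v‖ ^ 2) := by
    intro s a
    rcases (ENNReal.toReal_nonneg (a := πstar s a)).eq_or_lt with h | h
    · simp [← h]
    · rw [Real.log_div h.ne' (hπ.pos _ s a).ne', Real.log_div h.ne' (hπ.pos _ s a).ne']
      nlinarith [mul_le_mul_of_nonneg_left (log_policy_ge hπ θ v s a) h.le]
  have h1 : ∀ s, M.statDist πstar s * ∑ a, (πstar s a).toReal *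
      Real.log ((πstar s a).toReal / (π (θ + v) s a).toReal) ≤
      M.statDist πstar s * (∑ a, (πstar s a).toReal *
        Real.log ((πstar s a).toReal / (π θ s a).toReal))
        - (∑ a, inner ℝ (M.occ πstar s a • score π θ s a) v)
        + M.statDist πstar s * (G₂ / 2 * ‖v‖ ^ 2) := by
    intro s
    have h2 := mul_le_mul_of_nonneg_left (sum_le_sum fun a (_ : a ∈ univ) => hpt s a)
      (statDist_nonneg M πstar s)
    refine h2.trans_eq ?_
    simp only [sum_add_distrib, sum_sub_distrib, ← sum_mul, sum_toReal, one_mul, mul_add, mul_sub,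
      real_inner_smul_left, CMDP.occ, mul_assoc, ← mul_sum]
  refine (sum_le_sum fun s _ => h1 s).trans_eq ?_
  simp only [sum_add_distrib, sum_sub_distrib, ← sum_mul, sum_statDist, one_mul, ← sum_inner]
  rfl

theorem avgKL_nonneg (hπ : ScoreBounds π G₁ G₂) (πstar : Policy S A)
    (θ : EuclideanSpace ℝ (Fin d)) : 0 ≤ M.avgKL πstar (π θ) := by
  refine sum_nonneg fun s _ => mul_nonneg (statDist_nonneg M πstar s) ?_
  have h : ∀ a, (πstar s a).toReal - (π θ s a).toReal ≤
      (πstar s a).toReal * Real.log ((πstar s a).toReal / (π θ s a).toReal) := by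
    intro a
    have hp := hπ.pos θ s a
    rcases (ENNReal.toReal_nonneg (a := πstar s a)).eq_or_lt with h | h
    · simp [← h]
    · have h1 := Real.log_le_sub_one_of_pos (div_pos hp h)
      have h2 : Real.log ((πstar s a).toReal / (π θ s a).toReal) =
          - Real.log ((π θ s a).toReal / (πstar s a).toReal) := by
        rw [← Real.log_inv, inv_div]
      rw [h2]
      have h3 := mul_le_mul_of_nonneg_left h1 h.le
      rw [mul_sub, mul_div_cancel₀ _ h.ne'] at h3
      linarith
  refine le_trans ?_ (sum_le_sum fun a _ => h a)
  rw [sum_sub_distrib, sum_toReal, sum_toReal, sub_self]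

end KullbackLeibler
end PDNAC

namespace PDNAC


/-! ### Error of one epoch, drift of the potential and telescoping. -/

section Epoch

variable {S A : Type*} [Fintype S] [DecidableEq S] [Fintype A] {d m : ℕ}

/-- The assumptions on the model together with the smallness conditions on the step sizes; `τ`
bounds the mixing times. -/
structure IsRegular (M : CMDP S A) (π : PolicyClass S A d) (φ : Features S m)
    (πstar : Policy S A) (p : Params) (G₁ G₂ μ κ εbias τ : ℝ) : Prop where
  G₁_pos : 0 < G₁
  G₂_pos : 0 < G₂
  μ_pos : 0 < μ
  κ_pos : 0 < κ
  δ_pos : 0 < p.δ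
  cγ_ge : κ / 2 + 1 / (2 * κ) ≤ p.cγ
  feat : ∀ g s, ‖φ g s‖ ≤ 1
  erg : M.IsErgodic
  errFin : M.CriticErrFinite π φ p.cγ
  posDef : M.CriticPosDef π φ κ
  opt : M.IsOptimal πstar
  bias : M.BiasBound π πstar p.δ εbias
  score : ScoreBounds π G₁ G₂
  fisher : M.FisherNonDeg π μ
  mix : ∀ θ, M.mixTime (π θ) ≤ τ
  one_le_τ : 1 ≤ τ
  T_ne : p.Tmax ≠ 0
  γξ_pos : 0 < p.γξ
  γω_pos : 0 < p.γω
  critic_T : 192 * τ * (p.cγ + 3) ≤ κ / 2 * p.Tmax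
  critic_γ : p.γξ * (20000 * (Nat.log 2 p.Tmax + 1) * τ ^ 2 * (p.cγ + 3) ^ 2) ≤ κ / 2
  actor_T : 192 * τ * max (G₁ ^ 2) μ ≤ μ * p.Tmax
  actor_γ : p.γω * (20000 * (Nat.log 2 p.Tmax + 1) * τ ^ 2 * max (G₁ ^ 2) μ ^ 2) ≤ μ

/-- Bound on the norm of the critic limit. -/
noncomputable def criticRadius (p : Params) (κ : ℝ) : ℝ := (p.cγ + 1) / (κ / 2)

/-- Bound on the bias of the critic. -/
noncomputable def criticBias (p : Params) (κ τ : ℝ) : ℝ :=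
  ((1 - p.γξ * (κ / 2) / 2) ^ p.H + 128 * τ * (p.cγ + 3) / (κ / 2 * p.Tmax)) * criticRadius p κ

/-- Bound on the relative bias of the actor given the critic. -/
noncomputable def actorBias (p : Params) (G₁ μ τ : ℝ) : ℝ :=
  (1 - p.γω * μ / 2) ^ p.H + 128 * τ * max (G₁ ^ 2) μ / (μ * p.Tmax)

/-- Bound on the bias of the natural gradient estimate. -/
noncomputable def gradientBias (p : Params) (G₁ μ κ τ εapp : ℝ) : ℝ :=
  actorBias p G₁ μ τ * (G₁ / μ * (1 + 12 * criticRadius p κ))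
    + (3 * G₁ * criticBias p κ τ + 2 * G₁ * Real.sqrt εapp) / μ

/-- Bound on the second moment of the natural gradient estimate. -/
noncomputable def gradientSq (p : Params) (G₁ μ κ : ℝ) : ℝ :=
  (G₁ / μ) ^ 2 * (20 + 1800 * criticRadius p κ ^ 2)

variable {M : CMDP S A} {π : PolicyClass S A d} {φ : Features S m} {πstar : Policy S A}
  {p : Params} {G₁ G₂ μ κ εbias τ : ℝ}

theorem IsRegular.criticRadius_pos (h : IsRegular M π φ πstar p G₁ G₂ μ κ εbias τ) :
    0 < criticRadius p κ := by
  have := h.κ_pos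
  have : 0 < p.cγ := lt_of_lt_of_le (by positivity) h.cγ_ge
  unfold criticRadius
  positivity

/-- The law of the critic output. -/
noncomputable def CMDP.criticLaw (M : CMDP S A) (φ : Features S m) (p : Params)
    (π : PolicyClass S A d) (θ : EuclideanSpace ℝ (Fin d)) (s : S) :
    PMF ((Sig → CriticVec m) × S) :=
  iter (M.criticStep φ p (π θ)) p.H (fun _ => 0, s)

/-- The law of the actor output given the critic. -/
noncomputable def CMDP.actorLaw (M : CMDP S A) (φ : Features S m) (p : Params)
    (π : PolicyClass S A d) (θ : EuclideanSpace ℝ (Fin d)) (y : (Sig → CriticVec m) × S) :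
    PMF ((Sig → EuclideanSpace ℝ (Fin d)) × S) :=
  iter (M.actorStep φ p π θ y.1) p.H (fun _ => 0, y.2)

instance instFinSuppCriticLaw (M : CMDP S A) (φ : Features S m) (p : Params)
    (π : PolicyClass S A d) (θ : EuclideanSpace ℝ (Fin d)) (s : S) :
    FinSupp (M.criticLaw φ p π θ s) := instFinSuppIter _ _ _

instance instFinSuppActorLaw (M : CMDP S A) (φ : Features S m) (p : Params)
    (π : PolicyClass S A d) (θ : EuclideanSpace ℝ (Fin d)) (y : (Sig → CriticVec m) × S) :
    FinSupp (M.actorLaw φ p π θ y) := instFinSuppIter _ _ _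

theorem IsRegular.critic_sq_le (h : IsRegular M π φ πstar p G₁ G₂ μ κ εbias τ) (g : Sig)
    (θ : EuclideanSpace ℝ (Fin d)) (s : S) :
    mean (M.criticLaw φ p π θ s) (fun y => ‖criticEuclid (y.1 g)‖ ^ 2) ≤
      10 * criticRadius p κ ^ 2 := by
  have hSA := critic_isLinearSA h.feat h.κ_pos h.cγ_ge h.posDef g θ
  have h1 := hSA.mean_iter_sq_le h.erg (h.mix θ) h.one_le_τ h.T_ne h.γξ_pos h.critic_T h.critic_γ
    (criticStep_map M φ p (π θ) g) (x := (fun _ => 0, s)) (map_zero _) p.H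
  have h2 := pow_le_pow_left₀ (norm_nonneg _) hSA.norm_sol_le 2
  have h3 : ∀ y ∈ (M.criticLaw φ p π θ s).support, ‖criticEuclid (y.1 g)‖ ^ 2 ≤
      2 * ‖criticEuclid (y.1 g) - criticEuclid (M.criticOpt φ p.cγ g (π θ))‖ ^ 2
        + 2 * ‖criticEuclid (M.criticOpt φ p.cγ g (π θ))‖ ^ 2 := by
    intro y _
    have := norm_add_sq_le_two (criticEuclid (y.1 g) - criticEuclid (M.criticOpt φ p.cγ g (π θ)))
      (criticEuclid (M.criticOpt φ p.cγ g (π θ)))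
    rwa [sub_add_cancel] at this
  refine (mean_mono h3).trans ?_
  rw [mean_add, mean_const, mean_const_mul]
  unfold criticRadius
  simp only [CMDP.criticLaw]
  linarith

theorem IsRegular.critic_bias_le (h : IsRegular M π φ πstar p G₁ G₂ μ κ εbias τ) (g : Sig)
    (θ : EuclideanSpace ℝ (Fin d)) (s : S) :
    ‖mean (M.criticLaw φ p π θ s) (fun y =>
      criticEuclid (y.1 g) - criticEuclid (M.criticOpt φ p.cγ g (π θ)))‖ ≤ criticBias p κ τ :=
  (critic_isLinearSA h.feat h.κ_pos h.cγ_ge h.posDef g θ).norm_mean_iter_sub_le h.erg (h.mix θ)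
    h.one_le_τ h.T_ne h.γξ_pos h.critic_T h.critic_γ
    (criticStep_map M φ p (π θ) g) (x := (fun _ => 0, s)) (map_zero _) p.H

theorem IsRegular.critic_head_sq_le (h : IsRegular M π φ πstar p G₁ G₂ μ κ εbias τ) (g : Sig)
    (θ : EuclideanSpace ℝ (Fin d)) (s : S) :
    mean (M.criticLaw φ p π θ s) (fun y => y.1 g (Sum.inl ()) ^ 2) ≤
      10 * criticRadius p κ ^ 2 := by
  refine (mean_mono fun y _ => ?_).trans (h.critic_sq_le g θ s)
  rw [← sq_abs]
  exact pow_le_pow_left₀ (abs_nonneg _) (abs_head_le _) 2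

theorem IsRegular.critic_head_bias_le (h : IsRegular M π φ πstar p G₁ G₂ μ κ εbias τ) (g : Sig)
    (θ : EuclideanSpace ℝ (Fin d)) (s : S) :
    |mean (M.criticLaw φ p π θ s) (fun y => y.1 g (Sum.inl ())) - M.J g (π θ)| ≤
      criticBias p κ τ := by
  have h1 := mean_linear (M.criticLaw φ p π θ s)
    ((LinearMap.proj (R := ℝ) (φ := fun _ : Unit ⊕ Fin m => ℝ) (Sum.inl ())) ∘ₗ
      (criticEuclid (m := m)).symm.toLinearMap)
    (fun y => criticEuclid (y.1 g) - criticEuclid (M.criticOpt φ p.cγ g (π θ)))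
  have h2 : ∀ y : (Sig → CriticVec m) × S,
      ((LinearMap.proj (R := ℝ) (φ := fun _ : Unit ⊕ Fin m => ℝ) (Sum.inl ())) ∘ₗ
      (criticEuclid (m := m)).symm.toLinearMap)
      (criticEuclid (y.1 g) - criticEuclid (M.criticOpt φ p.cγ g (π θ))) =
      y.1 g (Sum.inl ()) - M.J g (π θ) := by
    intro y
    rw [← criticOpt_head h.erg h.feat h.κ_pos h.cγ_ge h.posDef]
    rfl
  simp_rw [h2] at h1
  rw [mean_sub, mean_const] at h1
  rw [h1]
  refine le_trans ?_ (h.critic_bias_le g θ s)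
  set v := mean (M.criticLaw φ p π θ s)
    (fun y => criticEuclid (y.1 g) - criticEuclid (M.criticOpt φ p.cγ g (π θ)))
  have h3 := abs_head_le ((criticEuclid (m := m)).symm v)
  rwa [LinearEquiv.apply_symm_apply] at h3

theorem IsRegular.actor_sq_le (h : IsRegular M π φ πstar p G₁ G₂ μ κ εbias τ) (g : Sig)
    (θ : EuclideanSpace ℝ (Fin d)) (y : (Sig → CriticVec m) × S) :
    mean (M.actorLaw φ p π θ y) (fun w => ‖w.1 g‖ ^ 2) ≤
      10 * (G₁ * (1 + 3 * ‖criticEuclid (y.1 g)‖) / μ) ^ 2 := by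
  obtain ⟨L, hL⟩ := exists_fisherInv h.μ_pos h.fisher θ
  have hSA := actor_isLinearSA h.feat h.μ_pos h.G₁_pos h.score h.fisher g θ (y.1 g) hL
  have h1 := hSA.mean_iter_sq_le h.erg (h.mix θ) h.one_le_τ h.T_ne h.γω_pos h.actor_T h.actor_γ
    (actorStep_map M φ p π θ y.1 g) (x := (fun _ => 0, y.2)) rfl p.H
  have h2 := pow_le_pow_left₀ (norm_nonneg _) hSA.norm_sol_le 2
  set xs := L (M.statMean (π θ) fun z => M.tdErr φ g (y.1 g) z • PDNAC.score π θ z.1 z.2.1)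
  have h3 : ∀ w ∈ (M.actorLaw φ p π θ y).support, ‖w.1 g‖ ^ 2 ≤
      2 * ‖w.1 g - xs‖ ^ 2 + 2 * ‖xs‖ ^ 2 := by
    intro w _
    have := norm_add_sq_le_two (w.1 g - xs) xs
    rwa [sub_add_cancel] at this
  refine (mean_mono h3).trans ?_
  rw [mean_add, mean_const, mean_const_mul]
  simp only [CMDP.actorLaw]
  linarith

theorem IsRegular.actor_bias_le (h : IsRegular M π φ πstar p G₁ G₂ μ κ εbias τ) (g : Sig)
    (θ : EuclideanSpace ℝ (Fin d)) (y : (Sig → CriticVec m) × S)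
    {L : EuclideanSpace ℝ (Fin d) →ₗ[ℝ] EuclideanSpace ℝ (Fin d)}
    (hL : ∀ v, M.fisherOp π θ (L v) = v) :
    ‖mean (M.actorLaw φ p π θ y) (fun w => w.1 g)
      - L (M.statMean (π θ) fun z => M.tdErr φ g (y.1 g) z • PDNAC.score π θ z.1 z.2.1)‖ ≤
      actorBias p G₁ μ τ * (G₁ * (1 + 3 * ‖criticEuclid (y.1 g)‖) / μ) := by
  have h1 := (actor_isLinearSA h.feat h.μ_pos h.G₁_pos h.score h.fisher g θ (y.1 g)
    hL).norm_mean_iter_sub_le h.erg (h.mix θ) h.one_le_τ h.T_ne h.γω_pos h.actor_T h.actor_γ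
    (actorStep_map M φ p π θ y.1 g) (x := (fun _ => 0, y.2)) rfl p.H
  rwa [mean_sub, mean_const] at h1

/-- The joint law of the critic and actor outputs of an epoch. -/
noncomputable def CMDP.innerLaw (M : CMDP S A) (φ : Features S m) (p : Params)
    (π : PolicyClass S A d) (θ : EuclideanSpace ℝ (Fin d)) (s : S) :
    PMF ((Sig → CriticVec m) × (Sig → EuclideanSpace ℝ (Fin d)) × S) :=
  (M.criticLaw φ p π θ s).bind fun y => (M.actorLaw φ p π θ y).map fun w => (y.1, w)

instance instFinSuppInnerLaw (M : CMDP S A) (φ : Features S m) (p : Params)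
    (π : PolicyClass S A d) (θ : EuclideanSpace ℝ (Fin d)) (s : S) :
    FinSupp (M.innerLaw φ p π θ s) := instFinSuppBind _ _

theorem mean_innerLaw {F : Type*} [NormedAddCommGroup F] [NormedSpace ℝ F]
    (θ : EuclideanSpace ℝ (Fin d)) (s : S)
    (f : (Sig → CriticVec m) × (Sig → EuclideanSpace ℝ (Fin d)) × S → F) :
    mean (M.innerLaw φ p π θ s) f =
      mean (M.criticLaw φ p π θ s) fun y => mean (M.actorLaw φ p π θ y) fun w => f (y.1, w) := by
  rw [CMDP.innerLaw, mean_bind]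
  simp_rw [mean_map]

/-- Conditionally on the critic the bound is quadratic in its norm, `10 (1 + 3x)² ≤ 20 + 180 x²`;
the second moment `10 R²` of the critic gives the `1800`. -/
theorem IsRegular.gradient_sq_le (h : IsRegular M π φ πstar p G₁ G₂ μ κ εbias τ) (g : Sig)
    (θ : EuclideanSpace ℝ (Fin d)) (s : S) :
    mean (M.innerLaw φ p π θ s) (fun u => ‖u.2.1 g‖ ^ 2) ≤ gradientSq p G₁ μ κ := by
  rw [mean_innerLaw]
  have h1 : ∀ y ∈ (M.criticLaw φ p π θ s).support,
      mean (M.actorLaw φ p π θ y) (fun w => ‖w.1 g‖ ^ 2) ≤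
      (G₁ / μ) ^ 2 * 20 + (G₁ / μ) ^ 2 * 180 * ‖criticEuclid (y.1 g)‖ ^ 2 := by
    intro y _
    refine (h.actor_sq_le g θ y).trans ?_
    have h2 : (G₁ * (1 + 3 * ‖criticEuclid (y.1 g)‖) / μ) ^ 2 =
        (G₁ / μ) ^ 2 * (1 + 3 * ‖criticEuclid (y.1 g)‖) ^ 2 := by ring
    have h3 : (1 + 3 * ‖criticEuclid (y.1 g)‖) ^ 2 ≤ 2 + 18 * ‖criticEuclid (y.1 g)‖ ^ 2 := by
      nlinarith [sq_nonneg (1 - 3 * ‖criticEuclid (y.1 g)‖)]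
    rw [h2]
    nlinarith [mul_le_mul_of_nonneg_left h3 (sq_nonneg (G₁ / μ))]
  refine (mean_mono h1).trans ?_
  rw [mean_add, mean_const, mean_const_mul]
  have h2 := mul_le_mul_of_nonneg_left (h.critic_sq_le g θ s)
    (show 0 ≤ (G₁ / μ) ^ 2 * 180 by positivity)
  unfold gradientSq
  linarith

theorem IsRegular.actorBias_nonneg (h : IsRegular M π φ πstar p G₁ G₂ μ κ εbias τ) :
    0 ≤ actorBias p G₁ μ τ := by
  have hμ := h.μ_pos
  have hτ := h.one_le_τ
  obtain ⟨L, hL⟩ := exists_fisherInv h.μ_pos h.fisher 0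
  have h1 := ((actor_isLinearSA (M := M) h.feat h.μ_pos h.G₁_pos h.score h.fisher .r 0 0
    hL).step_size h.one_le_τ h.γω_pos h.actor_γ).2
  have h2 : 0 < max (G₁ ^ 2) μ := lt_max_of_lt_right hμ
  have h3 : 0 ≤ (1 - p.γω * μ / 2) ^ p.H := pow_nonneg (by linarith) _
  unfold actorBias
  positivity

/-- Three sources are separated: the actor's own bias given the critic, the critic's mean error sent
through the linear map `L ∘ tdOp`, and the approximation error at the critic limit. The inverse
Fisher operator costs `1/μ`. -/
theorem IsRegular.gradient_bias_le (h : IsRegular M π φ πstar p G₁ G₂ μ κ εbias τ) (g : Sig)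
    (θ : EuclideanSpace ℝ (Fin d)) (s : S)
    {L : EuclideanSpace ℝ (Fin d) →ₗ[ℝ] EuclideanSpace ℝ (Fin d)}
    (hL : ∀ v, M.fisherOp π θ (L v) = v) :
    ‖mean (M.innerLaw φ p π θ s) (fun u => u.2.1 g) - L (M.advMean π g θ)‖ ≤
      gradientBias p G₁ μ κ τ (M.epsApp π φ p.cγ) := by
  have hμ := h.μ_pos
  have hG := h.G₁_pos
  have hR := h.criticRadius_pos
  have hLn : ∀ v, ‖L v‖ ≤ ‖v‖ / μ := fun v => by
    have := norm_le_div_of_mono h.μ_pos (fisherOp_mono h.fisher θ) (L v)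
    rwa [hL] at this
  set ξs := M.criticOpt φ p.cγ g (π θ) with hξs
  set t : CriticVec m → EuclideanSpace ℝ (Fin d) := fun ξ =>
    M.statMean (π θ) fun z => M.tdErr φ g ξ z • PDNAC.score π θ z.1 z.2.1 with ht
  rw [mean_innerLaw]
  have hsplit : mean (M.criticLaw φ p π θ s) (fun y => mean (M.actorLaw φ p π θ y) fun w => w.1 g)
      - L (M.advMean π g θ) =
      mean (M.criticLaw φ p π θ s)
        (fun y => mean (M.actorLaw φ p π θ y) (fun w => w.1 g) - L (t (y.1 g)))
      + (- L (M.tdOp φ π g θ (mean (M.criticLaw φ p π θ s)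
          fun y => criticEuclid (y.1 g) - criticEuclid ξs)))
      + L (t ξs - M.advMean π g θ) := by
    have h1 : ∀ y : (Sig → CriticVec m) × S, L (t (y.1 g)) = L (t ξs)
        - L (M.tdOp φ π g θ (criticEuclid (y.1 g) - criticEuclid ξs)) := by
      intro y
      rw [← map_sub, ht]
      exact congrArg L (statMean_tdErr_smul M φ π g θ (y.1 g) ξs)
    simp_rw [h1]
    rw [mean_sub, mean_sub, mean_const, map_sub]
    have h2 := mean_linear (M.criticLaw φ p π θ s) (L ∘ₗ M.tdOp φ π g θ)
      fun y => criticEuclid (y.1 g) - criticEuclid ξs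
    simp only [LinearMap.comp_apply] at h2
    rw [h2]
    abel
  rw [hsplit]
  have h1 : ‖mean (M.criticLaw φ p π θ s)
        (fun y => mean (M.actorLaw φ p π θ y) (fun w => w.1 g) - L (t (y.1 g)))‖ ≤
      actorBias p G₁ μ τ * (G₁ / μ * (1 + 12 * criticRadius p κ)) := by
    refine (norm_mean_le _).trans ((mean_mono fun y _ => h.actor_bias_le g θ y hL).trans ?_)
    rw [mean_const_mul]
    refine mul_le_mul_of_nonneg_left ?_ h.actorBias_nonneg
    have h2 : ∀ y : (Sig → CriticVec m) × S, G₁ * (1 + 3 * ‖criticEuclid (y.1 g)‖) / μ =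
        G₁ / μ + (G₁ / μ * 3) * ‖criticEuclid (y.1 g)‖ := fun y => by ring
    simp_rw [h2]
    rw [mean_add, mean_const, mean_const_mul]
    have h3 : mean (M.criticLaw φ p π θ s) (fun y => ‖criticEuclid (y.1 g)‖) ≤
        4 * criticRadius p κ := by
      -- Passing from the second to the first moment uses `10 ≤ 4²`.
      refine mean_le_of_sq_le (by positivity) ((h.critic_sq_le g θ s).trans ?_)
      nlinarith [sq_nonneg (criticRadius p κ)]
    have h4 := mul_le_mul_of_nonneg_left h3 (show 0 ≤ G₁ / μ * 3 by positivity)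
    linarith
  have h2 : ‖- L (M.tdOp φ π g θ (mean (M.criticLaw φ p π θ s)
      fun y => criticEuclid (y.1 g) - criticEuclid ξs))‖ ≤ 3 * G₁ * criticBias p κ τ / μ := by
    rw [norm_neg]
    refine (hLn _).trans (div_le_div_of_nonneg_right ?_ hμ.le)
    exact (norm_tdOp_le h.feat h.score g θ _).trans
      (mul_le_mul_of_nonneg_left (h.critic_bias_le g θ s) (by positivity))
  have h3 : ‖L (t ξs - M.advMean π g θ)‖ ≤
      2 * G₁ * Real.sqrt (M.epsApp π φ p.cγ) / μ :=
    (hLn _).trans (div_le_div_of_nonneg_right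
      (norm_statMean_tdErr_sub_advMean_le h.erg h.feat h.score h.κ_pos h.cγ_ge h.posDef h.errFin
        g θ) hμ.le)
  refine (norm_add_le _ _).trans ((add_le_add ((norm_add_le _ _).trans (add_le_add h1 h2))
    h3).trans_eq ?_)
  unfold gradientBias
  ring

theorem sq_proj_sub_le {b l : ℝ} (hl : l ∈ Set.Icc 0 b) (x : ℝ) :
    (max 0 (min b x) - l) ^ 2 ≤ (x - l) ^ 2 := by
  obtain ⟨h0, h1⟩ := hl
  rcases le_total x 0 with hx | hx
  · rw [min_eq_right (by linarith), max_eq_left hx]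
    nlinarith
  · rcases le_total b x with hb | hb
    · rw [min_eq_left hb, max_eq_right (by linarith)]
      nlinarith
    · rw [min_eq_right hb, max_eq_right hx]

/-- The Lyapunov function of the primal-dual iteration at the multiplier `l`. -/
noncomputable def CMDP.potential (M : CMDP S A) (π : PolicyClass S A d) (πstar : Policy S A)
    (p : Params) (l : ℝ) (x : EuclideanSpace ℝ (Fin d) × ℝ × S) : ℝ :=
  M.avgKL πstar (π x.1) / p.α + (x.2.1 - l) ^ 2 / (2 * p.β)

/-- The error made by one epoch. -/
noncomputable def epochErr (p : Params) (G₁ G₂ μ κ εbias εapp τ : ℝ) : ℝ :=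
  Real.sqrt εbias + G₁ * (1 + 2 / p.δ) * gradientBias p G₁ μ κ τ εapp
    + G₂ * p.α * (1 + (2 / p.δ) ^ 2) * gradientSq p G₁ μ κ
    + 2 / p.δ * criticBias p κ τ + 5 * p.β * criticRadius p κ ^ 2

theorem epoch_eq (x : EuclideanSpace ℝ (Fin d) × ℝ × S) :
    M.epoch φ p π x = (M.innerLaw φ p π x.1 x.2.2).map fun u =>
      (x.1 + p.α • (u.2.1 .r + x.2.1 • u.2.1 .c),
        max 0 (min (2 / p.δ) (x.2.1 - p.β * u.1 .c (Sum.inl ()))), u.2.2) := by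
  rw [CMDP.innerLaw, PMF.map_bind]
  simp only [PMF.map_comp]
  rfl

instance instFinSuppEpoch (x : EuclideanSpace ℝ (Fin d) × ℝ × S) :
    FinSupp (M.epoch φ p π x) := by
  rw [epoch_eq]; infer_instance

/-- The KL part falls by the Lagrangian gap at the current dual variable `lam`, the dual part by
`(lam - l) J_c`. In the sum the terms `lam J_c(θ)` cancel, leaving the gap at `l` and the term `lam
J_c^{π*}`, which is nonnegative because `πstar` is feasible and is dropped. -/
theorem IsRegular.potential_drift (h : IsRegular M π φ πstar p G₁ G₂ μ κ εbias τ)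
    (hα : 0 < p.α) (hβ : 0 < p.β) {l : ℝ} (hl : l ∈ Set.Icc 0 (2 / p.δ))
    {x : EuclideanSpace ℝ (Fin d) × ℝ × S} (hx : x.2.1 ∈ Set.Icc 0 (2 / p.δ)) :
    mean (M.epoch φ p π x) (M.potential π πstar p l) ≤ M.potential π πstar p l x
      - (M.J .r πstar - M.J .r (π x.1) - l * M.J .c (π x.1))
      + epochErr p G₁ G₂ μ κ εbias (M.epsApp π φ p.cγ) τ := by
  obtain ⟨θ, lam, s⟩ := x
  simp only at hx
  have hG := h.G₁_pos
  have hG₂ := h.G₂_pos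
  obtain ⟨L, hL⟩ := exists_fisherInv h.μ_pos h.fisher θ
  set I := M.innerLaw φ p π θ s with hI
  set us := M.meanScore π πstar θ with hus
  have hD : 0 ≤ 2 / p.δ := hl.1.trans hl.2
  have hpt : ∀ u ∈ I.support, M.potential π πstar p l
      (θ + p.α • (u.2.1 .r + lam • u.2.1 .c),
        max 0 (min (2 / p.δ) (lam - p.β * u.1 .c (Sum.inl ()))), u.2.2) ≤
      M.potential π πstar p l (θ, lam, s) - inner ℝ us (u.2.1 .r + lam • u.2.1 .c)
      + G₂ * p.α * (‖u.2.1 .r‖ ^ 2 + (2 / p.δ) ^ 2 * ‖u.2.1 .c‖ ^ 2)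
      - (lam - l) * u.1 .c (Sum.inl ()) + p.β / 2 * u.1 .c (Sum.inl ()) ^ 2 := by
    intro u _
    simp only [CMDP.potential]
    have h1 := avgKL_add_le (M := M) h.score πstar θ (p.α • (u.2.1 .r + lam • u.2.1 .c))
    rw [inner_smul_right, norm_smul, mul_pow, Real.norm_of_nonneg hα.le] at h1
    have h2 : ‖u.2.1 .r + lam • u.2.1 .c‖ ^ 2 ≤
        2 * (‖u.2.1 .r‖ ^ 2 + (2 / p.δ) ^ 2 * ‖u.2.1 .c‖ ^ 2) := by
      refine (norm_add_sq_le_two _ _).trans ?_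
      rw [norm_smul, mul_pow, Real.norm_of_nonneg hx.1]
      have := mul_le_mul_of_nonneg_right (pow_le_pow_left₀ hx.1 hx.2 2) (sq_nonneg ‖u.2.1 .c‖)
      linarith
    have h3 : M.avgKL πstar (π (θ + p.α • (u.2.1 .r + lam • u.2.1 .c))) / p.α ≤
        M.avgKL πstar (π θ) / p.α - inner ℝ us (u.2.1 .r + lam • u.2.1 .c)
        + G₂ * p.α * (‖u.2.1 .r‖ ^ 2 + (2 / p.δ) ^ 2 * ‖u.2.1 .c‖ ^ 2) := by
      rw [div_le_iff₀ hα]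
      refine h1.trans ?_
      have h4 := mul_le_mul_of_nonneg_left h2 (show 0 ≤ G₂ / 2 * p.α ^ 2 by positivity)
      have h5 : M.avgKL πstar (π θ) / p.α * p.α = M.avgKL πstar (π θ) :=
        div_mul_cancel₀ _ hα.ne'
      nlinarith
    have h4 := sq_proj_sub_le hl (lam - p.β * u.1 .c (Sum.inl ()))
    have h5 : (max 0 (min (2 / p.δ) (lam - p.β * u.1 .c (Sum.inl ()))) - l) ^ 2 / (2 * p.β) ≤
        (lam - l) ^ 2 / (2 * p.β) - (lam - l) * u.1 .c (Sum.inl ())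
          + p.β / 2 * u.1 .c (Sum.inl ()) ^ 2 := by
      refine (div_le_div_of_nonneg_right h4 (by positivity)).trans_eq ?_
      field_simp
      ring
    linarith
  rw [epoch_eq, mean_map]
  refine (mean_mono hpt).trans ?_
  simp only [mean_add, mean_sub, mean_const, mean_const_mul, mean_inner, mean_smul]
  have hsq := fun g => h.gradient_sq_le g θ s
  have hb := fun g => h.gradient_bias_le g θ s hL
  -- The dual step uses the critic only, so the actor is integrated out.
  have hη : mean I (fun u => u.1 .c (Sum.inl ())) =
      mean (M.criticLaw φ p π θ s) fun y => y.1 .c (Sum.inl ()) := by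
    rw [hI, mean_innerLaw]
    simp only [mean_const]
  have hη2 : mean I (fun u => u.1 .c (Sum.inl ()) ^ 2) =
      mean (M.criticLaw φ p π θ s) fun y => y.1 .c (Sum.inl ()) ^ 2 := by
    rw [hI, mean_innerLaw]
    simp only [mean_const]
  have hηb := h.critic_head_bias_le .c θ s
  have hηs := h.critic_head_sq_le .c θ s
  rw [← hη] at hηb
  rw [← hη2] at hηs
  set η := mean I (fun u => u.1 .c (Sum.inl ())) with hηdef
  have hgap := lagrangian_gap_le h.erg h.bias θ hx
    (ω := L (M.advMean π .r θ) + lam • L (M.advMean π .c θ)) (by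
      rw [map_add, map_smul, hL, hL])
  rw [← hus] at hgap
  have hinner : inner ℝ us (L (M.advMean π .r θ) + lam • L (M.advMean π .c θ))
      - G₁ * (1 + 2 / p.δ) * gradientBias p G₁ μ κ τ (M.epsApp π φ p.cγ) ≤
      inner ℝ us (mean I (fun u => u.2.1 .r) + lam • mean I fun u => u.2.1 .c) := by
    have h1 : mean I (fun u => u.2.1 .r) + (lam • mean I fun u => u.2.1 .c) =
        (L (M.advMean π .r θ) + lam • L (M.advMean π .c θ)) +
        ((mean I (fun u => u.2.1 .r) - L (M.advMean π .r θ))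
          + lam • (mean I (fun u => u.2.1 .c) - L (M.advMean π .c θ))) := by
      rw [smul_sub]
      abel
    rw [h1, inner_add_right us (L (M.advMean π .r θ) + lam • L (M.advMean π .c θ))]
    set v := (mean I (fun u => u.2.1 .r) - L (M.advMean π .r θ))
          + lam • (mean I (fun u => u.2.1 .c) - L (M.advMean π .c θ)) with hv
    have h2 : ‖v‖ ≤ (1 + 2 / p.δ) * gradientBias p G₁ μ κ τ (M.epsApp π φ p.cγ) := by
      refine (norm_add_le _ _).trans ?_
      rw [norm_smul, Real.norm_of_nonneg hx.1, add_mul, one_mul]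
      exact add_le_add (hb .r) (mul_le_mul hx.2 (hb .c) (norm_nonneg _) hD)
    have h3 := (abs_le.1 (abs_real_inner_le_norm us v)).1
    have h4 := mul_le_mul (norm_meanScore_le (M := M) h.score πstar θ) h2 (norm_nonneg _) hG.le
    rw [← hus] at h4
    linarith
  have hdual : -((lam - l) * η) ≤ -((lam - l) * M.J .c (π θ)) + 2 / p.δ * criticBias p κ τ := by
    have h1 : |lam - l| ≤ 2 / p.δ := by
      rw [abs_le]
      constructor <;> linarith [hx.1, hx.2, hl.1, hl.2]
    have h2 : |(lam - l) * (η - M.J .c (π θ))| ≤ 2 / p.δ * criticBias p κ τ := by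
      rw [abs_mul]
      exact mul_le_mul h1 hηb (abs_nonneg _) hD
    have h3 := (abs_le.1 h2).1
    linarith
  have hJc : 0 ≤ lam * M.J .c πstar := mul_nonneg hx.1 h.opt.1
  have hsq2 : G₂ * p.α * (mean I (fun u => ‖u.2.1 .r‖ ^ 2)
      + (2 / p.δ) ^ 2 * mean I (fun u => ‖u.2.1 .c‖ ^ 2)) ≤
      G₂ * p.α * (1 + (2 / p.δ) ^ 2) * gradientSq p G₁ μ κ := by
    rw [mul_assoc (G₂ * p.α)]
    refine mul_le_mul_of_nonneg_left ?_ (by positivity)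
    have := mul_le_mul_of_nonneg_left (hsq .c) (sq_nonneg (2 / p.δ))
    linarith [hsq .r]
  have hβη := mul_le_mul_of_nonneg_left hηs (show 0 ≤ p.β / 2 by positivity)
  unfold epochErr
  linarith

instance instFinSuppAlgLaw (θ₀ : EuclideanSpace ℝ (Fin d)) (k : ℕ) :
    FinSupp (M.algLaw φ p π θ₀ k) := instFinSuppBind _ _

theorem algLaw_succ (θ₀ : EuclideanSpace ℝ (Fin d)) (k : ℕ) :
    M.algLaw φ p π θ₀ (k + 1) = (M.algLaw φ p π θ₀ k).bind (M.epoch φ p π) := by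
  simp only [CMDP.algLaw, iter, PMF.bind_bind]

theorem dual_mem_of_mem_support (hδ : 0 < p.δ) (θ₀ : EuclideanSpace ℝ (Fin d)) (k : ℕ)
    {x : EuclideanSpace ℝ (Fin d) × ℝ × S} (hx : x ∈ (M.algLaw φ p π θ₀ k).support) :
    x.2.1 ∈ Set.Icc 0 (2 / p.δ) := by
  have hD : 0 ≤ 2 / p.δ := by positivity
  cases k with
  | zero =>
    simp only [CMDP.algLaw, iter, PMF.mem_support_bind_iff, PMF.mem_support_pure_iff] at hx
    obtain ⟨s, -, rfl⟩ := hx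
    exact ⟨le_rfl, hD⟩
  | succ k =>
    rw [algLaw_succ, PMF.mem_support_bind_iff] at hx
    obtain ⟨y, -, hy⟩ := hx
    rw [epoch_eq, PMF.mem_support_map_iff] at hy
    obtain ⟨u, -, rfl⟩ := hy
    exact ⟨le_max_left _ _, max_le hD (min_le_left _ _)⟩

/-- Telescoping the drift: the initial dual variable `0` yields `l² / (2β)`, and the final potential
is nonnegative by Gibbs' inequality. -/
theorem IsRegular.sum_gap_le (h : IsRegular M π φ πstar p G₁ G₂ μ κ εbias τ)
    (hα : 0 < p.α) (hβ : 0 < p.β) {l : ℝ} (hl : l ∈ Set.Icc 0 (2 / p.δ))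
    (θ₀ : EuclideanSpace ℝ (Fin d)) (K : ℕ) :
    ∑ k ∈ range K, mean (M.algLaw φ p π θ₀ k)
      (fun x => M.J .r πstar - M.J .r (π x.1) - l * M.J .c (π x.1)) ≤
      M.avgKL πstar (π θ₀) / p.α + l ^ 2 / (2 * p.β)
        + K * epochErr p G₁ G₂ μ κ εbias (M.epsApp π φ p.cγ) τ := by
  have key : ∀ K : ℕ, ∑ k ∈ range K, mean (M.algLaw φ p π θ₀ k)
      (fun x => M.J .r πstar - M.J .r (π x.1) - l * M.J .c (π x.1))
      + mean (M.algLaw φ p π θ₀ K) (M.potential π πstar p l) ≤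
      M.avgKL πstar (π θ₀) / p.α + l ^ 2 / (2 * p.β)
        + K * epochErr p G₁ G₂ μ κ εbias (M.epsApp π φ p.cγ) τ := by
    intro K
    induction K with
    | zero =>
      simp only [range_zero, sum_empty, Nat.cast_zero, zero_mul, add_zero, zero_add]
      refine mean_le_of_le fun x hx => ?_
      simp only [CMDP.algLaw, iter, PMF.mem_support_bind_iff, PMF.mem_support_pure_iff] at hx
      obtain ⟨s, -, rfl⟩ := hx
      simp [CMDP.potential]
    | succ K ih =>
      have h1 : mean (M.algLaw φ p π θ₀ (K + 1)) (M.potential π πstar p l) ≤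
          mean (M.algLaw φ p π θ₀ K) (M.potential π πstar p l)
          - mean (M.algLaw φ p π θ₀ K)
            (fun x => M.J .r πstar - M.J .r (π x.1) - l * M.J .c (π x.1))
          + epochErr p G₁ G₂ μ κ εbias (M.epsApp π φ p.cγ) τ := by
        rw [algLaw_succ, mean_bind]
        refine (mean_mono fun x hx => h.potential_drift hα hβ hl
          (dual_mem_of_mem_support h.δ_pos θ₀ K hx)).trans_eq ?_
        rw [mean_add, mean_sub, mean_const]
      rw [sum_range_succ]
      push_cast
      linarith
  refine le_trans ?_ (key K)
  refine le_add_of_nonneg_right (le_mean_of_le fun x _ => ?_)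
  exact add_nonneg (div_nonneg (avgKL_nonneg h.score πstar x.1) hα.le) (by positivity)

end Epoch
end PDNAC

namespace PDNAC


/-! ### The parameter schedule, the burn-in condition and the constants. -/

section Schedule

theorem half_le_log {T : ℕ} (hT : 2 ≤ T) : 1 / 2 ≤ Real.log T := by
  have h1 : Real.log 2 ≤ Real.log T :=
    Real.log_le_log (by norm_num) (by exact_mod_cast hT)
  linarith [Real.log_two_gt_d9]

theorem natLog_add_one_le {T : ℕ} (hT : 2 ≤ T) :
    (Nat.log 2 T : ℝ) + 1 ≤ 4 * Real.log T := by
  have h1 : ((2 : ℝ) ^ Nat.log 2 T) ≤ T := by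
    exact_mod_cast Nat.pow_log_le_self 2 (by omega)
  have h2 := Real.log_le_log (by positivity) h1
  rw [Real.log_pow] at h2
  have h3 : (0 : ℝ) ≤ Nat.log 2 T := Nat.cast_nonneg _
  nlinarith [Real.log_two_gt_d9, half_le_log hT]

/-- Rounding a number above `1` either way leaves a positive integer, so at most a factor `2` is
lost. -/
theorem le_two_mul_of_abs_sub_lt {n : ℕ} {x : ℝ} (hx : 1 < x) (h : |(n : ℝ) - x| < 1) :
    x ≤ 2 * n := by
  have h1 := (abs_lt.1 h).1
  have h2 : (0 : ℝ) < n := by linarith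
  have h3 : (1 : ℝ) ≤ n := by exact_mod_cast Nat.cast_pos.1 h2
  linarith

/-- The constant of the burn-in condition. -/
noncomputable def burnIn (G₁ μ κ cγ : ℝ) : ℝ :=
  1536 * (cγ + 3) / κ + 640000 * (cγ + 3) ^ 2 / κ ^ 2
    + 768 * max (G₁ ^ 2) μ / μ + 320000 * max (G₁ ^ 2) μ ^ 2 / μ ^ 2

/-- Here `768 = 4 · 192`, the `4` coming from `L² ≥ 1/4`. -/
theorem horizon_le {ρ Λ τ C₀ X L T : ℝ} (hρ : 0 < ρ) (hΛ : 0 < Λ) (hτ : 1 ≤ τ)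
    (hL : 1 / 2 ≤ L) (hC : 768 * Λ / ρ ≤ C₀) (hX : C₀ * τ ^ 2 * L ^ 2 ≤ X) (hXT : X ≤ T) :
    192 * τ * Λ ≤ ρ * T := by
  have h1 : 768 * Λ / ρ * (τ ^ 2 * L ^ 2) ≤ T := by
    refine le_trans ?_ (hX.trans hXT)
    rw [mul_assoc]
    exact mul_le_mul_of_nonneg_right hC (by positivity)
  have h2 : τ * (1 / 4) ≤ τ ^ 2 * L ^ 2 :=
    mul_le_mul (by nlinarith) (by nlinarith) (by norm_num) (by positivity)
  have h3 : 768 * Λ / ρ * (τ * (1 / 4)) ≤ T :=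
    (mul_le_mul_of_nonneg_left h2 (by positivity)).trans h1
  have h4 : 768 * Λ / ρ * (τ * (1 / 4)) = 192 * τ * Λ / ρ := by ring
  rw [h4, div_le_iff₀ hρ] at h3
  linarith

/-- Two constants `ρ` and `ρ'` are needed since the critic contracts at rate `κ/2` while its step
size is normalised by `κ`. The burn-in pays for `L²`: one logarithm from the step size, one from the
number of MLMC levels. -/
theorem stepSize_le {ρ ρ' Λ τ C₀ X L J H : ℝ} (hρ : 0 < ρ) (hρ' : 0 < ρ') (hΛ : 0 < Λ)
    (hτ : 1 ≤ τ) (hL : 1 / 2 ≤ L) (hJ : J ≤ 4 * L) (hH : 0 < H) (hXH : X ≤ 2 * H)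
    (hC : 320000 * Λ ^ 2 / (ρ * ρ') ≤ C₀) (hX : C₀ * τ ^ 2 * L ^ 2 ≤ X) :
    2 * L / (ρ' * H) * (20000 * J * τ ^ 2 * Λ ^ 2) ≤ ρ := by
  have h1 : 320000 * Λ ^ 2 / (ρ * ρ') * (τ ^ 2 * L ^ 2) ≤ 2 * H := by
    refine le_trans ?_ (hX.trans hXH)
    rw [mul_assoc]
    exact mul_le_mul_of_nonneg_right hC (by positivity)
  rw [div_mul_eq_mul_div, div_le_iff₀ (by positivity)] at h1
  rw [div_mul_eq_mul_div, div_le_iff₀ (by positivity)]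
  have h2 : 20000 * J * τ ^ 2 * Λ ^ 2 ≤ 20000 * (4 * L) * τ ^ 2 * Λ ^ 2 := by gcongr
  have h3 := mul_le_mul_of_nonneg_left h2 (show 0 ≤ 2 * L by linarith)
  nlinarith

theorem one_sub_pow_le {x r : ℝ} {n : ℕ} (hx : x ≤ 1) (h : Real.exp (-(n * x)) ≤ r) :
    (1 - x) ^ n ≤ r := by
  refine le_trans ?_ h
  have h1 := pow_le_pow_left₀ (sub_nonneg.2 hx) (Real.one_sub_le_exp_neg x) n
  rwa [← Real.exp_nat_mul, mul_neg] at h1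

/-- Coefficient of `T^{-1/2}` in the bias of the critic. -/
noncomputable def criticCoeff (κ cγ τ : ℝ) : ℝ :=
  (1 + 256 * τ * (cγ + 3) / κ) * ((cγ + 1) / (κ / 2))

/-- Coefficient of `T^{-1/2}` in the error of an epoch. -/
noncomputable def epochCoeff (G₁ G₂ μ κ cγ δ τ : ℝ) : ℝ :=
  G₁ * (1 + 2 / δ) * ((1 + 128 * τ * max (G₁ ^ 2) μ / μ) *
      (G₁ / μ * (1 + 12 * ((cγ + 1) / (κ / 2)))) + 3 * G₁ * criticCoeff κ cγ τ / μ)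
    + G₂ * (1 + (2 / δ) ^ 2) * ((G₁ / μ) ^ 2 * (20 + 1800 * ((cγ + 1) / (κ / 2)) ^ 2))
    + 2 / δ * criticCoeff κ cγ τ + 5 * ((cγ + 1) / (κ / 2)) ^ 2

/-- The constant of the rate. -/
noncomputable def rateConst (G₁ G₂ μ κ cγ δ τ kl : ℝ) : ℝ :=
  1 + G₁ * (1 + 2 / δ) * (2 * G₁ / μ) + epochCoeff G₁ G₂ μ κ cγ δ τ + 2 * kl + 4 / δ ^ 2

variable {S A : Type*} [Fintype S] [DecidableEq S] [Fintype A] {d m : ℕ}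
  {M : CMDP S A} {π : PolicyClass S A d} {φ : Features S m} {πstar : Policy S A}
  {p : Params} {G₁ G₂ μ κ εbias τ : ℝ}

theorem IsRegular.epochErr_le (h : IsRegular M π φ πstar p G₁ G₂ μ κ εbias τ) {r : ℝ}
    (hα : p.α = r) (hβ : p.β = r) (hT : 1 / (p.Tmax : ℝ) ≤ r)
    (hξ : Real.exp (-(p.H * (p.γξ * (κ / 2) / 2))) ≤ r)
    (hω : Real.exp (-(p.H * (p.γω * μ / 2))) ≤ r) :
    epochErr p G₁ G₂ μ κ εbias (M.epsApp π φ p.cγ) τ ≤ Real.sqrt εbias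
      + G₁ * (1 + 2 / p.δ) * (2 * G₁ / μ) * Real.sqrt (M.epsApp π φ p.cγ)
      + epochCoeff G₁ G₂ μ κ p.cγ p.δ τ * r := by
  have hμ := h.μ_pos
  have hG := h.G₁_pos
  have hκ := h.κ_pos
  have hδ := h.δ_pos
  have hτ := h.one_le_τ
  have hR := h.criticRadius_pos
  have hcγ : 0 < p.cγ := lt_of_lt_of_le (by positivity) h.cγ_ge
  have hΛ : 0 < max (G₁ ^ 2) μ := lt_max_of_lt_right hμ
  obtain ⟨L, hL⟩ := exists_fisherInv h.μ_pos h.fisher 0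
  have h1 := ((actor_isLinearSA (M := M) h.feat h.μ_pos h.G₁_pos h.score h.fisher .r 0 0
    hL).step_size h.one_le_τ h.γω_pos h.actor_γ).2
  have h2 := ((critic_isLinearSA h.feat h.κ_pos h.cγ_ge h.posDef .r 0).step_size h.one_le_τ
    h.γξ_pos h.critic_γ).2
  have hc : criticBias p κ τ ≤ criticCoeff κ p.cγ τ * r := by
    have h3 := one_sub_pow_le (by linarith) hξ
    have h4 : 128 * τ * (p.cγ + 3) / (κ / 2 * p.Tmax) ≤ 256 * τ * (p.cγ + 3) / κ * r := by
      have h5 : 128 * τ * (p.cγ + 3) / (κ / 2 * p.Tmax) =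
          256 * τ * (p.cγ + 3) / κ * (1 / p.Tmax) := by
        rw [div_mul_div_comm]
        rw [div_eq_div_iff]
        · ring
        · have := h.T_ne; positivity
        · have := h.T_ne; positivity
      rw [h5]
      exact mul_le_mul_of_nonneg_left hT (by positivity)
    have h5 := mul_le_mul_of_nonneg_right (add_le_add h3 h4) hR.le
    refine h5.trans_eq ?_
    unfold criticCoeff criticRadius
    ring
  have ha : actorBias p G₁ μ τ ≤ (1 + 128 * τ * max (G₁ ^ 2) μ / μ) * r := by
    have h3 := one_sub_pow_le (by linarith) hω
    have h4 : 128 * τ * max (G₁ ^ 2) μ / (μ * p.Tmax) ≤ 128 * τ * max (G₁ ^ 2) μ / μ * r := by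
      have h5 : 128 * τ * max (G₁ ^ 2) μ / (μ * p.Tmax) =
          128 * τ * max (G₁ ^ 2) μ / μ * (1 / p.Tmax) := by
        rw [div_mul_div_comm, mul_one]
      rw [h5]
      exact mul_le_mul_of_nonneg_left hT (by positivity)
    refine (add_le_add h3 h4).trans_eq ?_
    ring
  have hg : gradientBias p G₁ μ κ τ (M.epsApp π φ p.cγ) ≤
      ((1 + 128 * τ * max (G₁ ^ 2) μ / μ) * (G₁ / μ * (1 + 12 * ((p.cγ + 1) / (κ / 2))))
        + 3 * G₁ * criticCoeff κ p.cγ τ / μ) * r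
      + 2 * G₁ / μ * Real.sqrt (M.epsApp π φ p.cγ) := by
    unfold gradientBias
    have h3 := mul_le_mul_of_nonneg_right ha
      (show 0 ≤ G₁ / μ * (1 + 12 * criticRadius p κ) by positivity)
    have h4 : (3 * G₁ * criticBias p κ τ + 2 * G₁ * Real.sqrt (M.epsApp π φ p.cγ)) / μ ≤
        (3 * G₁ * (criticCoeff κ p.cγ τ * r) + 2 * G₁ * Real.sqrt (M.epsApp π φ p.cγ)) / μ := by
      gcongr
    refine (add_le_add h3 h4).trans_eq ?_
    unfold criticRadius
    ring
  have h3 := mul_le_mul_of_nonneg_left hg (show 0 ≤ G₁ * (1 + 2 / p.δ) by positivity)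
  have h4 := mul_le_mul_of_nonneg_left hc (show 0 ≤ 2 / p.δ by positivity)
  have h5 : epochCoeff G₁ G₂ μ κ p.cγ p.δ τ * r =
      G₁ * (1 + 2 / p.δ) * (((1 + 128 * τ * max (G₁ ^ 2) μ / μ) *
        (G₁ / μ * (1 + 12 * ((p.cγ + 1) / (κ / 2)))) + 3 * G₁ * criticCoeff κ p.cγ τ / μ) * r)
      + G₂ * r * (1 + (2 / p.δ) ^ 2) * gradientSq p G₁ μ κ
      + 2 / p.δ * (criticCoeff κ p.cγ τ * r) + 5 * r * criticRadius p κ ^ 2 := by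
    unfold epochCoeff gradientSq criticRadius
    ring
  rw [h5]
  unfold epochErr
  rw [hα, hβ]
  linarith

theorem epochCoeff_nonneg {cγ δ : ℝ} (hG₁ : 0 < G₁) (hG₂ : 0 < G₂) (hμ : 0 < μ) (hκ : 0 < κ)
    (hcγ : 0 < cγ) (hδ : 0 < δ) (hτ : 0 ≤ τ) : 0 ≤ epochCoeff G₁ G₂ μ κ cγ δ τ := by
  have hΛ : 0 < max (G₁ ^ 2) μ := lt_max_of_lt_right hμ
  have h1 : 0 ≤ criticCoeff κ cγ τ := by unfold criticCoeff; positivity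
  unfold epochCoeff
  positivity

/-- The averaged Lagrangian gap at a multiplier `l ∈ [0, 2/δ]`. -/
theorem IsRegular.average_gap_le (h : IsRegular M π φ πstar p G₁ G₂ μ κ εbias τ) {r ρ : ℝ}
    (hr : 0 < r) (hα : p.α = r) (hβ : p.β = r) (hT : 1 / (p.Tmax : ℝ) ≤ r)
    (hξ : Real.exp (-(p.H * (p.γξ * (κ / 2) / 2))) ≤ r)
    (hω : Real.exp (-(p.H * (p.γω * μ / 2))) ≤ r)
    {K : ℕ} (hK : 0 < K) (hrρ : r ≤ ρ) (hKρ : (K : ℝ)⁻¹ * r⁻¹ ≤ 2 * ρ) {l : ℝ}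
    (hl : l ∈ Set.Icc 0 (2 / p.δ)) (θ₀ : EuclideanSpace ℝ (Fin d)) :
    (K : ℝ)⁻¹ * ∑ k ∈ range K, mean (M.algLaw φ p π θ₀ k)
      (fun x => M.J .r πstar - M.J .r (π x.1) - l * M.J .c (π x.1)) ≤
      rateConst G₁ G₂ μ κ p.cγ p.δ τ (M.avgKL πstar (π θ₀)) *
        (Real.sqrt εbias + Real.sqrt (M.epsApp π φ p.cγ) + ρ) := by
  have hμ := h.μ_pos
  have hG := h.G₁_pos
  have hδ := h.δ_pos
  have hcγ : 0 < p.cγ := by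
    have := h.κ_pos
    exact lt_of_lt_of_le (by positivity) h.cγ_ge
  have hK0 : (0 : ℝ) < K := by exact_mod_cast hK
  have h1 := h.sum_gap_le (hα ▸ hr) (hβ ▸ hr) hl θ₀ K
  have h2 := mul_le_mul_of_nonneg_left h1 (inv_nonneg.2 hK0.le)
  refine h2.trans ?_
  set kl := M.avgKL πstar (π θ₀) with hkl
  have hkl0 : 0 ≤ kl := avgKL_nonneg h.score πstar θ₀
  have h3 := h.epochErr_le hα hβ hT hξ hω
  set Err := epochErr p G₁ G₂ μ κ εbias (M.epsApp π φ p.cγ) τ with hErr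
  have h4 : (K : ℝ)⁻¹ * (kl / p.α + l ^ 2 / (2 * p.β) + K * Err) =
      (K : ℝ)⁻¹ * r⁻¹ * (kl + l ^ 2 / 2) + Err := by
    rw [hα, hβ]
    field_simp
  rw [h4]
  have h5 : l ^ 2 / 2 ≤ 2 / p.δ ^ 2 := by
    have h6 := pow_le_pow_left₀ hl.1 hl.2 2
    have h7 : (2 / p.δ) ^ 2 / 2 = 2 / p.δ ^ 2 := by ring
    linarith
  have h6 : (K : ℝ)⁻¹ * r⁻¹ * (kl + l ^ 2 / 2) ≤ 2 * ρ * (kl + 2 / p.δ ^ 2) :=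
    mul_le_mul hKρ (by linarith) (by positivity) (by linarith)
  have hE := epochCoeff_nonneg hG h.G₂_pos hμ h.κ_pos hcγ hδ (zero_le_one.trans h.one_le_τ)
  set c₁ := G₁ * (1 + 2 / p.δ) * (2 * G₁ / μ) with hc₁
  set c₂ := epochCoeff G₁ G₂ μ κ p.cγ p.δ τ with hc₂
  have hc₁0 : 0 ≤ c₁ := by positivity
  have h7 := mul_le_mul_of_nonneg_left hrρ hE
  have hρ : 0 ≤ ρ := hr.le.trans hrρ
  have hb := Real.sqrt_nonneg εbias
  have ha := Real.sqrt_nonneg (M.epsApp π φ p.cγ)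
  have h8 : rateConst G₁ G₂ μ κ p.cγ p.δ τ kl = 1 + c₁ + c₂ + 2 * kl + 4 / p.δ ^ 2 := rfl
  rw [h8]
  set q := 2 / p.δ ^ 2 with hq
  have hq4 : 4 / p.δ ^ 2 = 2 * q := by rw [hq]; ring
  have hq0 : 0 ≤ q := by positivity
  rw [hq4]
  have e1 : 0 ≤ (c₁ + c₂ + 2 * kl + 2 * q) * Real.sqrt εbias := by positivity
  have e2 : 0 ≤ (1 + c₂ + 2 * kl + 2 * q) * Real.sqrt (M.epsApp π φ p.cγ) := by positivity
  have e3 : 0 ≤ (1 + c₁) * ρ := by positivity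
  nlinarith

theorem rateConst_nonneg {cγ δ kl : ℝ} (hG₁ : 0 < G₁) (hG₂ : 0 < G₂) (hμ : 0 < μ) (hκ : 0 < κ)
    (hcγ : 0 < cγ) (hδ : 0 < δ) (hτ : 0 ≤ τ) (hkl : 0 ≤ kl) :
    0 ≤ rateConst G₁ G₂ μ κ cγ δ τ kl := by
  have := epochCoeff_nonneg hG₁ hG₂ hμ hκ hcγ hδ hτ
  unfold rateConst
  positivity

/-- Under the Slater condition the averaged constraint violation is dominated by the averaged
Lagrangian gap at the multiplier `2/δ`. -/
theorem average_violation_le (hM : M.IsErgodic) (hopt : M.IsOptimal πstar) {δ R : ℝ}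
    (hδ : δ ∈ Set.Ioo (0 : ℝ) 1) (hslater : M.Slater π δ) (hR : 0 ≤ R)
    (θ₀ : EuclideanSpace ℝ (Fin d)) {K : ℕ}
    (h : (K : ℝ)⁻¹ * ∑ k ∈ range K, mean (M.algLaw φ p π θ₀ k)
      (fun x => M.J .r πstar - M.J .r (π x.1) - 2 / δ * M.J .c (π x.1)) ≤ R) :
    (K : ℝ)⁻¹ * ∑ k ∈ range K, mean (M.algLaw φ p π θ₀ k) (fun x => - M.J .c (π x.1)) ≤ R := by
  obtain ⟨θ, hθ⟩ := hslater
  obtain ⟨l, hl, hgap⟩ := exists_multiplier hM hopt hδ.1 hθ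
  set v := (K : ℝ)⁻¹ * ∑ k ∈ range K, mean (M.algLaw φ p π θ₀ k) (fun x => - M.J .c (π x.1))
    with hv
  -- Duality bounds the reward gap below by `l J_c`, so the Lagrangian gap at `2/δ` dominates `2/δ -
  -- l ≥ 1/δ ≥ 1` times the violation.
  have h1 : (2 / δ - l) * v ≤ R := by
    refine le_trans ?_ h
    rw [hv, mul_left_comm, mul_sum]
    refine mul_le_mul_of_nonneg_left (sum_le_sum fun k _ => ?_) (by positivity)
    rw [← mean_const_mul]
    refine mean_mono fun x _ => ?_
    linarith [hgap (π x.1)]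
  have h2 : 1 ≤ 1 / δ := by rw [le_div_iff₀ hδ.1]; linarith [hδ.2]
  have h3 : 2 / δ = 1 / δ + 1 / δ := by ring
  rcases le_total v 0 with h4 | h4
  · exact h4.trans hR
  · nlinarith

end Schedule
end PDNAC

/-! ### Assembly of the two bounds. -/

theorem mainTheorem2 (G₁ G₂ μ κ cγ δ : ℝ) (hG₁ : 0 < G₁) (hG₂ : 0 < G₂) (hμ : 0 < μ)
    (hκ : 0 < κ) (hcγ : κ + Real.sqrt (1 / κ ^ 2 - 1) ≤ cγ) (hδ : δ ∈ Set.Ioo (0 : ℝ) 1) :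
    ∃ C₀ : ℝ, 0 < C₀ ∧ ∃ p₀ p : ℕ, ∃ C : ℕ → ℝ → ℝ,
    ∀ (S A : Type*) [Fintype S] [DecidableEq S] [Fintype A] (d m : ℕ)
      (M : PDNAC.CMDP S A) (π : PDNAC.PolicyClass S A d) (φ : PDNAC.Features S m)
      (πstar : PDNAC.Policy S A) (θ₀ : EuclideanSpace ℝ (Fin d)) (εbias : ℝ),
      (∀ g s, ‖φ g s‖ ≤ 1) →
      M.Slater π δ →
      M.IsErgodic →
      M.CriticErrFinite π φ cγ →
      M.CriticPosDef π φ κ →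
      M.IsOptimal πstar →
      M.BiasBound π πstar δ εbias →
      PDNAC.ScoreBounds π G₁ G₂ →
      M.FisherNonDeg π μ →
      ∀ (ε : ℝ) (T H K : ℕ), ε ∈ Set.Ioo (0 : ℝ) 1 → 2 ≤ T →
        |(H : ℝ) - (T : ℝ) ^ ε| < 1 →
        |(K : ℝ) - (T : ℝ) ^ (1 - ε)| < 1 →
        C₀ * (M.tauMix π : ℝ) ^ 2 * Real.log T ^ p₀ ≤ (T : ℝ) ^ ε →
        let prm : PDNAC.Params :=
          { α := (T : ℝ) ^ (-(1 / 2) : ℝ)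
            β := (T : ℝ) ^ (-(1 / 2) : ℝ)
            γω := 2 * Real.log T / (μ * H)
            γξ := 2 * Real.log T / (κ * H)
            cγ := cγ
            δ := δ
            H := H
            Tmax := T }
        let rate : ℝ := C (M.tauMix π) (M.avgKL πstar (π θ₀)) * Real.log T ^ p *
          (Real.sqrt εbias + Real.sqrt (M.epsApp π φ cγ) + (T : ℝ) ^ (-(1 / 2 - ε)))
        (K : ℝ)⁻¹ * ∑ k ∈ Finset.range K, PDNAC.expect (M.algLaw φ prm π θ₀ k)
            (fun x => M.J .r πstar - M.J .r (π x.1)) ≤ rate ∧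
        (K : ℝ)⁻¹ * ∑ k ∈ Finset.range K, PDNAC.expect (M.algLaw φ prm π θ₀ k)
            (fun x => - M.J .c (π x.1)) ≤ rate := by
  have hcγ' := PDNAC.half_add_inv_le hκ hcγ
  have hcγ0 : 0 < cγ := lt_of_lt_of_le (by positivity) hcγ'
  have hΛ : 0 < max (G₁ ^ 2) μ := lt_max_of_lt_right hμ
  have hb₁ : 0 < 1536 * (cγ + 3) / κ := by positivity
  have hb₂ : 0 < 640000 * (cγ + 3) ^ 2 / κ ^ 2 := by positivity
  have hb₃ : 0 < 768 * max (G₁ ^ 2) μ / μ := by positivity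
  have hb₄ : 0 < 320000 * max (G₁ ^ 2) μ ^ 2 / μ ^ 2 := by positivity
  -- The choice `p₀ = 2` covers `stepSize_le`. No logarithm is needed in the rate (`p = 0`), because
  -- the logarithmic second moment of MLMC is absorbed by the burn-in condition.
  refine ⟨PDNAC.burnIn G₁ μ κ cγ, by unfold PDNAC.burnIn; positivity, 2, 0,
    fun τ kl => PDNAC.rateConst G₁ G₂ μ κ cγ δ τ kl, ?_⟩
  intro S A _ _ _ d m M π φ πstar θ₀ εbias hfeat hslater herg herr hpos hopt hbias hscore hfisher
    ε T H K hε hT hH hK hburn prm rate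
  have hT0 : (0 : ℝ) < T := by positivity
  have hT1 : (1 : ℝ) < T := by exact_mod_cast (by omega : 1 < T)
  have hL := PDNAC.half_le_log hT
  have hL0 : 0 < Real.log T := by linarith
  have hτ : (1 : ℝ) ≤ M.tauMix π := by exact_mod_cast PDNAC.one_le_tauMix herg π
  have hXH := PDNAC.le_two_mul_of_abs_sub_lt (Real.one_lt_rpow hT1 hε.1) hH
  have hXK := PDNAC.le_two_mul_of_abs_sub_lt (Real.one_lt_rpow hT1 (sub_pos.2 hε.2)) hK
  have hH0 : (0 : ℝ) < H := by
    have := Real.rpow_pos_of_pos hT0 ε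
    linarith
  have hK0 : (0 : ℝ) < K := by
    have := Real.rpow_pos_of_pos hT0 (1 - ε)
    linarith
  have hXT : (T : ℝ) ^ ε ≤ T := by
    simpa using Real.rpow_le_rpow_of_exponent_le hT1.le hε.2.le
  have hJ := PDNAC.natLog_add_one_le hT
  have hreg : PDNAC.IsRegular M π φ πstar prm G₁ G₂ μ κ εbias (M.tauMix π) :=
    { G₁_pos := hG₁
      G₂_pos := hG₂
      μ_pos := hμ
      κ_pos := hκ
      δ_pos := hδ.1
      cγ_ge := hcγ'
      feat := hfeat
      erg := herg
      errFin := herr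
      posDef := hpos
      opt := hopt
      bias := hbias
      score := hscore
      fisher := hfisher
      mix := fun θ => by exact_mod_cast PDNAC.mixTime_le_tauMix herg π θ
      one_le_τ := hτ
      T_ne := (by omega : T ≠ 0)
      γξ_pos := show 0 < 2 * Real.log T / (κ * H) by positivity
      γω_pos := show 0 < 2 * Real.log T / (μ * H) by positivity
      critic_T := PDNAC.horizon_le (half_pos hκ) (by positivity) hτ hL
        (by
          have : 768 * (cγ + 3) / (κ / 2) = 1536 * (cγ + 3) / κ := by field_simp; norm_num
          rw [this]; unfold PDNAC.burnIn; linarith) hburn hXT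
      critic_γ := PDNAC.stepSize_le (half_pos hκ) hκ (by positivity) hτ hL hJ hH0 hXH
        (by
          have : 320000 * (cγ + 3) ^ 2 / (κ / 2 * κ) = 640000 * (cγ + 3) ^ 2 / κ ^ 2 := by
            field_simp; norm_num
          rw [this]; unfold PDNAC.burnIn; linarith) hburn
      actor_T := PDNAC.horizon_le hμ hΛ hτ hL (by unfold PDNAC.burnIn; linarith) hburn hXT
      actor_γ := PDNAC.stepSize_le hμ hμ hΛ hτ hL hJ hH0 hXH
        (by rw [← pow_two]; unfold PDNAC.burnIn; linarith) hburn }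
  have hinv : 1 / (T : ℝ) ≤ (T : ℝ) ^ (-(1 / 2) : ℝ) := by
    rw [one_div, ← Real.rpow_neg_one]
    exact Real.rpow_le_rpow_of_exponent_le hT1.le (by norm_num)
  -- The critic contracts at rate `κ/4` per unit of step size, so `H` steps give exactly `T^{-1/2}`.
  -- The actor's rate `μ/2` gives `1/T`.
  have hξ : Real.exp (-(H * (2 * Real.log T / (κ * H) * (κ / 2) / 2))) ≤
      (T : ℝ) ^ (-(1 / 2) : ℝ) := by
    rw [Real.rpow_def_of_pos hT0]
    refine Real.exp_le_exp.2 (le_of_eq ?_)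
    field_simp
  have hω : Real.exp (-(H * (2 * Real.log T / (μ * H) * μ / 2))) ≤
      (T : ℝ) ^ (-(1 / 2) : ℝ) := by
    have h1 : -(H * (2 * Real.log T / (μ * H) * μ / 2)) = -Real.log T := by field_simp
    rwa [h1, Real.exp_neg, Real.exp_log hT0, ← one_div]
  have hrρ : (T : ℝ) ^ (-(1 / 2) : ℝ) ≤ (T : ℝ) ^ (-(1 / 2 - ε)) :=
    Real.rpow_le_rpow_of_exponent_le hT1.le (by linarith [hε.1])
  have hKρ : (K : ℝ)⁻¹ * ((T : ℝ) ^ (-(1 / 2) : ℝ))⁻¹ ≤ 2 * (T : ℝ) ^ (-(1 / 2 - ε)) := by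
    rw [← mul_inv, inv_le_iff_one_le_mul₀ (by positivity)]
    -- The initial potential contributes `1/(Kα)`, and with `K ≈ T^{1-ε}` the exponents balance at
    -- `-(1/2 - ε)`; this term determines the rate.
    have h1 : (T : ℝ) ^ (-(1 / 2 - ε)) * (T : ℝ) ^ (-(1 / 2) : ℝ) * (T : ℝ) ^ (1 - ε) = 1 := by
      rw [← Real.rpow_add hT0, ← Real.rpow_add hT0, ← Real.rpow_zero (T : ℝ)]
      congr 1
      ring
    have h2 := mul_le_mul_of_nonneg_left hXK
      (show 0 ≤ (T : ℝ) ^ (-(1 / 2 - ε)) * (T : ℝ) ^ (-(1 / 2) : ℝ) by positivity)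
    rw [h1] at h2
    linarith
  have hgap := fun (l : ℝ) (hl : l ∈ Set.Icc 0 (2 / δ)) =>
    hreg.average_gap_le (Real.rpow_pos_of_pos hT0 _) rfl rfl hinv hξ hω (Nat.cast_pos.1 hK0)
      hrρ hKρ hl θ₀
  have hrate : rate = PDNAC.rateConst G₁ G₂ μ κ cγ δ (M.tauMix π) (M.avgKL πstar (π θ₀)) *
      (Real.sqrt εbias + Real.sqrt (M.epsApp π φ cγ) + (T : ℝ) ^ (-(1 / 2 - ε))) := by
    simp only [rate, pow_zero, mul_one]
  have hrate0 : 0 ≤ rate := by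
    rw [hrate]
    exact mul_nonneg (PDNAC.rateConst_nonneg hG₁ hG₂ hμ hκ hcγ0 hδ.1 (zero_le_one.trans hτ)
      (PDNAC.avgKL_nonneg hscore πstar θ₀)) (by positivity)
  have hδ2 : 0 ≤ 2 / δ := div_nonneg zero_le_two hδ.1.le
  refine ⟨?_, PDNAC.average_violation_le herg hopt hδ hslater hrate0 θ₀
    ((hgap (2 / δ) ⟨hδ2, le_rfl⟩).trans_eq hrate.symm)⟩
  have h0 := (hgap 0 ⟨le_rfl, hδ2⟩).trans_eq hrate.symm
  simpa only [zero_mul, sub_zero, ← PDNAC.expect_eq_mean] using h0
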